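/- **Conventions.** Let $k$ be a field; $\otimes=\otimes_k$, a vector space also denotes its identity map, and for $f:V\otimes W\to V'\otimes W'$ we write $f^{13}:V\otimes Z\otimes W\to V'\otimes Z\otimes W'$ for $f$ acting on the first and third legs. $\langle X\rangle$ is the linear span of $X$. *Weak multiplier bialgebras.* Let $A$ be a (not necessarily unital) associative $k$-algebra with multiplication $\mu$ that is idempotent ($\mu:A\otimes A\to A$ is surjective) and non-degenerate ($aA=0$ implies $a=0$, and $Aa=0$ implies $a=0$). A *multiplier* of $A$ is a pair $m=(l,r)$ of linear maps $A\to A$, written $ma:=l(a)$, $am:=r(a)$, with $a(mb)=(am)b$ for all $a,b\in A$; multipliers form a unital algebra $\mathbb M(A)$ in which $(l,r)(l',r')=(ll',r'r)$. A *weak multiplier bialgebra* structure on $A$ consists of linear maps $E_1,E_2,T_1,T_2:A\otimes A\to A\otimes A$ and $\epsilon:A\to k$ such that, for all $a,b,c,d\in A$: 1. $(a\otimes b)E_1(c\otimes d)=E_2(a\otimes b)(c\otimes d)$; 2. $E_1^2=E_1$; 3. $(T_2\otimes A)(A\otimes T_1)=(A\otimes T_1)(T_2\otimes A)$; 4. $(\epsilon\otimes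 A)T_1=\mu=(A\otimes\epsilon)T_2$; 5. $(\mu\otimes A)T_1^{13}(A\otimes T_1)=T_1(\mu\otimes A)$; 6. $\langle T_1(a\otimes c)(b\otimes 1)\mid a,b,c\in A\rangle=\langle E_1(b\otimes c)\mid b,c\in A\rangle$ and $\langle (1\otimes c)T_2(b\otimes a)\mid a,b,c\in A\rangle=\langle E_2(b\otimes c)\mid b,c\in A\rangle$; 7. $(A\otimes E_2)(T_2\otimes A)=(T_2\otimes A)(A\otimes E_2)$ and $(A\otimes E_1)(T_1\otimes A)=(T_1\otimes A)E_1^{13}$; 8. $(\epsilon\otimes A)((1\otimes a)E_1(b\otimes c))=(\epsilon\otimes A)(T_1(a\otimes c)(b\otimes 1))$ and $(\epsilon\otimes A)(E_2(a\otimes b)(1\otimes c))=(\epsilon\otimes A)((1\otimes b)T_2(a\otimes c))$. (With the comultiplication $\Delta$ and the canonical idempotent multiplier $E$ of $A\otimes A$ one has $T_1(a\otimes b)=\Delta(a)(1\otimes b)$, $T_2(a\otimes b)=(a\otimes 1)\Delta(b)$, $E_1(x)=Ex$, $E_2(x)=xE$.) It is *regular* if there are linear maps $T_3,T_4:A\otimes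 A\to A\otimes A$ with $(1\otimes a)T_1(c\otimes b)=T_3(c\otimes a)(1\otimes b)$ and $T_2(a\otimes c)(b\otimes 1)=(a\otimes 1)T_4(b\otimes c)$ for all $a,b,c\in A$. Its comultiplication is *right full* if $\langle (A\otimes\omega)T_1(a\otimes b)\mid a,b\in A,\ \omega\in\mathrm{Lin}(A,k)\rangle=A$. In the regular case there are linear maps $\overline\sqcap^R,\sqcap^R:A\to\mathbb M(A)$, $$\overline\sqcap^R(a)b=(A\otimes\epsilon)E_1(b\otimes a),\qquad b\,\overline\sqcap^R(a)=(A\otimes\epsilon)T_1(b\otimes a),$$ $$\sqcap^R(a)b=(A\otimes\epsilon)T_3(b\otimes a),\qquad b\,\sqcap^R(a)=(A\otimes\epsilon)E_2(b\otimes a).$$ The *base algebra* $R$ is the range of $\overline\sqcap^R$, a (non-unital) subalgebra of $\mathbb M(A)$. *Comodules.* A *right comodule* over $A$ is a $k$-vector space $V$ with linear maps $\lambda,\varrho:V\otimes A\to V\otimes A$ such that $(1\otimes a)\lambda(v\otimes b)=\varrho(v\otimes a)(1\otimes b)$ for all $v\in V$, $a,b\in A$, and $$(\lambda\otimes A)\lambda^{13}(V\otimes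 E_1)=(\lambda\otimes A)\lambda^{13},\qquad (\lambda\otimes A)\lambda^{13}(V\otimes T_1)=(V\otimes T_1)(\lambda\otimes A).$$ It is *full* if $V=\langle (V\otimes\omega)\lambda(v\otimes a)\mid v\in V,\ a\in A,\ \omega\in\mathrm{Lin}(A,k)\rangle$. A morphism $V\to W$ is a linear map $f$ with $\lambda_W(f\otimes A)=(f\otimes A)\lambda_V$ and $\varrho_W(f\otimes A)=(f\otimes A)\varrho_V$. The category of full right comodules is denoted by $M^{(A)}$. *Firm bimodules.* For a non-unital $k$-algebra $R$, a right $R$-module $M$ and a left $R$-module $N$, $M\otimes_R N$ is the quotient of $M\otimes N$ by $\langle mr\otimes n-m\otimes rn\rangle$. An $R$-bimodule $M$ is *firm* if the actions induce bijections $R\otimes_R M\to M$ and $M\otimes_R R\to M$; the algebra $R$ is *firm* if its multiplication induces a bijection $R\otimes_R R\to R$. If $R$ is firm, the firm $R$-bimodules (with the bimodule maps) form a monoidal category ${}_RM_R$ with product $\otimes_R$, unit $R$, the evident associator, and the unitors induced by the actions. **Theorem.** Let $A$ be a regular weak multiplier bialgebra over a field $k$ whose comultiplication is right full. Then: (a)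 $\sqcap^R$ and $\overline\sqcap^R$ have the same range $R$, and $R$ is a firm algebra. Every full right comodule $V$ is a firm $R$-bimodule via $$v\,\overline\sqcap^R(a)=(V\otimes\epsilon)\lambda(v\otimes a),\qquad \sqcap^R(a)\,v=(V\otimes\epsilon)\varrho(v\otimes a)\qquad(v\in V,\ a\in A),$$ and this gives a functor $U:M^{(A)}\to{}_RM_R$ that does not change the underlying vector spaces and linear maps. (b) $M^{(A)}$ is a monoidal category, as follows. The monoidal product of $V$ and $W$ is the vector space $V\otimes_R W$ with the full comodule structure induced, along the canonical epimorphism $V\otimes W\to V\otimes_R W$, by the maps $\lambda_V^{13}(V\otimes\lambda_W)$ and $(V\otimes\varrho_W)\varrho_V^{13}$ on $V\otimes W\otimes A$. The monoidal unit is $R$ with the full comodule structure $\lambda(r\otimes a)=E(1\otimes ra)$, $\varrho(r\otimes a)=(1\otimes ar)E$; here the right-hand sides are elements of $R\otimes A$ regarded as multipliers of $A\otimes A$, that is, for all $b\in A$, $\lambda(r\otimes a)(b\otimes 1)=E_1(b\otimes ra)$ and $(b\otimes 1)\varrho(r\otimes a)=E_2(b\otimes ar)$. (c) For this structure $U$ is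 strict monoidal: it preserves the monoidal unit, the monoidal product of objects and of morphisms, the associator and the unitors on the nose. -/

import Mathlib

open CategoryTheory MonoidalCategory
open scoped TensorProduct

universe u v

set_option linter.unusedSectionVars false
set_option linter.unusedVariables false

noncomputable section

namespace FirmBimodules

section RelTensor

variable {k : Type*} [Field k] {R M N P M' N' : Type*}
  [AddCommGroup R] [Module k R]
  [AddCommGroup M] [Module k M] [AddCommGroup N] [Module k N] [AddCommGroup P] [Module k P]
  [AddCommGroup M'] [Module k M'] [AddCommGroup N'] [Module k N']

/-- The subspace of `M ⊗ N` spanned by the elements `m r ⊗ n - m ⊗ r n`; here `ρ r m` is the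
right action `m r` on `M` and `l r n` is the left action `r n` on `N`. -/
def balanced (ρ : R →ₗ[k] M →ₗ[k] M) (l : R →ₗ[k] N →ₗ[k] N) : Submodule k (M ⊗[k] N) :=
  Submodule.span k {x | ∃ m r n, x = ρ r m ⊗ₜ[k] n - m ⊗ₜ[k] l r n}

/-- The module tensor product `M ⊗_R N` of a right and a left `R`-module. -/
def RelTensor (ρ : R →ₗ[k] M →ₗ[k] M) (l : R →ₗ[k] N →ₗ[k] N) :=
  (M ⊗[k] N) ⧸ balanced ρ l

instance (ρ : R →ₗ[k] M →ₗ[k] M) (l : R →ₗ[k] N →ₗ[k] N) : AddCommGroup (RelTensor ρ l) :=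
  inferInstanceAs (AddCommGroup ((M ⊗[k] N) ⧸ balanced ρ l))

instance (ρ : R →ₗ[k] M →ₗ[k] M) (l : R →ₗ[k] N →ₗ[k] N) : Module k (RelTensor ρ l) :=
  inferInstanceAs (Module k ((M ⊗[k] N) ⧸ balanced ρ l))

namespace RelTensor

/-- The canonical epimorphism `M ⊗ N → M ⊗_R N`. -/
def proj (ρ : R →ₗ[k] M →ₗ[k] M) (l : R →ₗ[k] N →ₗ[k] N) : M ⊗[k] N →ₗ[k] RelTensor ρ l :=
  (balanced ρ l).mkQ

variable {ρ : R →ₗ[k] M →ₗ[k] M} {l : R →ₗ[k] N →ₗ[k] N}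
  {ρ' : R →ₗ[k] M' →ₗ[k] M'} {l' : R →ₗ[k] N' →ₗ[k] N'}

theorem proj_surjective : Function.Surjective (proj ρ l) := Submodule.mkQ_surjective _

theorem proj_balanced (m : M) (r : R) (n : N) :
    proj ρ l (ρ r m ⊗ₜ n) = proj ρ l (m ⊗ₜ l r n) := by
  rw [← sub_eq_zero, ← map_sub]
  exact (Submodule.Quotient.mk_eq_zero _).2 (Submodule.subset_span ⟨m, r, n, rfl⟩)

/-- The universal property of `M ⊗_R N`. -/
def lift (f : M ⊗[k] N →ₗ[k] P) (h : ∀ m r n, f (ρ r m ⊗ₜ n) = f (m ⊗ₜ l r n)) :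
    RelTensor ρ l →ₗ[k] P :=
  (balanced ρ l).liftQ f (Submodule.span_le.2 (by
    rintro _ ⟨m, r, n, rfl⟩
    simp [h]))

@[simp] theorem lift_proj (f : M ⊗[k] N →ₗ[k] P) (h : ∀ m r n, f (ρ r m ⊗ₜ n) = f (m ⊗ₜ l r n))
    (x : M ⊗[k] N) : lift f h (proj ρ l x) = f x :=
  (balanced ρ l).liftQ_apply f x

theorem hom_ext {f g : RelTensor ρ l →ₗ[k] P}
    (h : ∀ m n, f (proj ρ l (m ⊗ₜ n)) = g (proj ρ l (m ⊗ₜ n))) : f = g := by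
  apply Submodule.linearMap_qext
  exact TensorProduct.ext' h

/-- The map `f ⊗_R g`. -/
def map (f : M →ₗ[k] M') (g : N →ₗ[k] N') (hf : ∀ r m, f (ρ r m) = ρ' r (f m))
    (hg : ∀ r n, g (l r n) = l' r (g n)) : RelTensor ρ l →ₗ[k] RelTensor ρ' l' :=
  lift (proj ρ' l' ∘ₗ TensorProduct.map f g) (by
    intro m r n
    simp [hf, hg, proj_balanced])

@[simp] theorem map_proj (f : M →ₗ[k] M') (g : N →ₗ[k] N') (hf : ∀ r m, f (ρ r m) = ρ' r (f m))
    (hg : ∀ r n, g (l r n) = l' r (g n)) (m : M) (n : N) :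
    map f g hf hg (proj ρ l (m ⊗ₜ n)) = proj ρ' l' (f m ⊗ₜ g n) := by
  simp [map]

end RelTensor

end RelTensor

section Bimod

variable (k : Type*) [Field k] (R : Type*) [NonUnitalRing R] [Module k R]
  [IsScalarTower k R R] [SMulCommClass k R R]

/-- An `R`-bimodule structure on the `k`-vector space `M`, for an associative, not necessarily
unital `k`-algebra `R`: `left r m` is `r m` and `right r m` is `m r`. -/
@[ext] structure BimoduleStr (M : Type*) [AddCommGroup M] [Module k M] where
  left : R →ₗ[k] M →ₗ[k] M
  right : R →ₗ[k] M →ₗ[k] M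
  left_mul : ∀ r s m, left (r * s) m = left r (left s m)
  right_mul : ∀ r s m, right (r * s) m = right s (right r m)
  left_right : ∀ r s m, left r (right s m) = right s (left r m)

/-- `R` as a bimodule over itself. -/
def regular : BimoduleStr k R R where
  left := LinearMap.mul k R
  right := (LinearMap.mul k R).flip
  left_mul := by simp [mul_assoc]
  right_mul := by simp [mul_assoc]
  left_right := by simp [mul_assoc]

variable {k R}

@[simp] theorem regular_left (r s : R) : (regular k R).left r s = r * s := rfl

@[simp] theorem regular_right (r s : R) : (regular k R).right r s = s * r := rfl

namespace BimoduleStr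

variable {M : Type*} [AddCommGroup M] [Module k M] (B : BimoduleStr k R M)

/-- The map `R ⊗_R M → M` induced by the left action. -/
def leftMap : RelTensor (regular k R).right B.left →ₗ[k] M :=
  RelTensor.lift (TensorProduct.lift B.left) (by simp [B.left_mul])

/-- The map `M ⊗_R R → M` induced by the right action. -/
def rightMap : RelTensor B.right (regular k R).left →ₗ[k] M :=
  RelTensor.lift (TensorProduct.lift B.right.flip) (by simp [B.right_mul])

@[simp] theorem leftMap_proj (r : R) (m : M) :
    B.leftMap (RelTensor.proj _ _ (r ⊗ₜ m)) = B.left r m :=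
  (RelTensor.lift_proj _ _ _).trans (TensorProduct.lift.tmul _ _)

@[simp] theorem rightMap_proj (r : R) (m : M) :
    B.rightMap (RelTensor.proj _ _ (m ⊗ₜ r)) = B.right r m :=
  (RelTensor.lift_proj _ _ _).trans (TensorProduct.lift.tmul _ _)

/-- A bimodule is firm if it is firm as a left module and as a right module: the maps
`R ⊗_R M → M` and `M ⊗_R R → M` are isomorphisms. -/
structure IsFirm : Prop where
  left : Function.Bijective B.leftMap
  right : Function.Bijective B.rightMap

variable {N P : Type*} [AddCommGroup N] [Module k N] [AddCommGroup P] [Module k P]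
  (C : BimoduleStr k R N) (D : BimoduleStr k R P)

/-- The left action `r (m ⊗ n) = r m ⊗ n` on `M ⊗_R N`. -/
def tensorLeft : R →ₗ[k] RelTensor B.right C.left →ₗ[k] RelTensor B.right C.left where
  toFun r := RelTensor.map (B.left r) LinearMap.id (fun s m => B.left_right r s m) (fun _ _ => rfl)
  map_add' r s := RelTensor.hom_ext (by simp [TensorProduct.add_tmul])
  map_smul' r s := RelTensor.hom_ext (by simp [← TensorProduct.smul_tmul'])

/-- The right action `(m ⊗ n) r = m ⊗ n r` on `M ⊗_R N`. -/
def tensorRight : R →ₗ[k] RelTensor B.right C.left →ₗ[k] RelTensor B.right C.left where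
  toFun r := RelTensor.map LinearMap.id (C.right r) (fun _ _ => rfl)
    (fun s n => (C.left_right s r n).symm)
  map_add' r s := RelTensor.hom_ext (by simp [TensorProduct.tmul_add])
  map_smul' r s := RelTensor.hom_ext (by simp)

@[simp] theorem tensorLeft_proj (r : R) (m : M) (n : N) :
    tensorLeft B C r (RelTensor.proj _ _ (m ⊗ₜ n)) = RelTensor.proj _ _ (B.left r m ⊗ₜ n) :=
  rfl

@[simp] theorem tensorRight_proj (r : R) (m : M) (n : N) :
    tensorRight B C r (RelTensor.proj _ _ (m ⊗ₜ n)) = RelTensor.proj _ _ (m ⊗ₜ C.right r n) :=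
  rfl

/-- The bimodule `M ⊗_R N`, with `r (m ⊗ n) = r m ⊗ n` and `(m ⊗ n) r = m ⊗ n r`. -/
def tensor : BimoduleStr k R (RelTensor B.right C.left) where
  left := tensorLeft B C
  right := tensorRight B C
  left_mul r s := LinearMap.congr_fun (f := tensorLeft B C (r * s))
    (g := tensorLeft B C r ∘ₗ tensorLeft B C s) (RelTensor.hom_ext (by simp [B.left_mul]))
  right_mul r s := LinearMap.congr_fun (f := tensorRight B C (r * s))
    (g := tensorRight B C s ∘ₗ tensorRight B C r) (RelTensor.hom_ext (by simp [C.right_mul]))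
  left_right r s := LinearMap.congr_fun (f := tensorLeft B C r ∘ₗ tensorRight B C s)
    (g := tensorRight B C s ∘ₗ tensorLeft B C r) (RelTensor.hom_ext (by simp))

@[simp] theorem tensor_left_proj (r : R) (m : M) (n : N) :
    (B.tensor C).left r (RelTensor.proj _ _ (m ⊗ₜ n)) =
      RelTensor.proj _ _ (B.left r m ⊗ₜ n) := tensorLeft_proj B C r m n

@[simp] theorem tensor_right_proj (r : R) (m : M) (n : N) :
    (B.tensor C).right r (RelTensor.proj _ _ (m ⊗ₜ n)) =
      RelTensor.proj _ _ (m ⊗ₜ C.right r n) := tensorRight_proj B C r m n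

/-- The map `(M ⊗_R N) ⊗_R P → M ⊗_R (N ⊗_R P)`, `(m ⊗ n) ⊗ p ↦ m ⊗ (n ⊗ p)`. -/
def assocHom : RelTensor (B.tensor C).right D.left →ₗ[k] RelTensor B.right (C.tensor D).left :=
  RelTensor.lift
    (TensorProduct.lift (RelTensor.lift
      (TensorProduct.curry (RelTensor.proj B.right (C.tensor D).left ∘ₗ
        (RelTensor.proj C.right D.left).lTensor M ∘ₗ
          (TensorProduct.assoc k M N P).toLinearMap))
      (by
        intro m r n
        ext p
        simp [RelTensor.proj_balanced])))
    (by
      intro x r p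
      obtain ⟨x, rfl⟩ := RelTensor.proj_surjective x
      induction x with
      | zero => simp
      | add x y hx hy => simp only [map_add, TensorProduct.add_tmul, hx, hy]
      | tmul m n => simp [RelTensor.proj_balanced])

/-- The map `M ⊗_R (N ⊗_R P) → (M ⊗_R N) ⊗_R P`, `m ⊗ (n ⊗ p) ↦ (m ⊗ n) ⊗ p`. -/
def assocInv : RelTensor B.right (C.tensor D).left →ₗ[k] RelTensor (B.tensor C).right D.left :=
  RelTensor.lift
    (TensorProduct.lift (LinearMap.flip (RelTensor.lift
      (TensorProduct.curry (RelTensor.proj (B.tensor C).right D.left ∘ₗ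
        (RelTensor.proj B.right C.left).rTensor P ∘ₗ
          (TensorProduct.assoc k M N P).symm.toLinearMap ∘ₗ
            (TensorProduct.comm k (N ⊗[k] P) M).toLinearMap))
      (by
        intro n r p
        ext m
        simp [← RelTensor.proj_balanced]))))
    (by
      intro m r x
      obtain ⟨x, rfl⟩ := RelTensor.proj_surjective x
      induction x with
      | zero => simp
      | add x y hx hy => simp only [map_add, TensorProduct.tmul_add, hx, hy]
      | tmul n p => simp [RelTensor.proj_balanced])

@[simp] theorem assocHom_proj (m : M) (n : N) (p : P) :
    assocHom B C D (RelTensor.proj _ _ (RelTensor.proj _ _ (m ⊗ₜ n) ⊗ₜ p)) =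
      RelTensor.proj _ _ (m ⊗ₜ RelTensor.proj _ _ (n ⊗ₜ p)) := by
  simp [assocHom]

@[simp] theorem assocInv_proj (m : M) (n : N) (p : P) :
    assocInv B C D (RelTensor.proj _ _ (m ⊗ₜ RelTensor.proj _ _ (n ⊗ₜ p))) =
      RelTensor.proj _ _ (RelTensor.proj _ _ (m ⊗ₜ n) ⊗ₜ p) := by
  simp [assocInv]

theorem hom_ext_left {Q : Type*} [AddCommGroup Q] [Module k Q]
    {f g : RelTensor (B.tensor C).right D.left →ₗ[k] Q}
    (h : ∀ m n p, f (RelTensor.proj _ _ (RelTensor.proj _ _ (m ⊗ₜ n) ⊗ₜ p)) =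
      g (RelTensor.proj _ _ (RelTensor.proj _ _ (m ⊗ₜ n) ⊗ₜ p))) : f = g := by
  refine RelTensor.hom_ext fun x p => ?_
  obtain ⟨x, rfl⟩ := RelTensor.proj_surjective x
  induction x with
  | zero => simp
  | add x y hx hy => simp only [map_add, TensorProduct.add_tmul, hx, hy]
  | tmul m n => exact h m n p

theorem hom_ext_left₄ {L Q : Type*} [AddCommGroup L] [Module k L] [AddCommGroup Q] [Module k Q]
    (F : BimoduleStr k R L) {f g : RelTensor ((B.tensor C).tensor D).right F.left →ₗ[k] Q}
    (h : ∀ m n p q,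
      f (RelTensor.proj _ _ (RelTensor.proj _ _ (RelTensor.proj _ _ (m ⊗ₜ n) ⊗ₜ p) ⊗ₜ q)) =
      g (RelTensor.proj _ _ (RelTensor.proj _ _ (RelTensor.proj _ _ (m ⊗ₜ n) ⊗ₜ p) ⊗ₜ q))) :
    f = g := by
  refine hom_ext_left (B.tensor C) D F fun x p q => ?_
  obtain ⟨x, rfl⟩ := RelTensor.proj_surjective x
  induction x with
  | zero => simp
  | add x y hx hy => simp only [map_add, TensorProduct.add_tmul, hx, hy]
  | tmul m n => exact h m n p q

theorem hom_ext_right {Q : Type*} [AddCommGroup Q] [Module k Q]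
    {f g : RelTensor B.right (C.tensor D).left →ₗ[k] Q}
    (h : ∀ m n p, f (RelTensor.proj _ _ (m ⊗ₜ RelTensor.proj _ _ (n ⊗ₜ p))) =
      g (RelTensor.proj _ _ (m ⊗ₜ RelTensor.proj _ _ (n ⊗ₜ p)))) : f = g := by
  refine RelTensor.hom_ext fun m x => ?_
  obtain ⟨x, rfl⟩ := RelTensor.proj_surjective x
  induction x with
  | zero => simp
  | add x y hx hy => simp only [map_add, TensorProduct.tmul_add, hx, hy]
  | tmul n p => exact h m n p

/-- The associativity isomorphism `(M ⊗_R N) ⊗_R P ≅ M ⊗_R (N ⊗_R P)`. -/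
def assoc : RelTensor (B.tensor C).right D.left ≃ₗ[k] RelTensor B.right (C.tensor D).left :=
  LinearEquiv.ofLinearMap (assocHom B C D) (assocInv B C D)
    (hom_ext_right _ _ _ (by simp)) (hom_ext_left _ _ _ (by simp))

@[simp] theorem assoc_proj (m : M) (n : N) (p : P) :
    assoc B C D (RelTensor.proj _ _ (RelTensor.proj _ _ (m ⊗ₜ n) ⊗ₜ p)) =
      RelTensor.proj _ _ (m ⊗ₜ RelTensor.proj _ _ (n ⊗ₜ p)) :=
  assocHom_proj B C D m n p

@[simp] theorem assoc_symm_proj (m : M) (n : N) (p : P) :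
    (assoc B C D).symm (RelTensor.proj _ _ (m ⊗ₜ RelTensor.proj _ _ (n ⊗ₜ p))) =
      RelTensor.proj _ _ (RelTensor.proj _ _ (m ⊗ₜ n) ⊗ₜ p) :=
  assocInv_proj B C D m n p

variable {B C}

theorem tensor_isFirm (hB : B.IsFirm) (hC : C.IsFirm) : (B.tensor C).IsFirm where
  left := by
    let e := LinearEquiv.ofBijective B.leftMap hB.left
    have he : ∀ (r : R) (m : RelTensor (regular k R).right B.left),
        e (((regular k R).tensor B).right r m) = B.right r (e m) := fun r =>
      LinearMap.congr_fun (f := e.toLinearMap ∘ₗ ((regular k R).tensor B).right r)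
        (g := B.right r ∘ₗ e.toLinearMap)
        (RelTensor.hom_ext (by simp [e, B.left_right]))
    have he' : ∀ (r : R) (m : M),
        e.symm (B.right r m) = ((regular k R).tensor B).right r (e.symm m) := by
      intro r m
      apply e.injective
      simp [he]
    let f := RelTensor.map (l := C.left) (l' := C.left) e.toLinearMap LinearMap.id he
      (fun _ _ => rfl)
    let g := RelTensor.map (l := C.left) (l' := C.left) e.symm.toLinearMap LinearMap.id he'
      (fun _ _ => rfl)
    have h₁ : f ∘ₗ g = LinearMap.id := RelTensor.hom_ext (by simp [f, g])
    have h₂ : g ∘ₗ f = LinearMap.id := RelTensor.hom_ext (by simp [f, g])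
    let E : _ ≃ₗ[k] _ := LinearEquiv.ofLinearMap f g h₁ h₂
    have : (B.tensor C).leftMap =
        ((assoc (regular k R) B C).symm.trans E).toLinearMap := by
      refine hom_ext_right _ _ _ fun r m n => ?_
      simp [E, f, e]
    rw [this]
    exact LinearEquiv.bijective _
  right := by
    let e := LinearEquiv.ofBijective C.rightMap hC.right
    have he : ∀ (r : R) (m : RelTensor C.right (regular k R).left),
        e ((C.tensor (regular k R)).left r m) = C.left r (e m) := fun r =>
      LinearMap.congr_fun (f := e.toLinearMap ∘ₗ (C.tensor (regular k R)).left r)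
        (g := C.left r ∘ₗ e.toLinearMap)
        (RelTensor.hom_ext (by simp [e, C.left_right]))
    have he' : ∀ (r : R) (m : N),
        e.symm (C.left r m) = (C.tensor (regular k R)).left r (e.symm m) := by
      intro r m
      apply e.injective
      simp [he]
    let f := RelTensor.map (ρ := B.right) (ρ' := B.right) LinearMap.id e.toLinearMap
      (fun _ _ => rfl) he
    let g := RelTensor.map (ρ := B.right) (ρ' := B.right) LinearMap.id e.symm.toLinearMap
      (fun _ _ => rfl) he'
    have h₁ : f ∘ₗ g = LinearMap.id := RelTensor.hom_ext (by simp [f, g])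
    have h₂ : g ∘ₗ f = LinearMap.id := RelTensor.hom_ext (by simp [f, g])
    let E : _ ≃ₗ[k] _ := LinearEquiv.ofLinearMap f g h₁ h₂
    have : (B.tensor C).rightMap =
        ((assoc B C (regular k R)).trans E).toLinearMap := by
      refine hom_ext_left _ _ _ fun r m n => ?_
      simp [E, f, e]
    rw [this]
    exact LinearEquiv.bijective _

end BimoduleStr

end Bimod

/-- A firm algebra: a not necessarily unital algebra `R` such that the multiplication induces
an isomorphism `R ⊗_R R → R`. -/
class IsFirmAlgebra (k : Type*) [Field k] (R : Type*) [NonUnitalRing R] [Module k R]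
    [IsScalarTower k R R] [SMulCommClass k R R] : Prop where
  isFirm : (regular k R).IsFirm

/-- A firm `R`-bimodule. -/
structure FirmBimod (k : Type u) [Field k] (R : Type v) [NonUnitalRing R] [Module k R]
    [IsScalarTower k R R] [SMulCommClass k R R] where
  carrier : Type v
  [addCommGroup : AddCommGroup carrier]
  [module : Module k carrier]
  str : BimoduleStr k R carrier
  firm : str.IsFirm

namespace FirmBimod

attribute [instance] addCommGroup module

variable {k : Type u} [Field k] {R : Type v} [NonUnitalRing R] [Module k R]
  [IsScalarTower k R R] [SMulCommClass k R R]

/-- Bimodule maps. -/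
@[ext] structure Hom (X Y : FirmBimod k R) where
  lin : X.carrier →ₗ[k] Y.carrier
  map_left : ∀ r x, lin (X.str.left r x) = Y.str.left r (lin x)
  map_right : ∀ r x, lin (X.str.right r x) = Y.str.right r (lin x)

instance : Category (FirmBimod k R) where
  Hom := Hom
  id X := ⟨LinearMap.id, fun _ _ => rfl, fun _ _ => rfl⟩
  comp f g := ⟨g.lin ∘ₗ f.lin, by simp [f.map_left, g.map_left], by simp [f.map_right, g.map_right]⟩

@[ext] theorem hom_ext {X Y : FirmBimod k R} {f g : X ⟶ Y} (h : Hom.lin f = Hom.lin g) : f = g :=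
  Hom.ext h

@[simp] theorem id_lin (X : FirmBimod k R) : Hom.lin (𝟙 X) = LinearMap.id := rfl

@[simp] theorem comp_lin {X Y Z : FirmBimod k R} (f : X ⟶ Y) (g : Y ⟶ Z) :
    Hom.lin (f ≫ g) = Hom.lin g ∘ₗ Hom.lin f := rfl

/-- A bijective bimodule map is an isomorphism. -/
def isoMk {X Y : FirmBimod k R} (e : X.carrier ≃ₗ[k] Y.carrier)
    (hl : ∀ r x, e (X.str.left r x) = Y.str.left r (e x))
    (hr : ∀ r x, e (X.str.right r x) = Y.str.right r (e x)) : X ≅ Y where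
  hom := ⟨e.toLinearMap, hl, hr⟩
  inv := ⟨e.symm.toLinearMap, fun r x => e.injective (by simp [hl]),
    fun r x => e.injective (by simp [hr])⟩
  hom_inv_id := by ext; simp
  inv_hom_id := by ext; simp

@[simp] theorem isoMk_hom_lin {X Y : FirmBimod k R} (e : X.carrier ≃ₗ[k] Y.carrier)
    (hl : ∀ r x, e (X.str.left r x) = Y.str.left r (e x))
    (hr : ∀ r x, e (X.str.right r x) = Y.str.right r (e x)) :
    Hom.lin (isoMk e hl hr).hom = e.toLinearMap := rfl

/-- The firm bimodule `X ⊗_R Y`. -/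
def tensor (X Y : FirmBimod k R) : FirmBimod k R where
  carrier := RelTensor X.str.right Y.str.left
  str := X.str.tensor Y.str
  firm := BimoduleStr.tensor_isFirm X.firm Y.firm

/-- The canonical epimorphism `X ⊗ Y → X ⊗_R Y`. -/
def proj (X Y : FirmBimod k R) : X.carrier ⊗[k] Y.carrier →ₗ[k] (tensor X Y).carrier :=
  RelTensor.proj X.str.right Y.str.left

/-- The bimodule map `f ⊗_R g`. -/
def tensorMap {X Y X' Y' : FirmBimod k R} (f : X ⟶ X') (g : Y ⟶ Y') :
    tensor X Y ⟶ tensor X' Y' where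
  lin := RelTensor.map f.lin g.lin f.map_right g.map_left
  map_left r := LinearMap.congr_fun
    (f := RelTensor.map f.lin g.lin f.map_right g.map_left ∘ₗ (X.str.tensor Y.str).left r)
    (g := (X'.str.tensor Y'.str).left r ∘ₗ RelTensor.map f.lin g.lin f.map_right g.map_left)
    (RelTensor.hom_ext (by simp [f.map_left]))
  map_right r := LinearMap.congr_fun
    (f := RelTensor.map f.lin g.lin f.map_right g.map_left ∘ₗ (X.str.tensor Y.str).right r)
    (g := (X'.str.tensor Y'.str).right r ∘ₗ RelTensor.map f.lin g.lin f.map_right g.map_left)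
    (RelTensor.hom_ext (by simp [g.map_right]))

/-- The associativity isomorphism. -/
def assocIso (X Y Z : FirmBimod k R) : tensor (tensor X Y) Z ≅ tensor X (tensor Y Z) :=
  isoMk (X := tensor (tensor X Y) Z) (Y := tensor X (tensor Y Z))
    (BimoduleStr.assoc X.str Y.str Z.str)
    (fun r => LinearMap.congr_fun
      (f := (BimoduleStr.assoc X.str Y.str Z.str).toLinearMap ∘ₗ
        ((X.str.tensor Y.str).tensor Z.str).left r)
      (g := (X.str.tensor (Y.str.tensor Z.str)).left r ∘ₗ
        (BimoduleStr.assoc X.str Y.str Z.str).toLinearMap)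
      (BimoduleStr.hom_ext_left _ _ _ (by simp)))
    (fun r => LinearMap.congr_fun
      (f := (BimoduleStr.assoc X.str Y.str Z.str).toLinearMap ∘ₗ
        ((X.str.tensor Y.str).tensor Z.str).right r)
      (g := (X.str.tensor (Y.str.tensor Z.str)).right r ∘ₗ
        (BimoduleStr.assoc X.str Y.str Z.str).toLinearMap)
      (BimoduleStr.hom_ext_left _ _ _ (by simp)))

section Unit

variable [hR : IsFirmAlgebra k R]

variable (k R) in
/-- The firm algebra `R` as a bimodule over itself. -/
def unit : FirmBimod k R where
  carrier := R
  str := regular k R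
  firm := hR.isFirm

/-- The left unit isomorphism `R ⊗_R X ≅ X`, `r ⊗ x ↦ r x`. -/
def leftIso (X : FirmBimod k R) : tensor (unit k R) X ≅ X :=
  isoMk (X := tensor (unit k R) X) (LinearEquiv.ofBijective X.str.leftMap X.firm.left)
    (fun r => LinearMap.congr_fun
      (f := X.str.leftMap ∘ₗ ((regular k R).tensor X.str).left r)
      (g := X.str.left r ∘ₗ X.str.leftMap)
      (RelTensor.hom_ext (by simp [X.str.left_mul])))
    (fun r => LinearMap.congr_fun
      (f := X.str.leftMap ∘ₗ ((regular k R).tensor X.str).right r)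
      (g := X.str.right r ∘ₗ X.str.leftMap)
      (RelTensor.hom_ext (by simp [X.str.left_right])))

/-- The right unit isomorphism `X ⊗_R R ≅ X`, `x ⊗ r ↦ x r`. -/
def rightIso (X : FirmBimod k R) : tensor X (unit k R) ≅ X :=
  isoMk (X := tensor X (unit k R)) (LinearEquiv.ofBijective X.str.rightMap X.firm.right)
    (fun r => LinearMap.congr_fun
      (f := X.str.rightMap ∘ₗ (X.str.tensor (regular k R)).left r)
      (g := X.str.left r ∘ₗ X.str.rightMap)
      (RelTensor.hom_ext (by simp [X.str.left_right])))
    (fun r => LinearMap.congr_fun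
      (f := X.str.rightMap ∘ₗ (X.str.tensor (regular k R)).right r)
      (g := X.str.right r ∘ₗ X.str.rightMap)
      (RelTensor.hom_ext (by simp [X.str.right_mul])))

/-- The monoidal category of firm bimodules over a firm algebra `R`, with the module tensor
product `⊗_R` and the unit `R`. -/
instance monoidal : MonoidalCategory (FirmBimod k R) :=
  letI : MonoidalCategoryStruct (FirmBimod k R) :=
    { tensorObj := tensor
      whiskerLeft := fun X _ _ f => tensorMap (𝟙 X) f
      whiskerRight := fun f Y => tensorMap f (𝟙 Y)
      tensorHom := tensorMap
      tensorUnit := unit k R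
      associator := assocIso
      leftUnitor := leftIso
      rightUnitor := rightIso }
  MonoidalCategory.ofTensorHom
    (id_tensorHom_id := fun X Y => hom_ext (RelTensor.hom_ext fun _ _ => rfl))
    (id_tensorHom := fun _ _ _ _ => rfl)
    (tensorHom_id := fun _ _ => rfl)
    (tensorHom_comp_tensorHom := fun _ _ _ _ => hom_ext (RelTensor.hom_ext fun _ _ => rfl))
    (associator_naturality := fun _ _ _ =>
      hom_ext (BimoduleStr.hom_ext_left _ _ _ fun _ _ _ => rfl))
    (leftUnitor_naturality := fun f =>
      hom_ext (RelTensor.hom_ext fun r x => (f.map_left r x).symm))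
    (rightUnitor_naturality := fun f =>
      hom_ext (RelTensor.hom_ext fun x r => (f.map_right r x).symm))
    (pentagon := fun W X Y Z => hom_ext
      (BimoduleStr.hom_ext_left₄ W.str X.str Y.str Z.str fun _ _ _ _ => rfl))
    (triangle := fun X Y => hom_ext (BimoduleStr.hom_ext_left _ _ _ fun x r y =>
      (RelTensor.proj_balanced (ρ := X.str.right) (l := Y.str.left) x r y).symm))

end Unit

end FirmBimod

end FirmBimodules

namespace WeakMultiplier

section Legs

variable {k : Type*} [Field k] {V W V' W' A : Type*}
  [AddCommGroup V] [Module k V] [AddCommGroup W] [Module k W]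
  [AddCommGroup V'] [Module k V'] [AddCommGroup W'] [Module k W']

/-- The map `f ⊗ Z` (legs 1 and 2) on `V ⊗ W ⊗ Z`. -/
def leg12 (f : V ⊗[k] W →ₗ[k] V' ⊗[k] W') (Z : Type*) [AddCommGroup Z] [Module k Z] :
    V ⊗[k] (W ⊗[k] Z) →ₗ[k] V' ⊗[k] (W' ⊗[k] Z) :=
  (TensorProduct.assoc k V' W' Z).toLinearMap ∘ₗ f.rTensor Z ∘ₗ
    (TensorProduct.assoc k V W Z).symm.toLinearMap

/-- The map `f¹³ = (V' ⊗ tw)(f ⊗ Z)(V ⊗ tw)` (legs 1 and 3) on `V ⊗ Z ⊗ W`. -/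
def leg13 (f : V ⊗[k] W →ₗ[k] V' ⊗[k] W') (Z : Type*) [AddCommGroup Z] [Module k Z] :
    V ⊗[k] (Z ⊗[k] W) →ₗ[k] V' ⊗[k] (Z ⊗[k] W') :=
  (TensorProduct.comm k W' Z).toLinearMap.lTensor V' ∘ₗ leg12 f Z ∘ₗ
    (TensorProduct.comm k Z W).toLinearMap.lTensor V

/-- The map `ω ⊗ V : W ⊗ V → V` for a functional `ω` on `W`. -/
def sliceLeft (V : Type*) [AddCommGroup V] [Module k V] (ω : W →ₗ[k] k) : W ⊗[k] V →ₗ[k] V :=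
  (TensorProduct.lid k V).toLinearMap ∘ₗ ω.rTensor V

/-- The map `V ⊗ ω : V ⊗ W → V` for a functional `ω` on `W`. -/
def sliceRight (V : Type*) [AddCommGroup V] [Module k V] (ω : W →ₗ[k] k) : V ⊗[k] W →ₗ[k] V :=
  (TensorProduct.rid k V).toLinearMap ∘ₗ ω.lTensor V

@[simp] theorem sliceLeft_tmul (ω : W →ₗ[k] k) (w : W) (v : V) :
    sliceLeft V ω (w ⊗ₜ v) = ω w • v := by simp [sliceLeft]

@[simp] theorem sliceRight_tmul (ω : W →ₗ[k] k) (v : V) (w : W) :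
    sliceRight V ω (v ⊗ₜ w) = ω w • v := by simp [sliceRight]

/-- A jointly injective family of maps stays jointly injective after tensoring from the left. -/
theorem lTensor_joint {ι : Type*} (f : ι → W →ₗ[k] W') (hf : ∀ w, (∀ i, f i w = 0) → w = 0)
    (x : V ⊗[k] W) (hx : ∀ i, (f i).lTensor V x = 0) : x = 0 := by
  classical
  let b := Module.Basis.ofVectorSpace k V
  have key : ∀ i (x : V ⊗[k] W) j, TensorProduct.equivFinsuppOfBasisLeft b ((f i).lTensor V x) j =
      f i (TensorProduct.equivFinsuppOfBasisLeft b x j) := by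
    intro i x j
    induction x with
    | zero => simp
    | add x y hx hy => simp [hx, hy]
    | tmul v w => simp
  apply (TensorProduct.equivFinsuppOfBasisLeft (N := W) b).injective
  ext j
  simp only [map_zero, Finsupp.coe_zero, Pi.zero_apply]
  exact hf _ fun i => by rw [← key, hx]; simp

theorem rTensor_joint {ι : Type*} (f : ι → W →ₗ[k] W') (hf : ∀ w, (∀ i, f i w = 0) → w = 0)
    (x : W ⊗[k] V) (hx : ∀ i, (f i).rTensor V x = 0) : x = 0 := by
  apply (TensorProduct.comm k W V).injective
  rw [map_zero]
  apply lTensor_joint f hf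
  intro i
  rw [← LinearMap.comm_comp_rTensor_comp_comm_eq]
  simp [hx]

variable [NonUnitalRing A] [Module k A] [IsScalarTower k A A] [SMulCommClass k A A]

/-- `x ↦ (a ⊗ 1) x`. -/
def mulL₁ (V : Type*) [AddCommGroup V] [Module k V] (a : A) : A ⊗[k] V →ₗ[k] A ⊗[k] V :=
  (LinearMap.mulLeft k a).rTensor V

/-- `x ↦ x (a ⊗ 1)`. -/
def mulR₁ (V : Type*) [AddCommGroup V] [Module k V] (a : A) : A ⊗[k] V →ₗ[k] A ⊗[k] V :=
  (LinearMap.mulRight k a).rTensor V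

/-- `x ↦ (1 ⊗ a) x`. -/
def mulL₂ (V : Type*) [AddCommGroup V] [Module k V] (a : A) : V ⊗[k] A →ₗ[k] V ⊗[k] A :=
  (LinearMap.mulLeft k a).lTensor V

/-- `x ↦ x (1 ⊗ a)`. -/
def mulR₂ (V : Type*) [AddCommGroup V] [Module k V] (a : A) : V ⊗[k] A →ₗ[k] V ⊗[k] A :=
  (LinearMap.mulRight k a).lTensor V

@[simp] theorem mulL₁_tmul (a b : A) (v : V) : mulL₁ (k := k) V a (b ⊗ₜ v) = (a * b) ⊗ₜ v := rfl
@[simp] theorem mulR₁_tmul (a b : A) (v : V) : mulR₁ (k := k) V a (b ⊗ₜ v) = (b * a) ⊗ₜ v := rfl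
@[simp] theorem mulL₂_tmul (a b : A) (v : V) : mulL₂ (k := k) V a (v ⊗ₜ b) = v ⊗ₜ (a * b) := rfl
@[simp] theorem mulR₂_tmul (a b : A) (v : V) : mulR₂ (k := k) V a (v ⊗ₜ b) = v ⊗ₜ (b * a) := rfl

end Legs

section Multiplier

variable (k : Type*) [Field k] (A : Type*) [NonUnitalRing A] [Module k A]
  [IsScalarTower k A A] [SMulCommClass k A A]

/-- The multiplier algebra of `A`: the pairs `(l, r)` of linear maps `A → A` such that
`a * l b = r a * b`, with the product `(l, r) (l', r') = (l l', r' r)`. -/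
def Multiplier : Subalgebra k (Module.End k A × (Module.End k A)ᵐᵒᵖ) where
  carrier := {m | ∀ a b : A, a * m.1 b = m.2.unop a * b}
  mul_mem' := by
    intro m m' hm hm' a b
    have h := hm a (m'.1 b)
    have h' := hm' (m.2.unop a) b
    simpa using h.trans h'
  add_mem' := by
    intro m m' hm hm' a b
    simp [mul_add, add_mul, hm a b, hm' a b]
  algebraMap_mem' := by
    intro c a b
    simp [Algebra.algebraMap_eq_smul_one, mul_smul_comm, smul_mul_assoc]

variable {k A}

/-- The element `m a` of `A`, for a multiplier `m`. -/
def lact (m : Multiplier k A) : A →ₗ[k] A := m.1.1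

/-- The element `a m` of `A`, for a multiplier `m`. -/
def ract (m : Multiplier k A) : A →ₗ[k] A := m.1.2.unop

/-- The linear map `m ↦ m a`. -/
def lactAt (a : A) : Multiplier k A →ₗ[k] A where
  toFun m := lact m a
  map_add' _ _ := rfl
  map_smul' _ _ := rfl

/-- The linear map `m ↦ a m`. -/
def ractAt (a : A) : Multiplier k A →ₗ[k] A where
  toFun m := ract m a
  map_add' _ _ := rfl
  map_smul' _ _ := rfl

/-- The multiplier with given left and right multiplications. -/
def mkMultiplier (l r : A →ₗ[k] A) (h : ∀ a b, a * l b = r a * b) : Multiplier k A :=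
  ⟨(l, MulOpposite.op r), h⟩

theorem mul_lact (m : Multiplier k A) (a b : A) : a * lact m b = ract m a * b := m.2 a b

@[simp] theorem ract_mul (m n : Multiplier k A) (a : A) : ract (m * n) a = ract n (ract m a) := rfl

theorem multiplier_ext (hA : ∀ a : A, (∀ b : A, b * a = 0) → a = 0) {m n : Multiplier k A}
    (h : ∀ a, ract m a = ract n a) : m = n := by
  have h2 : m.1.2 = n.1.2 := MulOpposite.unop_injective (LinearMap.ext h)
  have h1 : m.1.1 = n.1.1 := by
    refine LinearMap.ext fun b => ?_
    rw [← sub_eq_zero]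
    apply hA
    intro a
    have h3 := mul_lact m a b
    rw [h, ← mul_lact n] at h3
    rw [mul_sub, sub_eq_zero]
    exact h3
  exact Subtype.ext (Prod.ext h1 h2)

end Multiplier

/-- A weak multiplier bialgebra structure on a not necessarily unital `k`-algebra `A`. With the
comultiplication `Δ` from `A` to the multiplier algebra of `A ⊗ A` and the canonical idempotent
multiplier `E`, the maps are `E₁ x = E x`, `E₂ x = x E`, `T₁ (a ⊗ b) = Δ(a) (1 ⊗ b)` and
`T₂ (a ⊗ b) = (a ⊗ 1) Δ(b)`. -/
structure WeakMultiplierBialgebra (k : Type*) [Field k] (A : Type*) [NonUnitalRing A]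
    [Module k A] [IsScalarTower k A A] [SMulCommClass k A A] where
  /-- `A` is idempotent. -/
  mul_surjective : Function.Surjective (LinearMap.mul' k A)
  /-- `A` is non-degenerate. -/
  right_nondeg : ∀ a : A, (∀ b : A, a * b = 0) → a = 0
  left_nondeg : ∀ a : A, (∀ b : A, b * a = 0) → a = 0
  E₁ : A ⊗[k] A →ₗ[k] A ⊗[k] A
  E₂ : A ⊗[k] A →ₗ[k] A ⊗[k] A
  T₁ : A ⊗[k] A →ₗ[k] A ⊗[k] A
  T₂ : A ⊗[k] A →ₗ[k] A ⊗[k] A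
  counit : A →ₗ[k] k
  /-- `(a ⊗ b) E₁(c ⊗ d) = E₂(a ⊗ b) (c ⊗ d)`. -/
  E_multiplier : ∀ a b c d : A,
    (a ⊗ₜ[k] b) * E₁ (c ⊗ₜ[k] d) = E₂ (a ⊗ₜ[k] b) * (c ⊗ₜ[k] d)
  /-- `E₁² = E₁`. -/
  E_idem : E₁ ∘ₗ E₁ = E₁
  /-- `(T₂ ⊗ A)(A ⊗ T₁) = (A ⊗ T₁)(T₂ ⊗ A)`. -/
  coassoc : leg12 T₂ A ∘ₗ T₁.lTensor A = T₁.lTensor A ∘ₗ leg12 T₂ A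
  /-- `(ε ⊗ A) T₁ = μ`. -/
  counit_T₁ : sliceLeft A counit ∘ₗ T₁ = LinearMap.mul' k A
  /-- `(A ⊗ ε) T₂ = μ`. -/
  counit_T₂ : sliceRight A counit ∘ₗ T₂ = LinearMap.mul' k A
  /-- `(μ ⊗ A) T₁¹³ (A ⊗ T₁) = T₁ (μ ⊗ A)`. -/
  T₁_mul :
    (LinearMap.mul' k A).rTensor A ∘ₗ (TensorProduct.assoc k A A A).symm.toLinearMap ∘ₗ
        leg13 T₁ A ∘ₗ T₁.lTensor A =
      T₁ ∘ₗ (LinearMap.mul' k A).rTensor A ∘ₗ (TensorProduct.assoc k A A A).symm.toLinearMap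
  /-- `⟨T₁(a ⊗ c)(b ⊗ 1)⟩ = ⟨E₁(b ⊗ c)⟩`. -/
  span_T₁ : Submodule.span k {x | ∃ a b c : A, x = mulR₁ A b (T₁ (a ⊗ₜ[k] c))} =
    Submodule.span k {x | ∃ b c : A, x = E₁ (b ⊗ₜ[k] c)}
  /-- `⟨(1 ⊗ c) T₂(b ⊗ a)⟩ = ⟨E₂(b ⊗ c)⟩`. -/
  span_T₂ : Submodule.span k {x | ∃ a b c : A, x = mulL₂ A c (T₂ (b ⊗ₜ[k] a))} =
    Submodule.span k {x | ∃ b c : A, x = E₂ (b ⊗ₜ[k] c)}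
  /-- `(A ⊗ E₂)(T₂ ⊗ A) = (T₂ ⊗ A)(A ⊗ E₂)`; given the other axioms, this is equivalent to
  `(E₁ ⊗ A)(A ⊗ T₁) = (A ⊗ T₁)(E₁ ⊗ A)`. -/
  E₂_T₂ : E₂.lTensor A ∘ₗ leg12 T₂ A = leg12 T₂ A ∘ₗ E₂.lTensor A
  /-- `(A ⊗ E₁)(T₁ ⊗ A) = (T₁ ⊗ A) E₁¹³`; given the other axioms, this is equivalent to
  `(E₂ ⊗ A)(A ⊗ T₂) = (A ⊗ T₂) E₂¹³`. -/
  E₁_T₁ : E₁.lTensor A ∘ₗ leg12 T₁ A = leg12 T₁ A ∘ₗ leg13 E₁ A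
  /-- `(ε ⊗ A)((1 ⊗ a) E₁(b ⊗ c)) = (ε ⊗ A)(T₁(a ⊗ c)(b ⊗ 1))`. -/
  counit_E₁ : ∀ a b c : A, sliceLeft A counit (mulL₂ A a (E₁ (b ⊗ₜ[k] c))) =
    sliceLeft A counit (mulR₁ A b (T₁ (a ⊗ₜ[k] c)))
  /-- `(ε ⊗ A)(E₂(a ⊗ b)(1 ⊗ c)) = (ε ⊗ A)((1 ⊗ b) T₂(a ⊗ c))`. -/
  counit_E₂ : ∀ a b c : A, sliceLeft A counit (mulR₂ A c (E₂ (a ⊗ₜ[k] b))) =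
    sliceLeft A counit (mulL₂ A b (T₂ (a ⊗ₜ[k] c)))

/-- A regular weak multiplier bialgebra structure on `A`. The maps `T₃` and `T₄` are
`T₃ (a ⊗ b) = (1 ⊗ b) Δ(a)` and `T₄ (a ⊗ b) = Δ(b) (a ⊗ 1)`; by non-degeneracy they are
determined by the two axioms. -/
structure RegularWeakMultiplierBialgebra (k : Type*) [Field k] (A : Type*) [NonUnitalRing A]
    [Module k A] [IsScalarTower k A A] [SMulCommClass k A A] extends
    WeakMultiplierBialgebra k A where
  T₃ : A ⊗[k] A →ₗ[k] A ⊗[k] A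
  T₄ : A ⊗[k] A →ₗ[k] A ⊗[k] A
  /-- `(1 ⊗ a) T₁(c ⊗ b) = T₃(c ⊗ a)(1 ⊗ b)`. -/
  T₁_T₃ : ∀ a b c : A, mulL₂ A a (T₁ (c ⊗ₜ[k] b)) = mulR₂ A b (T₃ (c ⊗ₜ[k] a))
  /-- `T₂(a ⊗ c)(b ⊗ 1) = (a ⊗ 1) T₄(b ⊗ c)`. -/
  T₂_T₄ : ∀ a b c : A, mulR₁ A b (T₂ (a ⊗ₜ[k] c)) = mulL₁ A a (T₄ (b ⊗ₜ[k] c))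

section Cancel

variable {k : Type*} [Field k] {A : Type*} [NonUnitalRing A] [Module k A]
  [IsScalarTower k A A] [SMulCommClass k A A] {V : Type*} [AddCommGroup V] [Module k V]

theorem cancel_mulL₁ (h : ∀ a : A, (∀ b : A, b * a = 0) → a = 0) {x y : A ⊗[k] V}
    (hx : ∀ a, mulL₁ V a x = mulL₁ V a y) : x = y := by
  rw [← sub_eq_zero]
  refine rTensor_joint (fun a : A => LinearMap.mulLeft k a) h _ fun a => ?_
  rw [map_sub, sub_eq_zero]
  exact hx a

theorem cancel_mulL₂ (h : ∀ a : A, (∀ b : A, b * a = 0) → a = 0) {x y : V ⊗[k] A}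
    (hx : ∀ a, mulL₂ V a x = mulL₂ V a y) : x = y := by
  rw [← sub_eq_zero]
  refine lTensor_joint (fun a : A => LinearMap.mulLeft k a) h _ fun a => ?_
  rw [map_sub, sub_eq_zero]
  exact hx a

theorem cancel_mulR₂ (h : ∀ a : A, (∀ b : A, a * b = 0) → a = 0) {x y : V ⊗[k] A}
    (hx : ∀ a, mulR₂ V a x = mulR₂ V a y) : x = y := by
  rw [← sub_eq_zero]
  refine lTensor_joint (fun a : A => LinearMap.mulRight k a) h _ fun a => ?_
  rw [map_sub, sub_eq_zero]
  exact hx a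

theorem cancel_mulR₁ (h : ∀ a : A, (∀ b : A, a * b = 0) → a = 0) {x y : A ⊗[k] V}
    (hx : ∀ a, mulR₁ V a x = mulR₁ V a y) : x = y := by
  rw [← sub_eq_zero]
  refine rTensor_joint (fun a : A => LinearMap.mulRight k a) h _ fun a => ?_
  rw [map_sub, sub_eq_zero]
  exact hx a

theorem mulL₂_tmul_mul (a b : A) (x : A ⊗[k] A) :
    mulL₁ A a (mulL₂ A b x) = (a ⊗ₜ[k] b) * x := by
  induction x with
  | zero => simp
  | add x y hx hy => simp [mul_add, hx, hy]
  | tmul x y => simp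

theorem mulR₂_tmul_mul (a b : A) (x : A ⊗[k] A) :
    mulR₁ A a (mulR₂ A b x) = x * (a ⊗ₜ[k] b) := by
  induction x with
  | zero => simp
  | add x y hx hy => simp [add_mul, hx, hy]
  | tmul x y => simp

theorem mulL₁_mulL₂ (a b : A) (x : A ⊗[k] A) :
    mulL₁ A a (mulL₂ A b x) = mulL₂ A b (mulL₁ A a x) := by
  induction x with
  | zero => simp
  | add x y hx hy => simp [hx, hy]
  | tmul x y => simp

theorem mulR₁_mulR₂ (a b : A) (x : A ⊗[k] A) :
    mulR₁ A a (mulR₂ A b x) = mulR₂ A b (mulR₁ A a x) := by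
  induction x with
  | zero => simp
  | add x y hx hy => simp [hx, hy]
  | tmul x y => simp

theorem mulL₁_mulR₂ (a b : A) (x : A ⊗[k] A) :
    mulL₁ A a (mulR₂ A b x) = mulR₂ A b (mulL₁ A a x) := by
  induction x with
  | zero => simp
  | add x y hx hy => simp [hx, hy]
  | tmul x y => simp

theorem mulR₁_mulL₂ (a b : A) (x : A ⊗[k] A) :
    mulR₁ A a (mulL₂ A b x) = mulL₂ A b (mulR₁ A a x) := by
  induction x with
  | zero => simp
  | add x y hx hy => simp [hx, hy]
  | tmul x y => simp

theorem mulL₁_mulR₁ (a b : A) (x : A ⊗[k] A) :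
    mulL₁ A a (mulR₁ A b x) = mulR₁ A b (mulL₁ A a x) := by
  induction x with
  | zero => simp
  | add x y hx hy => simp [hx, hy]
  | tmul x y => simp [mul_assoc]

theorem mulL₂_mulR₂ (a b : A) (x : V ⊗[k] A) :
    mulL₂ V a (mulR₂ V b x) = mulR₂ V b (mulL₂ V a x) := by
  induction x with
  | zero => simp
  | add x y hx hy => simp [hx, hy]
  | tmul x y => simp [mul_assoc]

theorem sliceRight_mulL₁ (ω : A →ₗ[k] k) (a : A) (x : A ⊗[k] A) :
    sliceRight A ω (mulL₁ A a x) = a * sliceRight A ω x := by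
  induction x with
  | zero => simp
  | add x y hx hy => simp [mul_add, hx, hy]
  | tmul x y => simp [mul_smul_comm]

theorem sliceRight_mulR₁ (ω : A →ₗ[k] k) (a : A) (x : A ⊗[k] A) :
    sliceRight A ω (mulR₁ A a x) = sliceRight A ω x * a := by
  induction x with
  | zero => simp
  | add x y hx hy => simp [add_mul, hx, hy]
  | tmul x y => simp [smul_mul_assoc]

theorem sliceLeft_mulL₂ (ω : A →ₗ[k] k) (a : A) (x : A ⊗[k] A) :
    sliceLeft A ω (mulL₂ A a x) = a * sliceLeft A ω x := by
  induction x with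
  | zero => simp
  | add x y hx hy => simp [mul_add, hx, hy]
  | tmul x y => simp [mul_smul_comm]

theorem sliceLeft_mulR₂ (ω : A →ₗ[k] k) (a : A) (x : A ⊗[k] A) :
    sliceLeft A ω (mulR₂ A a x) = sliceLeft A ω x * a := by
  induction x with
  | zero => simp
  | add x y hx hy => simp [add_mul, hx, hy]
  | tmul x y => simp [smul_mul_assoc]

theorem counit_slice (ω : A →ₗ[k] k) (x : A ⊗[k] A) :
    ω (sliceLeft A ω x) = ω (sliceRight A ω x) := by
  induction x with
  | zero => simp
  | add x y hx hy => simp [hx, hy]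
  | tmul x y => simp [mul_comm]

end Cancel

namespace WeakMultiplierBialgebra

variable {k : Type*} [Field k] {A : Type*} [NonUnitalRing A] [Module k A]
  [IsScalarTower k A A] [SMulCommClass k A A] (H : WeakMultiplierBialgebra k A)

theorem E_mul (x y : A ⊗[k] A) : x * H.E₁ y = H.E₂ x * y := by
  induction x with
  | zero => simp
  | add x x' hx hx' => simp [add_mul, hx, hx']
  | tmul a b =>
    induction y with
    | zero => simp
    | add y y' hy hy' => simp [mul_add, hy, hy']
    | tmul c d => exact H.E_multiplier a b c d

theorem counit_T₁_apply (a b : A) : sliceLeft A H.counit (H.T₁ (a ⊗ₜ b)) = a * b :=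
  LinearMap.congr_fun H.counit_T₁ (a ⊗ₜ b)

theorem counit_T₂_apply (a b : A) : sliceRight A H.counit (H.T₂ (a ⊗ₜ b)) = a * b :=
  LinearMap.congr_fun H.counit_T₂ (a ⊗ₜ b)

/-- `(A ⊗ ε ⊗ A)(T₂ ⊗ A)(x ⊗ w) = (x ⊗ 1) w`. -/
theorem slice_leg12_T₂ (x : A) (w : A ⊗[k] A) :
    (sliceLeft A H.counit).lTensor A (leg12 H.T₂ A (x ⊗ₜ w)) = mulL₁ A x w := by
  induction w with
  | zero => simp
  | add w w' hw hw' => simp only [TensorProduct.tmul_add, map_add, hw, hw']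
  | tmul p q =>
    have h : ∀ z : A ⊗[k] A, (sliceLeft A H.counit).lTensor A
        (TensorProduct.assoc k A A A (z ⊗ₜ q)) = sliceRight A H.counit z ⊗ₜ q := by
      intro z
      induction z with
      | zero => simp
      | add z z' hz hz' => simp only [TensorProduct.add_tmul, map_add, hz, hz']
      | tmul a b => simp [TensorProduct.smul_tmul]
    simp [leg12, h, H.counit_T₂_apply]

/-- `(a ⊗ 1) T₁(c ⊗ b) = T₂(a ⊗ c)(1 ⊗ b)`. -/
theorem T₁_T₂ (a b c : A) : mulL₁ A a (H.T₁ (c ⊗ₜ b)) = mulR₂ A b (H.T₂ (a ⊗ₜ c)) := by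
  rw [← H.slice_leg12_T₂]
  have h := LinearMap.congr_fun H.coassoc (a ⊗ₜ (c ⊗ₜ b))
  simp only [LinearMap.comp_apply, LinearMap.lTensor_tmul] at h
  rw [h]
  have h' : ∀ z : A ⊗[k] A, (sliceLeft A H.counit).lTensor A (H.T₁.lTensor A
        (TensorProduct.assoc k A A A (z ⊗ₜ b))) = mulR₂ A b z := by
    intro z
    induction z with
    | zero => simp
    | add z z' hz hz' => simp only [TensorProduct.add_tmul, map_add, hz, hz']
    | tmul p q => simp [H.counit_T₁_apply]
  simp [leg12, h']

/-- `b ((A ⊗ ε) E₁(c ⊗ a)) = ((A ⊗ ε) T₁(b ⊗ a)) c`. -/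
theorem piBarR_multiplier (a b c : A) :
    b * sliceRight A H.counit (H.E₁ (c ⊗ₜ a)) =
      sliceRight A H.counit (H.T₁ (b ⊗ₜ a)) * c := by
  rw [← sub_eq_zero]
  apply H.left_nondeg
  intro x
  rw [mul_sub, sub_eq_zero, ← mul_assoc, ← mul_assoc]
  let F : A →ₗ[k] A := sliceLeft A H.counit ∘ₗ H.T₂ ∘ₗ (TensorProduct.mk k A A).flip a
  have hF : ∀ t, F t = sliceLeft A H.counit (H.T₂ (t ⊗ₜ a)) := fun _ => rfl
  have key : mulL₁ A (x * b) (H.E₁ (c ⊗ₜ a)) =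
      TensorProduct.map (LinearMap.mulRight k c) F (H.T₂ (x ⊗ₜ b)) := by
    refine cancel_mulL₂ H.left_nondeg fun z => ?_
    have h1 : ∀ t : A ⊗[k] A, (sliceLeft A H.counit).lTensor A (H.E₂.lTensor A
        (TensorProduct.assoc k A A A (t ⊗ₜ z))) * (c ⊗ₜ a) =
        mulL₂ A z (TensorProduct.map (LinearMap.mulRight k c) F t) := by
      intro t
      induction t with
      | zero => simp
      | add t t' ht ht' => simp only [TensorProduct.add_tmul, map_add, add_mul, ht, ht']
      | tmul p q =>
        simp [hF, ← sliceLeft_mulR₂, H.counit_E₂, ← sliceLeft_mulL₂]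
    rw [← h1]
    have h2 := LinearMap.congr_fun H.E₂_T₂ (x ⊗ₜ (b ⊗ₜ z))
    have h3 : leg12 H.T₂ A (x ⊗ₜ (b ⊗ₜ z)) =
      TensorProduct.assoc k A A A (H.T₂ (x ⊗ₜ b) ⊗ₜ z) := rfl
    simp only [LinearMap.comp_apply, LinearMap.lTensor_tmul, h3] at h2
    rw [h2, H.slice_leg12_T₂, ← mulR₂_tmul_mul, ← mulL₁_mulR₂, ← mulL₁_mulR₁, mulR₂_tmul_mul,
      ← H.E_mul, ← mulL₁_mulL₂, mulL₂_tmul_mul]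
    generalize H.E₁ (c ⊗ₜ a) = w
    induction w with
    | zero => simp
    | add w w' hw hw' => simp only [mul_add, map_add, hw, hw']
    | tmul p q => simp [mul_assoc]
  have h := congrArg (sliceRight A H.counit) key
  rw [sliceRight_mulL₁] at h
  rw [h, ← sliceRight_mulL₁, H.T₁_T₂, ← sliceRight_mulR₁]
  generalize H.T₂ (x ⊗ₜ b) = t
  induction t with
  | zero => simp
  | add t t' ht ht' => simp only [map_add, ht, ht']
  | tmul p q => simp [hF, counit_slice, H.counit_T₂_apply]

/-- The map `⊓̄ᴿ : A → M(A)`, `⊓̄ᴿ(a) b = (A ⊗ ε) E₁(b ⊗ a)` and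
`b ⊓̄ᴿ(a) = (A ⊗ ε) T₁(b ⊗ a)`. -/
def piBarR : A →ₗ[k] Multiplier k A where
  toFun a := mkMultiplier
    (sliceRight A H.counit ∘ₗ H.E₁ ∘ₗ (TensorProduct.mk k A A).flip a)
    (sliceRight A H.counit ∘ₗ H.T₁ ∘ₗ (TensorProduct.mk k A A).flip a)
    (fun b c => H.piBarR_multiplier a b c)
  map_add' a b := multiplier_ext H.left_nondeg fun c => by
    change sliceRight A H.counit (H.T₁ (c ⊗ₜ (a + b))) =
      sliceRight A H.counit (H.T₁ (c ⊗ₜ a)) + sliceRight A H.counit (H.T₁ (c ⊗ₜ b))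
    simp [TensorProduct.tmul_add]
  map_smul' r a := multiplier_ext H.left_nondeg fun c => by
    change sliceRight A H.counit (H.T₁ (c ⊗ₜ (r • a))) =
      r • sliceRight A H.counit (H.T₁ (c ⊗ₜ a))
    simp

theorem ract_piBarR (a b : A) :
    ract (H.piBarR a) b = sliceRight A H.counit (H.T₁ (b ⊗ₜ a)) := rfl

theorem lact_piBarR (a b : A) :
    lact (H.piBarR a) b = sliceRight A H.counit (H.E₁ (b ⊗ₜ a)) := rfl

/-- `⊓̄ᴿ(a) ⊓̄ᴿ(b) = ⊓̄ᴿ(⊓̄ᴿ(a) b)`. -/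
theorem piBarR_mul (a b : A) :
    H.piBarR a * H.piBarR b = H.piBarR (lact (H.piBarR a) b) := by
  refine multiplier_ext H.left_nondeg fun x => ?_
  rw [ract_mul, ract_piBarR H b, ract_piBarR H (lact _ _)]
  congr 1
  refine cancel_mulL₁ H.left_nondeg fun y => ?_
  rw [H.T₁_T₂, H.T₁_T₂]
  have h := LinearMap.congr_fun H.coassoc (y ⊗ₜ (x ⊗ₜ a))
  have h3 : leg12 H.T₂ A (y ⊗ₜ (x ⊗ₜ a)) =
      TensorProduct.assoc k A A A (H.T₂ (y ⊗ₜ x) ⊗ₜ a) := rfl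
  simp only [LinearMap.comp_apply, LinearMap.lTensor_tmul, h3] at h
  have h1 : ∀ w : A ⊗[k] A, (sliceRight A H.counit).lTensor A (leg12 H.T₂ A (y ⊗ₜ w)) =
      H.T₂ (y ⊗ₜ sliceRight A H.counit w) := by
    intro w
    induction w with
    | zero => simp
    | add w w' hw hw' => simp only [TensorProduct.tmul_add, map_add, hw, hw']
    | tmul p q =>
      have h4 : ∀ z : A ⊗[k] A, (sliceRight A H.counit).lTensor A
          (TensorProduct.assoc k A A A (z ⊗ₜ q)) = H.counit q • z := by
        intro z
        induction z with
        | zero => simp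
        | add z z' hz hz' => simp only [TensorProduct.add_tmul, map_add, smul_add, hz, hz']
        | tmul a b => simp
      simp [leg12, h4]
  have h2 : ∀ t : A ⊗[k] A, mulR₂ A b ((sliceRight A H.counit).lTensor A (H.T₁.lTensor A
      (TensorProduct.assoc k A A A (t ⊗ₜ a)))) = mulR₂ A (lact (H.piBarR a) b) t := by
    intro t
    induction t with
    | zero => simp
    | add t t' ht ht' => simp only [TensorProduct.add_tmul, map_add, ht, ht']
    | tmul p q => simp [mul_lact, ract_piBarR]
  rw [← h2, ← h, h1, ract_piBarR]

/-- The base algebra `R`: the range of `⊓̄ᴿ`, a (non-unital) subalgebra of the multiplier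
algebra. -/
def base : NonUnitalSubalgebra k (Multiplier k A) :=
  { LinearMap.range H.piBarR with
    mul_mem' := by
      rintro _ _ ⟨a, rfl⟩ ⟨b, rfl⟩
      exact ⟨_, (H.piBarR_mul a b).symm⟩ }

theorem mem_base {m : Multiplier k A} : m ∈ H.base ↔ ∃ a, H.piBarR a = m := Iff.rfl

/-- The comultiplication is right full: `A` is spanned by the elements `(A ⊗ ω) T₁(a ⊗ b)`. -/
def IsRightFull : Prop :=
  Submodule.span k {x : A | ∃ (a b : A) (ω : A →ₗ[k] k),
    x = sliceRight A ω (H.T₁ (a ⊗ₜ[k] b))} = ⊤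

end WeakMultiplierBialgebra

namespace RegularWeakMultiplierBialgebra

section

variable {k : Type*} [Field k] {A : Type*} [NonUnitalRing A] [Module k A]
  [IsScalarTower k A A] [SMulCommClass k A A] (H : RegularWeakMultiplierBialgebra k A)

/-- `T₁(c ⊗ b)(a ⊗ 1) = T₄(a ⊗ c)(1 ⊗ b)`. -/
theorem T₁_T₄ (a b c : A) : mulR₁ A a (H.T₁ (c ⊗ₜ b)) = mulR₂ A b (H.T₄ (a ⊗ₜ c)) := by
  refine cancel_mulL₁ H.left_nondeg fun d => ?_
  rw [mulL₁_mulR₁, H.T₁_T₂, mulR₁_mulR₂, H.T₂_T₄, mulL₁_mulR₂]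

/-- `T₃(c ⊗ b)(a ⊗ 1) = (1 ⊗ b) T₄(a ⊗ c)`. -/
theorem T₃_T₄ (a b c : A) : mulR₁ A a (H.T₃ (c ⊗ₜ b)) = mulL₂ A b (H.T₄ (a ⊗ₜ c)) := by
  refine cancel_mulR₂ H.right_nondeg fun d => ?_
  rw [← mulR₁_mulR₂, ← H.T₁_T₃, mulR₁_mulL₂, H.T₁_T₄, mulL₂_mulR₂]

/-- `(A ⊗ ε) T₄(b ⊗ a) = a b`. -/
theorem counit_T₄ (a b : A) : sliceRight A H.counit (H.T₄ (b ⊗ₜ a)) = a * b := by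
  rw [← sub_eq_zero]
  apply H.left_nondeg
  intro c
  rw [mul_sub, sub_eq_zero, ← sliceRight_mulL₁, ← H.T₂_T₄, sliceRight_mulR₁, H.counit_T₂_apply,
    mul_assoc]

/-- `(A ⊗ ε ⊗ A)(T₄ ⊗ A)(x ⊗ w) = w (x ⊗ 1)`. -/
theorem slice_leg12_T₄ (x : A) (w : A ⊗[k] A) :
    (sliceLeft A H.counit).lTensor A (leg12 H.T₄ A (x ⊗ₜ w)) = mulR₁ A x w := by
  induction w with
  | zero => simp
  | add w w' hw hw' => simp only [TensorProduct.tmul_add, map_add, hw, hw']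
  | tmul p q =>
    have h : ∀ z : A ⊗[k] A, (sliceLeft A H.counit).lTensor A
        (TensorProduct.assoc k A A A (z ⊗ₜ q)) = sliceRight A H.counit z ⊗ₜ q := by
      intro z
      induction z with
      | zero => simp
      | add z z' hz hz' => simp only [TensorProduct.add_tmul, map_add, hz, hz']
      | tmul a b => simp [TensorProduct.smul_tmul]
    simp [leg12, h, H.counit_T₄]

theorem E₁_mulR₁ (a : A) (x : A ⊗[k] A) : H.E₁ (mulR₁ A a x) = mulR₁ A a (H.E₁ x) := by
  refine cancel_mulL₂ H.left_nondeg fun c => cancel_mulL₁ H.left_nondeg fun b => ?_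
  rw [mulL₂_tmul_mul, H.E_mul, mulL₂_tmul_mul]
  have h : ∀ y z : A ⊗[k] A, y * mulR₁ A a z = mulR₁ A a (y * z) := by
    intro y z
    induction y with
    | zero => simp
    | add y y' hy hy' => simp only [add_mul, map_add, hy, hy']
    | tmul p q =>
      induction z with
      | zero => simp
      | add z z' hz hz' => simp only [mul_add, map_add, hz, hz']
      | tmul r s => simp [mul_assoc]
  rw [h, h, H.E_mul]

/-- `(A ⊗ E₁)(T₄ ⊗ A) = (T₄ ⊗ A)(A ⊗ E₁)`. -/
theorem E₁_T₄ (w x z : A) : H.E₁.lTensor A (TensorProduct.assoc k A A A (H.T₄ (w ⊗ₜ x) ⊗ₜ z)) =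
    leg12 H.T₄ A (w ⊗ₜ H.E₁ (x ⊗ₜ z)) := by
  rw [← sub_eq_zero]
  refine lTensor_joint (fun y : A => mulR₁ (k := k) A y) (fun u hu => ?_) _ fun y => ?_
  · exact cancel_mulR₁ H.right_nondeg fun a => by simp [hu]
  rw [map_sub, sub_eq_zero]
  have h := congrArg (mulR₁ (k := k) (A ⊗[k] A) w)
    (LinearMap.congr_fun H.E₁_T₁ (x ⊗ₜ (y ⊗ₜ z)))
  have h1 : ∀ t : A ⊗[k] A, (mulR₁ (k := k) A y).lTensor A (H.E₁.lTensor A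
      (TensorProduct.assoc k A A A (t ⊗ₜ z))) = H.E₁.lTensor A
      (TensorProduct.assoc k A A A (mulR₂ A y t ⊗ₜ z)) := by
    intro t
    induction t with
    | zero => simp
    | add t t' ht ht' => simp only [TensorProduct.add_tmul, map_add, ht, ht']
    | tmul p q => simp [← E₁_mulR₁]
  have h2 : ∀ t : A ⊗[k] A, mulR₁ (k := k) (A ⊗[k] A) w (H.E₁.lTensor A
      (TensorProduct.assoc k A A A (t ⊗ₜ z))) = H.E₁.lTensor A
      (TensorProduct.assoc k A A A (mulR₁ A w t ⊗ₜ z)) := by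
    intro t
    induction t with
    | zero => simp
    | add t t' ht ht' => simp only [TensorProduct.add_tmul, map_add, ht, ht']
    | tmul p q => simp
  have h3 : leg12 H.T₁ A (x ⊗ₜ (y ⊗ₜ z)) =
    TensorProduct.assoc k A A A (H.T₁ (x ⊗ₜ y) ⊗ₜ z) := rfl
  simp only [LinearMap.comp_apply, h3, h2, H.T₁_T₄] at h
  rw [h1, h]
  have h4 : leg13 H.E₁ A (x ⊗ₜ (y ⊗ₜ z)) = (TensorProduct.comm k A A).toLinearMap.lTensor A
      (TensorProduct.assoc k A A A (H.E₁ (x ⊗ₜ z) ⊗ₜ y)) := rfl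
  rw [h4]
  generalize H.E₁ (x ⊗ₜ z) = t
  induction t with
  | zero => simp
  | add t t' ht ht' =>
    simp only [TensorProduct.add_tmul, TensorProduct.tmul_add, map_add, ht, ht']
  | tmul p q =>
    have h5 : ∀ s : A ⊗[k] A, mulR₁ (k := k) (A ⊗[k] A) w (TensorProduct.assoc k A A A (s ⊗ₜ q)) =
        TensorProduct.assoc k A A A (mulR₁ A w s ⊗ₜ q) := by
      intro s
      induction s with
      | zero => simp
      | add s s' hs hs' => simp only [TensorProduct.add_tmul, map_add, hs, hs']
      | tmul a b => simp
    have h6 : ∀ s : A ⊗[k] A, (mulR₁ (k := k) A y).lTensor A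
        (TensorProduct.assoc k A A A (s ⊗ₜ q)) =
        TensorProduct.assoc k A A A (mulR₂ A y s ⊗ₜ q) := by
      intro s
      induction s with
      | zero => simp
      | add s s' hs hs' => simp only [TensorProduct.add_tmul, map_add, hs, hs']
      | tmul a b => simp
    simp [leg12, h5, h6, H.T₁_T₄]

/-- `c ((A ⊗ ε) T₃(b ⊗ a)) = ((A ⊗ ε) E₂(c ⊗ a)) b`. -/
theorem piR_multiplier (a b c : A) :
    c * sliceRight A H.counit (H.T₃ (b ⊗ₜ a)) =
      sliceRight A H.counit (H.E₂ (c ⊗ₜ a)) * b := by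
  rw [← sub_eq_zero]
  apply H.right_nondeg
  intro x
  rw [sub_mul, sub_eq_zero, mul_assoc, mul_assoc]
  let F : A →ₗ[k] A := sliceLeft A H.counit ∘ₗ H.T₄ ∘ₗ (TensorProduct.mk k A A).flip a
  have hF : ∀ t, F t = sliceLeft A H.counit (H.T₄ (t ⊗ₜ a)) := fun _ => rfl
  have key : mulR₁ A (b * x) (H.E₂ (c ⊗ₜ a)) =
      TensorProduct.map (LinearMap.mulLeft k c) F (H.T₄ (x ⊗ₜ b)) := by
    refine cancel_mulR₂ H.right_nondeg fun z => ?_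
    have h1 : ∀ t : A ⊗[k] A, (c ⊗ₜ[k] a) * (sliceLeft A H.counit).lTensor A (H.E₁.lTensor A
        (TensorProduct.assoc k A A A (t ⊗ₜ z))) =
        mulR₂ A z (TensorProduct.map (LinearMap.mulLeft k c) F t) := by
      intro t
      induction t with
      | zero => simp
      | add t t' ht ht' => simp only [TensorProduct.add_tmul, map_add, mul_add, ht, ht']
      | tmul p q =>
        simp [hF, ← sliceLeft_mulL₂, H.counit_E₁, H.T₁_T₄, ← sliceLeft_mulR₂]
    rw [← h1, H.E₁_T₄, H.slice_leg12_T₄, ← E₁_mulR₁, H.E_mul, ← mulR₁_mulR₂, mulR₂_tmul_mul]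
    simp
  have h := congrArg (sliceRight A H.counit) key
  rw [sliceRight_mulR₁] at h
  rw [h, ← sliceRight_mulR₁, H.T₃_T₄, ← sliceRight_mulL₁]
  generalize H.T₄ (x ⊗ₜ b) = t
  induction t with
  | zero => simp
  | add t t' ht ht' => simp only [map_add, ht, ht']
  | tmul p q => simp [hF, counit_slice, H.counit_T₄]

/-- The map `⊓ᴿ : A → M(A)`, `⊓ᴿ(a) b = (A ⊗ ε) T₃(b ⊗ a)` and
`b ⊓ᴿ(a) = (A ⊗ ε) E₂(b ⊗ a)`. -/
def piR : A →ₗ[k] Multiplier k A where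
  toFun a := mkMultiplier
    (sliceRight A H.counit ∘ₗ H.T₃ ∘ₗ (TensorProduct.mk k A A).flip a)
    (sliceRight A H.counit ∘ₗ H.E₂ ∘ₗ (TensorProduct.mk k A A).flip a)
    (fun c b => H.piR_multiplier a b c)
  map_add' a b := multiplier_ext H.left_nondeg fun c => by
    change sliceRight A H.counit (H.E₂ (c ⊗ₜ (a + b))) =
      sliceRight A H.counit (H.E₂ (c ⊗ₜ a)) + sliceRight A H.counit (H.E₂ (c ⊗ₜ b))
    simp [TensorProduct.tmul_add]
  map_smul' r a := multiplier_ext H.left_nondeg fun c => by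
    change sliceRight A H.counit (H.E₂ (c ⊗ₜ (r • a))) =
      r • sliceRight A H.counit (H.E₂ (c ⊗ₜ a))
    simp

end

end RegularWeakMultiplierBialgebra

section Comodules

variable {k : Type*} [Field k] {A : Type*} [NonUnitalRing A] [Module k A]
  [IsScalarTower k A A] [SMulCommClass k A A]

/-- A right comodule structure on the vector space `V` over a regular weak multiplier bialgebra
`A`. -/
structure RightComod (H : RegularWeakMultiplierBialgebra k A) (V : Type*) [AddCommGroup V]
    [Module k V] where
  lam : V ⊗[k] A →ₗ[k] V ⊗[k] A
  rho : V ⊗[k] A →ₗ[k] V ⊗[k] A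
  /-- `(1 ⊗ a) λ(v ⊗ b) = ρ(v ⊗ a)(1 ⊗ b)`. -/
  compat : ∀ (v : V) (a b : A), mulL₂ V a (lam (v ⊗ₜ b)) = mulR₂ V b (rho (v ⊗ₜ a))
  /-- `(λ ⊗ A) λ¹³ (V ⊗ E₁) = (λ ⊗ A) λ¹³`. -/
  norm : leg12 lam A ∘ₗ leg13 lam A ∘ₗ H.E₁.lTensor V = leg12 lam A ∘ₗ leg13 lam A
  /-- `(λ ⊗ A) λ¹³ (V ⊗ T₁) = (V ⊗ T₁)(λ ⊗ A)`. -/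
  coassoc : leg12 lam A ∘ₗ leg13 lam A ∘ₗ H.T₁.lTensor V = H.T₁.lTensor V ∘ₗ leg12 lam A

namespace RightComod

variable {H : RegularWeakMultiplierBialgebra k A} {V W P : Type*} [AddCommGroup V] [Module k V]
  [AddCommGroup W] [Module k W] [AddCommGroup P] [Module k P]

/-- A comodule is full if `V` is spanned by the elements `(V ⊗ ω) λ(v ⊗ a)`. -/
def IsFull (c : RightComod H V) : Prop :=
  Submodule.span k {x : V | ∃ (v : V) (a : A) (ω : A →ₗ[k] k),
    x = sliceRight V ω (c.lam (v ⊗ₜ[k] a))} = ⊤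

/-- The map `λ_V¹³ (V ⊗ λ_W)` on `V ⊗ W ⊗ A`. -/
def prodLam (c : RightComod H V) (d : RightComod H W) :
    (V ⊗[k] W) ⊗[k] A →ₗ[k] (V ⊗[k] W) ⊗[k] A :=
  (TensorProduct.assoc k V W A).symm.toLinearMap ∘ₗ leg13 c.lam W ∘ₗ d.lam.lTensor V ∘ₗ
    (TensorProduct.assoc k V W A).toLinearMap

/-- The map `(V ⊗ ρ_W) ρ_V¹³` on `V ⊗ W ⊗ A`. -/
def prodRho (c : RightComod H V) (d : RightComod H W) :
    (V ⊗[k] W) ⊗[k] A →ₗ[k] (V ⊗[k] W) ⊗[k] A :=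
  (TensorProduct.assoc k V W A).symm.toLinearMap ∘ₗ d.rho.lTensor V ∘ₗ leg13 c.rho W ∘ₗ
    (TensorProduct.assoc k V W A).toLinearMap

/-- The coactions of `e` on `P` are induced, along `p : V ⊗ W → P`, by the coactions
`λ_V¹³ (V ⊗ λ_W)` and `(V ⊗ ρ_W) ρ_V¹³` on `V ⊗ W`. -/
def IsInduced (c : RightComod H V) (d : RightComod H W) (p : V ⊗[k] W →ₗ[k] P)
    (e : RightComod H P) : Prop :=
  e.lam ∘ₗ p.rTensor A = p.rTensor A ∘ₗ prodLam c d ∧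
    e.rho ∘ₗ p.rTensor A = p.rTensor A ∘ₗ prodRho c d

/-- The coactions on the base algebra `R` are `λ(r ⊗ a) = E (1 ⊗ r a)` and
`ρ(r ⊗ a) = (1 ⊗ a r) E`. As these are elements of `R ⊗ A` inside the multiplier algebra of
`A ⊗ A`, they are determined by their products with all `b ⊗ 1`, which are written out here. -/
def IsBaseComod (c : RightComod H H.base) : Prop :=
  (∀ (r : H.base) (a b : A),
    ((lactAt b ∘ₗ H.base.toSubmodule.subtype).rTensor A) (c.lam (r ⊗ₜ[k] a)) =
      H.E₁ (b ⊗ₜ[k] lact r.1 a)) ∧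
  ∀ (r : H.base) (a b : A),
    ((ractAt b ∘ₗ H.base.toSubmodule.subtype).rTensor A) (c.rho (r ⊗ₜ[k] a)) =
      H.E₂ (b ⊗ₜ[k] ract r.1 a)

end RightComod

end Comodules

open FirmBimodules

/-- A full right comodule over a regular weak multiplier bialgebra. -/
structure FullComod {k : Type u} [Field k] {A : Type v} [NonUnitalRing A] [Module k A]
    [IsScalarTower k A A] [SMulCommClass k A A] (H : RegularWeakMultiplierBialgebra k A) where
  carrier : Type v
  [addCommGroup : AddCommGroup carrier]
  [module : Module k carrier]
  str : RightComod H carrier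
  full : str.IsFull

namespace FullComod

attribute [instance] addCommGroup module

variable {k : Type u} [Field k] {A : Type v} [NonUnitalRing A] [Module k A]
  [IsScalarTower k A A] [SMulCommClass k A A] {H : RegularWeakMultiplierBialgebra k A}

/-- Morphisms of comodules: linear maps compatible with `λ` and with `ρ` (each of the two
conditions implies the other one). -/
@[ext] structure Hom (X Y : FullComod H) where
  lin : X.carrier →ₗ[k] Y.carrier
  comm_lam : Y.str.lam ∘ₗ lin.rTensor A = lin.rTensor A ∘ₗ X.str.lam
  comm_rho : Y.str.rho ∘ₗ lin.rTensor A = lin.rTensor A ∘ₗ X.str.rho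

/-- The category of full right comodules. -/
instance : Category (FullComod H) where
  Hom := Hom
  id X := ⟨LinearMap.id, by simp, by simp⟩
  comp f g := ⟨g.lin ∘ₗ f.lin,
    by rw [LinearMap.rTensor_comp, ← LinearMap.comp_assoc, g.comm_lam, LinearMap.comp_assoc,
      f.comm_lam, LinearMap.comp_assoc],
    by rw [LinearMap.rTensor_comp, ← LinearMap.comp_assoc, g.comm_rho, LinearMap.comp_assoc,
      f.comm_rho, LinearMap.comp_assoc]⟩

end FullComod

section Functor

variable {k : Type u} [Field k] {A : Type v} [NonUnitalRing A] [Module k A]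
  [IsScalarTower k A A] [SMulCommClass k A A]

/-- The maps `⊓ᴿ` and `⊓̄ᴿ` have the same range `R`, and every full right comodule `V` is a firm
`R`-bimodule via the actions `v ⊓̄ᴿ(a) = (V ⊗ ε) λ(v ⊗ a)` and `⊓ᴿ(a) v = (V ⊗ ε) ρ(v ⊗ a)`.
(These formulae determine the actions.) -/
structure BaseActions (H : RegularWeakMultiplierBialgebra k A) where
  range_eq : LinearMap.range H.piR = LinearMap.range H.piBarR
  str : ∀ V : FullComod H, BimoduleStr k H.base V.carrier
  firm : ∀ V, (str V).IsFirm
  right_eq : ∀ (V : FullComod H) (r : H.base) (a : A), H.piBarR a = r.1 → ∀ v,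
    (str V).right r v = sliceRight V.carrier H.counit (V.str.lam (v ⊗ₜ[k] a))
  left_eq : ∀ (V : FullComod H) (r : H.base) (a : A), H.piR a = r.1 → ∀ v,
    (str V).left r v = sliceRight V.carrier H.counit (V.str.rho (v ⊗ₜ[k] a))

namespace BaseActions

variable {H : RegularWeakMultiplierBialgebra k A}

theorem exists_piR (B : BaseActions H) (r : H.base) : ∃ a, H.piR a = r.1 := by
  have h : r.1 ∈ LinearMap.range H.piBarR := r.2
  rw [← B.range_eq] at h
  exact h

theorem map_slice {V W : Type*} [AddCommGroup V] [Module k V] [AddCommGroup W] [Module k W]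
    (f : V →ₗ[k] W) (ω : A →ₗ[k] k) (x : V ⊗[k] A) :
    f (sliceRight V ω x) = sliceRight W ω (f.rTensor A x) := by
  induction x with
  | zero => simp
  | add x y hx hy => simp [hx, hy]
  | tmul v a => simp

theorem map_left (B : BaseActions H) {V W : FullComod H} (f : FullComod.Hom V W) (r : H.base)
    (v : V.carrier) : f.lin ((B.str V).left r v) = (B.str W).left r (f.lin v) := by
  obtain ⟨a, ha⟩ := B.exists_piR r
  rw [B.left_eq V r a ha, B.left_eq W r a ha, map_slice]
  exact congrArg _ (LinearMap.congr_fun f.comm_rho (v ⊗ₜ a)).symm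

theorem map_right (B : BaseActions H) {V W : FullComod H} (f : FullComod.Hom V W) (r : H.base)
    (v : V.carrier) : f.lin ((B.str V).right r v) = (B.str W).right r (f.lin v) := by
  obtain ⟨a, ha⟩ := H.mem_base.1 r.2
  rw [B.right_eq V r a ha, B.right_eq W r a ha, map_slice]
  exact congrArg _ (LinearMap.congr_fun f.comm_lam (v ⊗ₜ a)).symm

/-- The forgetful functor from full right comodules to firm `R`-bimodules. It does not change the
underlying vector spaces and linear maps. -/
def functor (B : BaseActions H) : FullComod H ⥤ FirmBimod k H.base where
  obj V := ⟨V.carrier, B.str V, B.firm V⟩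
  map f := ⟨FullComod.Hom.lin f, B.map_left f, B.map_right f⟩
  map_id _ := rfl
  map_comp _ _ := rfl

end BaseActions

end Functor

/-- A functor between monoidal categories is strict monoidal if it preserves the monoidal unit,
the monoidal product of objects and of morphisms, the associator and the unitors on the nose. -/
structure IsStrictMonoidal {C D : Type*} [Category* C] [Category* D] [MonoidalCategory C]
    [MonoidalCategory D] (F : C ⥤ D) : Prop where
  obj_unit : F.obj (𝟙_ C) = 𝟙_ D
  obj_tensor : ∀ X Y : C, F.obj (X ⊗ Y) = F.obj X ⊗ F.obj Y
  map_tensor : ∀ {X X' Y Y' : C} (f : X ⟶ X') (g : Y ⟶ Y'),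
    F.map (f ⊗ₘ g) =
      eqToHom (obj_tensor X Y) ≫ (F.map f ⊗ₘ F.map g) ≫ eqToHom (obj_tensor X' Y').symm
  map_associator : ∀ X Y Z : C,
    F.map (α_ X Y Z).hom =
      eqToHom (by rw [obj_tensor, obj_tensor]) ≫ (α_ (F.obj X) (F.obj Y) (F.obj Z)).hom ≫
        eqToHom (by rw [obj_tensor, obj_tensor])
  map_leftUnitor : ∀ X : C,
    F.map (λ_ X).hom = eqToHom (by rw [obj_tensor, obj_unit]) ≫ (λ_ (F.obj X)).hom
  map_rightUnitor : ∀ X : C,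
    F.map (ρ_ X).hom = eqToHom (by rw [obj_tensor, obj_unit]) ≫ (ρ_ (F.obj X)).hom

end WeakMultiplier

end

open FirmBimodules WeakMultiplier

/-! ### Calculus of legs in tensor products, and the opposite algebra. -/

noncomputable section

namespace WeakMultiplier

section Tensor

variable {k : Type*} [Field k] {A : Type*} [NonUnitalRing A] [Module k A]
  [IsScalarTower k A A] [SMulCommClass k A A] {V W Z P : Type*} [AddCommGroup V] [Module k V]
  [AddCommGroup W] [Module k W] [AddCommGroup Z] [Module k Z] [AddCommGroup P] [Module k P]

/-! Write `Δ(a) = a₁ ⊗ a₂`, `λ(v ⊗ a) = v₀ ⊗ v₁ a`, `ρ(v ⊗ a) = v₀ ⊗ a v₁` and `v ◁ a = (V ⊗ ε) λ(v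
⊗ a)`. There is no unit, so an identity in a tensor product is proved after multiplying its legs by
elements of `A`, which loses nothing because `A` is non-degenerate.

The engine is `lTensor_lam₂`. By the axiom on spans every `E w` is a sum of elements `Δ(p) t`
(`exists_comul`), the axiom `norm` allows `w` to be replaced by `E w` under the iterated coaction,
and coassociativity then evaluates `(V ⊗ F)(λ ⊗ A)λ¹³` for both slices `F = ε ⊗ A` and `F = A ⊗ ε`.
This gives `(v₀ ◁ a) ⊗ v₁ b = v₀ ⊗ v₁ ⊓ᴸ(a) b` and `λ((v ◁ a) ⊗ b) = λ(v ⊗ ⊓̄ᴿ(a) b)`. On a full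
comodule the first formula shows that `◁ a` depends only on `⊓̄ᴿ(a)` and that the elements `v ◁ a`
span `V`; the second shows that `◁` is multiplicative. The statements about `ρ` and the left action
are those about `λ` and the right action over the opposite of `A`, which is again a regular weak
multiplier bialgebra (`RegularWeakMultiplierBialgebra.op`, `RightComod.op`).

The formula `E (1 ⊗ p q) = ⊓̄ᴿ(p₁) ⊗ p₂ q` (`E₁_tmul_mul`) places `E (1 ⊗ a)` in `R ⊗ A`; dually the
first legs of `(1 ⊗ a) E` are values of `⊓ᴿ`. Comparing both in `(1 ⊗ a) E (1 ⊗ b)`, right fullness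
yields the equality of the two ranges (`range_piR`). If `E (1 ⊗ a) = ∑ rᵢ ⊗ aᵢ`, then `⊓̄ᴿ(a) ↦ ∑
⊓̄ᴿ(aᵢ) ⊗ rᵢ` is a well defined map `δ : R → R ⊗ R` that splits the multiplication and satisfies `r
δ(s) = δ(r) s`. So `R` is coseparable, and over such an algebra with the relevant non-degeneracy a
bimodule with `R M = M = M R` is firm (`leftMap_bijective`, `rightMap_bijective`).

The coaction `v₀ ⊗ w₀ ⊗ v₁ w₁ a` on `V ⊗ W` is `R`-balanced, because `(v r) ⊗ w` and `v ⊗ (r w)`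
both insert `r` between `v₁` and `w₁`. On a full comodule `E` acts trivially on `λ(v ⊗ a)` when its
first leg acts through `R` (`IsFull.baseLeftE_lam`). Applying `ε`, one finds that the comodule `V
⊗_R W` induces the usual bimodule structure of `V ⊗_R W` (`bimod_relProd`); the comodule `R` induces
the regular bimodule (`bimod_baseComod`). These are equalities of structures on the same space. The
associator and the unitors of bimodules commute with `λ`, so they lift to comodules; the forgetful
functor is faithful, so the monoidal axioms lift as well, and it is strict because its comparison
isomorphisms are identities. -/

theorem rTensor_mulL₂ (f : V →ₗ[k] W) (a : A) (x : V ⊗[k] A) :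
    f.rTensor A (mulL₂ V a x) = mulL₂ W a (f.rTensor A x) := by
  induction x with
  | zero => simp
  | add x y hx hy => simp only [map_add, hx, hy]
  | tmul v b => simp

theorem rTensor_mulR₂ (f : V →ₗ[k] W) (a : A) (x : V ⊗[k] A) :
    f.rTensor A (mulR₂ V a x) = mulR₂ W a (f.rTensor A x) := by
  induction x with
  | zero => simp
  | add x y hx hy => simp only [map_add, hx, hy]
  | tmul v b => simp

theorem lTensor_mulR₁ (f : V →ₗ[k] W) (a : A) (x : A ⊗[k] V) :
    f.lTensor A (mulR₁ V a x) = mulR₁ W a (f.lTensor A x) := by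
  induction x with
  | zero => simp
  | add x y hx hy => simp only [map_add, hx, hy]
  | tmul v b => simp

theorem lTensor_mulL₁ (f : V →ₗ[k] W) (a : A) (x : A ⊗[k] V) :
    f.lTensor A (mulL₁ V a x) = mulL₁ W a (f.lTensor A x) := by
  induction x with
  | zero => simp
  | add x y hx hy => simp only [map_add, hx, hy]
  | tmul v b => simp

theorem rTensor_lTensor (f : V →ₗ[k] W) (g : Z →ₗ[k] P) (x : V ⊗[k] Z) :
    f.rTensor P (g.lTensor V x) = g.lTensor W (f.rTensor Z x) := by
  induction x with
  | zero => simp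
  | add x y hx hy => simp only [map_add, hx, hy]
  | tmul v b => simp

theorem mulR₂_mulR₂ (a b : A) (x : V ⊗[k] A) :
    mulR₂ V b (mulR₂ V a x) = mulR₂ V (a * b) x := by
  induction x with
  | zero => simp
  | add x y hx hy => simp only [map_add, hx, hy]
  | tmul v c => simp [mul_assoc]

theorem mulR₁_mulR₁ (a b : A) (x : A ⊗[k] V) :
    mulR₁ V b (mulR₁ V a x) = mulR₁ V (a * b) x := by
  induction x with
  | zero => simp
  | add x y hx hy => simp only [map_add, hx, hy]
  | tmul v c => simp [mul_assoc]

theorem mulR₂_mul (a : A) (x y : A ⊗[k] A) : x * mulR₂ A a y = mulR₂ A a (x * y) := by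
  induction x with
  | zero => simp
  | add x x' hx hx' => simp only [add_mul, map_add, hx, hx']
  | tmul p q =>
    induction y with
    | zero => simp
    | add y y' hy hy' => simp only [mul_add, map_add, hy, hy']
    | tmul r s => simp [mul_assoc]

theorem mulL₁_mul (a : A) (x y : A ⊗[k] A) : mulL₁ A a x * y = mulL₁ A a (x * y) := by
  induction x with
  | zero => simp
  | add x x' hx hx' => simp only [add_mul, map_add, hx, hx']
  | tmul p q =>
    induction y with
    | zero => simp
    | add y y' hy hy' => simp only [mul_add, map_add, hy, hy']
    | tmul r s => simp [mul_assoc]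

theorem mulL₂_mul (a : A) (x y : A ⊗[k] A) : mulL₂ A a x * y = mulL₂ A a (x * y) := by
  induction x with
  | zero => simp
  | add x x' hx hx' => simp only [add_mul, map_add, hx, hx']
  | tmul p q =>
    induction y with
    | zero => simp
    | add y y' hy hy' => simp only [mul_add, map_add, hy, hy']
    | tmul r s => simp [mul_assoc]

@[simp] theorem leg12_tmul (f : V ⊗[k] W →ₗ[k] Z ⊗[k] P) (v : V) (w : W) (a : A) :
    leg12 f A (v ⊗ₜ (w ⊗ₜ a)) = TensorProduct.assoc k Z P A (f (v ⊗ₜ w) ⊗ₜ a) := rfl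

theorem map_sliceRight (f : V →ₗ[k] W) (ω : A →ₗ[k] k) (x : V ⊗[k] A) :
    f (sliceRight V ω x) = sliceRight W ω (f.rTensor A x) := by
  induction x with
  | zero => simp
  | add x y hx hy => simp [hx, hy]
  | tmul v a => simp

theorem sliceRight_lTensor (f : W →ₗ[k] A) (ω : A →ₗ[k] k) (x : V ⊗[k] W) :
    sliceRight V ω (f.lTensor V x) = sliceRight V (ω ∘ₗ f) x := by
  induction x with
  | zero => simp
  | add x y hx hy => simp [hx, hy]
  | tmul v a => simp

theorem cancel_lTensor_mulR₂ (h : ∀ a : A, (∀ b : A, a * b = 0) → a = 0)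
    {x y : W ⊗[k] (V ⊗[k] A)}
    (hx : ∀ a, (mulR₂ V a).lTensor W x = (mulR₂ V a).lTensor W y) : x = y := by
  rw [← sub_eq_zero]
  refine lTensor_joint (fun a : A => mulR₂ (k := k) V a) (fun u hu => ?_) _ fun a => ?_
  · exact cancel_mulR₂ h fun a => by simp [hu]
  · rw [map_sub, sub_eq_zero]
    exact hx a

theorem mulL₁_assoc (a : A) (x : A ⊗[k] W) (z : Z) :
    mulL₁ (k := k) (W ⊗[k] Z) a (TensorProduct.assoc k A W Z (x ⊗ₜ z)) =
      TensorProduct.assoc k A W Z (mulL₁ W a x ⊗ₜ z) := by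
  induction x with
  | zero => simp
  | add x y hx hy => simp only [map_add, TensorProduct.add_tmul, hx, hy]
  | tmul v b => simp

theorem mulR₁_assoc (a : A) (x : A ⊗[k] W) (z : Z) :
    mulR₁ (k := k) (W ⊗[k] Z) a (TensorProduct.assoc k A W Z (x ⊗ₜ z)) =
      TensorProduct.assoc k A W Z (mulR₁ W a x ⊗ₜ z) := by
  induction x with
  | zero => simp
  | add x y hx hy => simp only [map_add, TensorProduct.add_tmul, hx, hy]
  | tmul v b => simp

theorem lTensor_mulR₁_assoc (a : A) (x : V ⊗[k] A) (z : Z) :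
    (mulR₁ (k := k) Z a).lTensor V (TensorProduct.assoc k V A Z (x ⊗ₜ z)) =
      TensorProduct.assoc k V A Z (mulR₂ V a x ⊗ₜ z) := by
  induction x with
  | zero => simp
  | add x y hx hy => simp only [map_add, TensorProduct.add_tmul, hx, hy]
  | tmul v b => simp

theorem lTensor_mulL₁_assoc (a : A) (x : V ⊗[k] A) (z : Z) :
    (mulL₁ (k := k) Z a).lTensor V (TensorProduct.assoc k V A Z (x ⊗ₜ z)) =
      TensorProduct.assoc k V A Z (mulL₂ V a x ⊗ₜ z) := by
  induction x with
  | zero => simp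
  | add x y hx hy => simp only [map_add, TensorProduct.add_tmul, hx, hy]
  | tmul v b => simp

theorem lTensor_lTensor_assoc (g : Z →ₗ[k] P) (x : V ⊗[k] W) (z : Z) :
    (g.lTensor W).lTensor V (TensorProduct.assoc k V W Z (x ⊗ₜ z)) =
      TensorProduct.assoc k V W P (x ⊗ₜ g z) := by
  induction x with
  | zero => simp
  | add x y hx hy => simp only [map_add, TensorProduct.add_tmul, hx, hy]
  | tmul v b => simp

/-- `w ↦ v ⊗ w`. -/
abbrev tmulLeft (W : Type*) [AddCommGroup W] [Module k W] (v : V) : W →ₗ[k] V ⊗[k] W :=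
  TensorProduct.mk k V W v

/-- `v ↦ v ⊗ w`. -/
abbrev tmulRight (V : Type*) [AddCommGroup V] [Module k V] (w : W) : V →ₗ[k] V ⊗[k] W :=
  (TensorProduct.mk k V W).flip w

/-- In `(f ⊗ A) f¹³` the inner map consumes `b`, sends its output in `A` to the last place, and the
outer map then consumes `a`. This is the Sweedler form in which the iterated coaction is computed on
elementary tensors. -/
theorem leg12_leg13_tmul (f : V ⊗[k] A →ₗ[k] V ⊗[k] A) (v : V) (a b : A) :
    leg12 f A (leg13 f A (v ⊗ₜ (a ⊗ₜ b))) =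
      TensorProduct.assoc k V A A ((f ∘ₗ tmulRight V a).rTensor A (f (v ⊗ₜ b))) := by
  have h : ∀ t : V ⊗[k] A, leg12 f A ((TensorProduct.comm k A A).toLinearMap.lTensor V
      (TensorProduct.assoc k V A A (t ⊗ₜ a))) =
        TensorProduct.assoc k V A A ((f ∘ₗ tmulRight V a).rTensor A t) := by
    intro t
    induction t with
    | zero => simp
    | add t t' ht ht' => simp only [TensorProduct.add_tmul, map_add, ht, ht']
    | tmul p q => simp
  exact h _

/-- The multiplication of `A ⊗ A` is non-degenerate. -/
theorem tensor_left_nondeg (h : ∀ a : A, (∀ b : A, b * a = 0) → a = 0) {x y : A ⊗[k] A}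
    (hx : ∀ w : A ⊗[k] A, w * x = w * y) : x = y :=
  cancel_mulL₂ h fun b => cancel_mulL₁ h fun a => by simp only [mulL₂_tmul_mul, hx]

theorem tensor_right_nondeg (h : ∀ a : A, (∀ b : A, a * b = 0) → a = 0) {x y : A ⊗[k] A}
    (hx : ∀ w : A ⊗[k] A, x * w = y * w) : x = y :=
  cancel_mulR₂ h fun b => cancel_mulR₁ h fun a => by simp only [mulR₂_tmul_mul, hx]

end Tensor

/-- The opposite of a not necessarily unital ring, on the same type. -/
def Op (A : Type*) := A

section Op

instance (A : Type*) [NonUnitalRing A] : NonUnitalRing (Op A) :=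
  { (inferInstance : AddCommGroup A) with
    mul := fun (a b : A) => (b * a : A)
    left_distrib := fun a b c => add_mul (R := A) b c a
    right_distrib := fun a b c => mul_add (R := A) c a b
    zero_mul := fun a => mul_zero (M₀ := A) a
    mul_zero := fun a => zero_mul (M₀ := A) a
    mul_assoc := fun a b c => (mul_assoc (G := A) c b a).symm }

variable {k : Type*} [Field k] {A : Type*} [NonUnitalRing A] [Module k A]

instance : Module k (Op A) := inferInstanceAs (Module k A)

variable [IsScalarTower k A A] [SMulCommClass k A A]

instance : IsScalarTower k (Op A) (Op A) :=
  ⟨fun c a b => mul_smul_comm (α := k) (β := A) c b a⟩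

instance : SMulCommClass k (Op A) (Op A) :=
  ⟨fun c a b => (smul_mul_assoc (α := k) (β := A) c b a).symm⟩

variable {V : Type*} [AddCommGroup V] [Module k V]

/-- The product on the space `A ⊗ A` reverses in both legs at once. Together with `mul_tmul_op` it
suffices to have one elementary factor, since this is all that the axiom `E_multiplier` of the
opposite needs. -/
theorem tmul_mul_op (a b : A) (x : A ⊗[k] A) :
    (show Op A ⊗[k] Op A from a ⊗ₜ[k] b) * (show Op A ⊗[k] Op A from x) = x * (a ⊗ₜ[k] b) :=
  (mulL₂_tmul_mul (k := k) (A := Op A) a b (show Op A ⊗[k] Op A from x)).symm.trans (mulR₂_tmul_mul (A := A) a b x)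

theorem mul_tmul_op (a b : A) (x : A ⊗[k] A) :
    (show Op A ⊗[k] Op A from x) * (show Op A ⊗[k] Op A from a ⊗ₜ[k] b) = (a ⊗ₜ[k] b) * x :=
  (mulR₂_tmul_mul (k := k) (A := Op A) a b (show Op A ⊗[k] Op A from x)).symm.trans (mulL₂_tmul_mul (A := A) a b x)

end Op

end WeakMultiplier

end

/-! ### Left multiplication by `Δ(y)`, and the opposite weak multiplier bialgebra. -/

noncomputable section

namespace WeakMultiplier

section

variable {k : Type*} [Field k] {A : Type*} [NonUnitalRing A] [Module k A]
  [IsScalarTower k A A] [SMulCommClass k A A]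

/-- `y ↦ (b ⊗ c ↦ T(y ⊗ c)(b ⊗ 1))`. -/
def firstLegMul (T : A ⊗[k] A →ₗ[k] A ⊗[k] A) : A →ₗ[k] A ⊗[k] A →ₗ[k] A ⊗[k] A :=
  TensorProduct.curry ((LinearMap.mul' k A).rTensor A ∘ₗ
    (TensorProduct.assoc k A A A).symm.toLinearMap ∘ₗ leg13 T A)

theorem firstLegMul_tmul (T : A ⊗[k] A →ₗ[k] A ⊗[k] A) (a b c : A) :
    firstLegMul T a (b ⊗ₜ c) = mulR₁ A b (T (a ⊗ₜ c)) := by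
  have h : ∀ t : A ⊗[k] A, (LinearMap.mul' k A).rTensor A ((TensorProduct.assoc k A A A).symm
      ((TensorProduct.comm k A A).toLinearMap.lTensor A
        (TensorProduct.assoc k A A A (t ⊗ₜ b)))) = mulR₁ A b t := by
    intro t
    induction t with
    | zero => simp
    | add t t' ht ht' => simp only [TensorProduct.add_tmul, map_add, ht, ht']
    | tmul p q => simp
  exact h _

end

namespace RegularWeakMultiplierBialgebra

variable {k : Type*} [Field k] {A : Type*} [NonUnitalRing A] [Module k A]
  [IsScalarTower k A A] [SMulCommClass k A A] (H : RegularWeakMultiplierBialgebra k A)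

/-- `(x ⊗ 1) T₃(a ⊗ c) = (1 ⊗ c) T₂(x ⊗ a)`. -/
theorem T₂_T₃ (x a c : A) : mulL₁ A x (H.T₃ (a ⊗ₜ c)) = mulL₂ A c (H.T₂ (x ⊗ₜ a)) :=
  cancel_mulR₂ H.right_nondeg fun d => by
    rw [← mulL₁_mulR₂, ← H.T₁_T₃, mulL₁_mulL₂, H.T₁_T₂, mulL₂_mulR₂]

theorem E₁_mulR₂ (a : A) (x : A ⊗[k] A) : H.E₁ (mulR₂ A a x) = mulR₂ A a (H.E₁ x) :=
  tensor_left_nondeg H.left_nondeg fun w => by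
    rw [H.E_mul, mulR₂_mul, mulR₂_mul, H.E_mul]

theorem E₂_mulL₁ (a : A) (x : A ⊗[k] A) : H.E₂ (mulL₁ A a x) = mulL₁ A a (H.E₂ x) :=
  tensor_right_nondeg H.right_nondeg fun w => by
    rw [← H.E_mul, mulL₁_mul, mulL₁_mul, H.E_mul]

theorem E₁_E₁ (x : A ⊗[k] A) : H.E₁ (H.E₁ x) = H.E₁ x := LinearMap.congr_fun H.E_idem x

theorem E₂_E₂ (x : A ⊗[k] A) : H.E₂ (H.E₂ x) = H.E₂ x :=
  tensor_right_nondeg H.right_nondeg fun w => by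
    rw [← H.E_mul, ← H.E_mul, H.E₁_E₁, H.E_mul]

/-- `(ε ⊗ A) T₃(a ⊗ b) = b a`. -/
theorem counit_T₃ (a b : A) : sliceLeft A H.counit (H.T₃ (a ⊗ₜ b)) = b * a := by
  rw [← sub_eq_zero]
  apply H.right_nondeg
  intro c
  rw [sub_mul, sub_eq_zero, ← sliceLeft_mulR₂, ← H.T₁_T₃, sliceLeft_mulL₂, H.counit_T₁_apply,
    mul_assoc]

/-- `(T₄ ⊗ A)(A ⊗ T₃) = (A ⊗ T₃)(T₄ ⊗ A)`. -/
theorem T₄_T₃ : leg12 H.T₄ A ∘ₗ H.T₃.lTensor A = H.T₃.lTensor A ∘ₗ leg12 H.T₄ A := by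
  refine TensorProduct.ext_threefold' fun a b c => ?_
  -- Multiplying the first leg by `x` on the left turns `T₄` into `T₂`, and multiplying the last leg
  -- by `y` on the right turns `T₃` into `T₁`. What remains is the axiom `coassoc`.
  refine cancel_mulL₁ H.left_nondeg fun x => cancel_lTensor_mulR₂ H.right_nondeg fun y => ?_
  have h1 : ∀ t : A ⊗[k] A, (mulR₂ A y).lTensor A (mulL₁ (A ⊗[k] A) x (leg12 H.T₄ A (a ⊗ₜ t))) =
      mulR₁ (k := k) (A ⊗[k] A) a (leg12 H.T₂ A (x ⊗ₜ mulR₂ A y t)) := by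
    intro t
    induction t with
    | zero => simp
    | add t t' ht ht' => simp only [TensorProduct.tmul_add, map_add, ht, ht']
    | tmul p q =>
      rw [leg12_tmul, mulL₁_assoc, ← H.T₂_T₄, mulR₂, lTensor_lTensor_assoc]
      simp [mulR₁_assoc]
  have h2 : ∀ t : A ⊗[k] A, (mulR₂ A y).lTensor A (mulL₁ (A ⊗[k] A) x
      (H.T₃.lTensor A (TensorProduct.assoc k A A A (t ⊗ₜ c)))) =
      (mulL₂ A c).lTensor A (H.T₁.lTensor A
        (TensorProduct.assoc k A A A (mulL₁ A x t ⊗ₜ y))) := by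
    intro t
    induction t with
    | zero => simp
    | add t t' ht ht' => simp only [TensorProduct.add_tmul, map_add, ht, ht']
    | tmul p q => simp [H.T₁_T₃]
  have h3 : ∀ t : A ⊗[k] A, (mulL₂ A c).lTensor A (leg12 H.T₂ A (x ⊗ₜ t)) =
      leg12 H.T₂ A (x ⊗ₜ mulL₂ A c t) := by
    intro t
    induction t with
    | zero => simp
    | add t t' ht ht' => simp only [TensorProduct.tmul_add, map_add, ht, ht']
    | tmul p q => simp only [leg12_tmul, mulL₂, lTensor_lTensor_assoc, LinearMap.lTensor_tmul]
  have h4 : ∀ t : A ⊗[k] A, H.T₁.lTensor A (TensorProduct.assoc k A A A (mulR₁ A a t ⊗ₜ y)) =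
      mulR₁ (k := k) (A ⊗[k] A) a (H.T₁.lTensor A (TensorProduct.assoc k A A A (t ⊗ₜ y))) := by
    intro t
    induction t with
    | zero => simp
    | add t t' ht ht' => simp only [TensorProduct.add_tmul, map_add, ht, ht']
    | tmul p q => simp
  have h := LinearMap.congr_fun H.coassoc (x ⊗ₜ (b ⊗ₜ y))
  simp only [LinearMap.comp_apply, LinearMap.lTensor_tmul, leg12_tmul] at h
  rw [LinearMap.comp_apply, LinearMap.lTensor_tmul, h1, ← H.T₁_T₃, ← h3, h,
    LinearMap.comp_apply, leg12_tmul, h2, ← H.T₂_T₄, h4, lTensor_mulR₁]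

/-- The left multiplication by `Δ(y)`. -/
def comul : A →ₗ[k] A ⊗[k] A →ₗ[k] A ⊗[k] A := firstLegMul H.T₁

theorem comul_tmul (y b c : A) : H.comul y (b ⊗ₜ c) = mulR₁ A b (H.T₁ (y ⊗ₜ c)) :=
  firstLegMul_tmul H.T₁ y b c

theorem comul_mulR₁ (y a : A) (t : A ⊗[k] A) :
    H.comul y (mulR₁ A a t) = mulR₁ A a (H.comul y t) := by
  induction t with
  | zero => simp
  | add t t' ht ht' => simp only [map_add, ht, ht']
  | tmul p q => simp [comul_tmul, mulR₁_mulR₁]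

/-- The axiom `T₁_mul`: it expresses that `Δ` is multiplicative. -/
theorem comul_T₁ (a b c : A) : H.comul a (H.T₁ (b ⊗ₜ c)) = H.T₁ ((a * b) ⊗ₜ c) :=
  LinearMap.congr_fun H.T₁_mul (a ⊗ₜ (b ⊗ₜ c))

theorem T₃_mul_eq (b c : A) (s : A ⊗[k] A) : H.T₃ (b ⊗ₜ c) * s = mulL₂ A c (H.comul b s) := by
  induction s with
  | zero => simp
  | add s s' hs hs' => simp only [map_add, mul_add, hs, hs']
  | tmul p q => rw [← mulR₂_tmul_mul, ← H.T₁_T₃, comul_tmul, mulR₁_mulL₂]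

theorem T₂_mul_eq (x b : A) (s : A ⊗[k] A) : H.T₂ (x ⊗ₜ b) * s = mulL₁ A x (H.comul b s) := by
  induction s with
  | zero => simp
  | add s s' hs hs' => simp only [map_add, mul_add, hs, hs']
  | tmul p q => rw [← mulR₂_tmul_mul, ← H.T₁_T₂, comul_tmul, mulL₁_mulR₁]

/-- `(b ⊗ c) Δ(y)` in terms of `T₂` and `T₃`, times `w`. -/
theorem comul_multiplier (b c y : A) (w : A ⊗[k] A) :
    (b ⊗ₜ[k] c) * H.comul y w = mulL₂ A c (H.T₂ (b ⊗ₜ y)) * w := by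
  rw [mulL₂_mul, T₂_mul_eq, ← mulL₁_mulL₂, mulL₂_tmul_mul]

/-- This becomes the axiom `E₁_T₁` of the opposite. Multiplying the first leg by `x` from the left
replaces `T₃` by `T₂` (`T₂_T₃`), and then the axiom `E₂_T₂` applies. -/
theorem E₂_T₃ : H.E₂.lTensor A ∘ₗ leg12 H.T₃ A = leg12 H.T₃ A ∘ₗ leg13 H.E₂ A := by
  refine TensorProduct.ext_threefold' fun a b c => cancel_mulL₁ H.left_nondeg fun x => ?_
  have h1 : ∀ t : A ⊗[k] A, mulL₁ (k := k) (A ⊗[k] A) x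
      (H.E₂.lTensor A (TensorProduct.assoc k A A A (t ⊗ₜ c))) =
      H.E₂.lTensor A (TensorProduct.assoc k A A A (mulL₁ A x t ⊗ₜ c)) := by
    intro t
    rw [← mulL₁_assoc, lTensor_mulL₁]
  have h2 : ∀ t : A ⊗[k] A, H.E₂.lTensor A (TensorProduct.assoc k A A A (mulL₂ A b t ⊗ₜ c)) =
      (mulL₁ A b).lTensor A (H.E₂.lTensor A (TensorProduct.assoc k A A A (t ⊗ₜ c))) := by
    intro t
    induction t with
    | zero => simp
    | add t t' ht ht' => simp only [TensorProduct.add_tmul, map_add, ht, ht']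
    | tmul p q => simp [← E₂_mulL₁]
  have h3 : leg13 H.E₂ A (a ⊗ₜ (b ⊗ₜ c)) = (TensorProduct.comm k A A).toLinearMap.lTensor A
      (TensorProduct.assoc k A A A (H.E₂ (a ⊗ₜ c) ⊗ₜ b)) := rfl
  have h4 : ∀ t : A ⊗[k] A, mulL₁ (k := k) (A ⊗[k] A) x (leg12 H.T₃ A
      ((TensorProduct.comm k A A).toLinearMap.lTensor A (TensorProduct.assoc k A A A (t ⊗ₜ b)))) =
      (mulL₁ A b).lTensor A (leg12 H.T₂ A (x ⊗ₜ t)) := by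
    intro t
    induction t with
    | zero => simp
    | add t t' ht ht' =>
      simp only [TensorProduct.add_tmul, TensorProduct.tmul_add, map_add, ht, ht']
    | tmul p q => simp [mulL₁_assoc, T₂_T₃, lTensor_mulL₁_assoc]
  have h := LinearMap.congr_fun H.E₂_T₂ (x ⊗ₜ (a ⊗ₜ c))
  simp only [LinearMap.comp_apply, LinearMap.lTensor_tmul, leg12_tmul] at h
  rw [LinearMap.comp_apply, leg12_tmul, h1, T₂_T₃, h2, h, LinearMap.comp_apply, h3, h4]

/-- The opposite regular weak multiplier bialgebra. -/
def op : RegularWeakMultiplierBialgebra k (Op A) where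
  mul_surjective := by
    have h : LinearMap.mul' k A ∘ₗ (TensorProduct.comm k A A).toLinearMap =
        (LinearMap.mul' k (Op A) : A ⊗[k] A →ₗ[k] A) := TensorProduct.ext' fun _ _ => rfl
    have h' : Function.Surjective
        (LinearMap.mul' k A ∘ₗ (TensorProduct.comm k A A).toLinearMap) :=
      H.mul_surjective.comp (TensorProduct.comm k A A).surjective
    rw [h] at h'
    exact h'
  right_nondeg := H.left_nondeg
  left_nondeg := H.right_nondeg
  -- Reversing products exchanges `E₁` with `E₂`, `T₁` with `T₃` and `T₂` with `T₄`; the counit is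
  -- unchanged.
  E₁ := H.E₂
  E₂ := H.E₁
  T₁ := H.T₃
  T₂ := H.T₄
  counit := H.counit
  E_multiplier := fun (a b c d : A) =>
    (tmul_mul_op a b (H.E₂ (c ⊗ₜ d))).trans ((H.E_mul _ _).symm.trans
      (mul_tmul_op c d (H.E₁ (a ⊗ₜ b))).symm)
  E_idem := LinearMap.ext H.E₂_E₂
  coassoc := H.T₄_T₃
  counit_T₁ := TensorProduct.ext' fun (a b : A) => H.counit_T₃ a b
  counit_T₂ := TensorProduct.ext' fun (a b : A) => H.counit_T₄ b a
  T₁_mul := by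
    refine TensorProduct.ext_threefold' fun (a b c : A) => ?_
    let T : Op A ⊗[k] Op A →ₗ[k] Op A ⊗[k] Op A := H.T₃
    let L : A ⊗[k] A →ₗ[k] A ⊗[k] A := firstLegMul T (show Op A from a)
    have hL : ∀ p q : A, L (p ⊗ₜ q) = mulL₁ A p (H.T₃ (a ⊗ₜ q)) := fun p q =>
      firstLegMul_tmul T (show Op A from a) (show Op A from p) (show Op A from q)
    -- `L` is right multiplication by `Δ(a)`. Multiplied by `1 ⊗ y` it becomes a product with the
    -- element `T₁(a ⊗ y)` of `A ⊗ A`, where associativity and `comul_T₁` are available.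
    have h : ∀ (y : A) (t : A ⊗[k] A), mulR₂ A y (L t) = t * H.T₁ (a ⊗ₜ y) := by
      intro y t
      induction t with
      | zero => simp
      | add t t' ht ht' => simp only [map_add, add_mul, ht, ht']
      | tmul p q => rw [hL, ← mulL₁_mulR₂, ← H.T₁_T₃, mulL₂_tmul_mul]
    change L (H.T₃ (b ⊗ₜ c)) = H.T₃ ((b * a) ⊗ₜ c)
    refine cancel_mulR₂ H.right_nondeg fun y => ?_
    rw [h, T₃_mul_eq, comul_T₁, H.T₁_T₃]
  span_T₁ := by
    refine Eq.trans (congrArg (Submodule.span k) ?_) H.span_T₂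
    ext x
    exact ⟨fun ⟨a, b, c, h⟩ => ⟨a, b, c, h.trans (H.T₂_T₃ b a c)⟩,
      fun ⟨a, b, c, h⟩ => ⟨a, b, c, h.trans (H.T₂_T₃ b a c).symm⟩⟩
  span_T₂ := by
    refine Eq.trans (congrArg (Submodule.span k) ?_) H.span_T₁
    ext x
    exact ⟨fun ⟨a, b, c, h⟩ => ⟨a, b, c, h.trans (H.T₁_T₄ b c a).symm⟩,
      fun ⟨a, b, c, h⟩ => ⟨a, b, c, h.trans (H.T₁_T₄ b c a)⟩⟩
  E₂_T₂ := TensorProduct.ext_threefold' fun a b c => H.E₁_T₄ a b c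
  E₁_T₁ := H.E₂_T₃
  counit_E₁ := fun (a b c : A) =>
    (H.counit_E₂ b c a).trans (congrArg (sliceLeft A H.counit) (H.T₂_T₃ b a c)).symm
  counit_E₂ := fun (a b c : A) =>
    (H.counit_E₁ c a b).trans (congrArg (sliceLeft A H.counit) (H.T₁_T₄ a b c))
  T₃ := H.T₁
  T₄ := H.T₂
  T₁_T₃ := fun (a b c : A) => (H.T₁_T₃ b a c).symm
  T₂_T₄ := fun (a b c : A) => (H.T₂_T₄ b a c).symm

end RegularWeakMultiplierBialgebra
end WeakMultiplier
end

/-! ### The idempotent `E` in terms of `Δ`, and the slices of the iterated coaction. -/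

noncomputable section

namespace WeakMultiplier

namespace RegularWeakMultiplierBialgebra

variable {k : Type*} [Field k] {A : Type*} [NonUnitalRing A] [Module k A]
  [IsScalarTower k A A] [SMulCommClass k A A] (H : RegularWeakMultiplierBialgebra k A)

/-- The axiom `span_T₁`, read as: the image of `E` is spanned by the elements `Δ(p) t`. It reduces
statements that only depend on `E w` to multiples of `Δ(p)`, where coassociativity applies. -/
theorem exists_comul (w : A ⊗[k] A) :
    ∃ s : A ⊗[k] (A ⊗[k] A), H.E₁ w = TensorProduct.lift H.comul s := by
  have h1 : H.E₁ w ∈ Submodule.span k {x | ∃ b c : A, x = H.E₁ (b ⊗ₜ[k] c)} := by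
    induction w with
    | zero => simp
    | add x y hx hy => rw [map_add]; exact add_mem hx hy
    | tmul b c => exact Submodule.subset_span ⟨b, c, rfl⟩
  rw [← H.span_T₁] at h1
  have h2 : Submodule.span k {x | ∃ a b c : A, x = mulR₁ A b (H.T₁ (a ⊗ₜ[k] c))} ≤
      LinearMap.range (TensorProduct.lift H.comul) := by
    rw [Submodule.span_le]
    rintro _ ⟨a, b, c, rfl⟩
    exact ⟨a ⊗ₜ (b ⊗ₜ c), by simp [comul_tmul]⟩
  obtain ⟨s, hs⟩ := h2 h1
  exact ⟨s, hs.symm⟩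

/-- The other inclusion in `span_T₁`: `Δ(y) t` lies in the image of `E`, and `E` is idempotent. -/
theorem E₁_comul (y : A) (t : A ⊗[k] A) : H.E₁ (H.comul y t) = H.comul y t := by
  induction t with
  | zero => simp
  | add t t' ht ht' => simp only [map_add, ht, ht']
  | tmul b c =>
    have h : H.comul y (b ⊗ₜ c) ∈
        Submodule.span k {x | ∃ a b c : A, x = mulR₁ A b (H.T₁ (a ⊗ₜ[k] c))} :=
      Submodule.subset_span ⟨y, b, c, H.comul_tmul y b c⟩
    rw [H.span_T₁] at h
    have h2 : Submodule.span k {x | ∃ b c : A, x = H.E₁ (b ⊗ₜ[k] c)} ≤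
        LinearMap.ker (H.E₁ - LinearMap.id) := by
      rw [Submodule.span_le]
      rintro _ ⟨b, c, rfl⟩
      simp [E₁_E₁]
    have h3 := h2 h
    rwa [LinearMap.mem_ker, LinearMap.sub_apply, sub_eq_zero] at h3

theorem E₂_mulL₂_T₂ (b c y : A) :
    H.E₂ (mulL₂ A c (H.T₂ (b ⊗ₜ y))) = mulL₂ A c (H.T₂ (b ⊗ₜ y)) := by
  have h : mulL₂ A c (H.T₂ (b ⊗ₜ y)) ∈
      Submodule.span k {x | ∃ a b c : A, x = mulL₂ A c (H.T₂ (b ⊗ₜ[k] a))} :=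
    Submodule.subset_span ⟨y, b, c, rfl⟩
  rw [H.span_T₂] at h
  have h2 : Submodule.span k {x | ∃ b c : A, x = H.E₂ (b ⊗ₜ[k] c)} ≤
      LinearMap.ker (H.E₂ - LinearMap.id) := by
    rw [Submodule.span_le]
    rintro _ ⟨b, c, rfl⟩
    simp [E₂_E₂]
  have h3 := h2 h
  rwa [LinearMap.mem_ker, LinearMap.sub_apply, sub_eq_zero] at h3

theorem E₁_T₁_apply (x : A ⊗[k] A) : H.E₁ (H.T₁ x) = H.T₁ x := by
  induction x with
  | zero => simp
  | add x y hx hy => simp only [map_add, hx, hy]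
  | tmul a b =>
    refine cancel_mulR₁ H.right_nondeg fun c => ?_
    rw [← E₁_mulR₁, ← comul_tmul, E₁_comul]

theorem E₁_T₄_apply (x : A ⊗[k] A) : H.E₁ (H.T₄ x) = H.T₄ x := by
  induction x with
  | zero => simp
  | add x y hx hy => simp only [map_add, hx, hy]
  | tmul a b =>
    refine cancel_mulR₂ H.right_nondeg fun c => ?_
    rw [← E₁_mulR₂, ← T₁_T₄, ← comul_tmul, E₁_comul]

/-- The mirror image of `E₁_comul`: by `span_T₂`, the rows `(b ⊗ c) Δ(y)` are fixed by right
multiplication with `E`. -/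
theorem comul_E₁ (y : A) (t : A ⊗[k] A) : H.comul y (H.E₁ t) = H.comul y t :=
  cancel_mulL₂ H.left_nondeg fun c => cancel_mulL₁ H.left_nondeg fun b => by
    rw [mulL₂_tmul_mul, mulL₂_tmul_mul, comul_multiplier, comul_multiplier, H.E_mul,
      E₂_mulL₂_T₂]

/-- The elements `E x` are detected by the comultiplication. -/
theorem E₁_eq_of_comul {u w : A ⊗[k] A} (h : ∀ p, H.comul p u = H.comul p w) :
    H.E₁ u = H.E₁ w := by
  refine cancel_mulL₂ H.left_nondeg fun c => cancel_mulL₁ H.left_nondeg fun b => ?_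
  rw [mulL₂_tmul_mul, mulL₂_tmul_mul, H.E_mul, H.E_mul]
  -- By `span_T₂` the row `(b ⊗ c) E` is a sum of rows `(b' ⊗ c') Δ(p)`, and by hypothesis these do
  -- not distinguish `u` from `w`.
  have h1 : H.E₂ (b ⊗ₜ c) ∈
      Submodule.span k {x | ∃ a b c : A, x = mulL₂ A c (H.T₂ (b ⊗ₜ[k] a))} := by
    rw [H.span_T₂]
    exact Submodule.subset_span ⟨b, c, rfl⟩
  have h2 : Submodule.span k {x | ∃ a b c : A, x = mulL₂ A c (H.T₂ (b ⊗ₜ[k] a))} ≤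
      LinearMap.ker (LinearMap.mulRight k (u - w)) := by
    rw [Submodule.span_le]
    rintro _ ⟨a, b, c, rfl⟩
    simp [mul_sub, ← comul_multiplier, h]
  have h3 := h2 h1
  rwa [LinearMap.mem_ker, LinearMap.mulRight_apply, mul_sub, sub_eq_zero] at h3

/-- `⊓ᴸ(a) b = (ε ⊗ A) E₁(a ⊗ b)`. -/
def piLAct (a b : A) : A := sliceLeft A H.counit (H.E₁ (a ⊗ₜ b))

/-- `⊓̄ᴿ(a) b = (A ⊗ ε) E₁(b ⊗ a)`. -/
def piBarRAct (a b : A) : A := sliceRight A H.counit (H.E₁ (b ⊗ₜ a))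

/-- The axiom `counit_E₁`. This and `sliceRight_comul` are the two instances of the hypothesis of
`RightComod.lTensor_lam₂`. -/
theorem sliceLeft_comul (y : A) (t : A ⊗[k] A) :
    sliceLeft A H.counit (H.comul y t) = y * sliceLeft A H.counit (H.E₁ t) := by
  induction t with
  | zero => simp
  | add t t' ht ht' => simp only [map_add, ht, ht', mul_add]
  | tmul b c => rw [comul_tmul, ← H.counit_E₁, sliceLeft_mulL₂]

/-- The compatibility of the left and right multiplications of `⊓̄ᴿ(c)`, for `t = b ⊗ c`. -/
theorem sliceRight_comul (y : A) (t : A ⊗[k] A) :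
    sliceRight A H.counit (H.comul y t) = y * sliceRight A H.counit (H.E₁ t) := by
  induction t with
  | zero => simp
  | add t t' ht ht' => simp only [map_add, ht, ht', mul_add]
  | tmul b c => rw [comul_tmul, sliceRight_mulR₁, H.piBarR_multiplier]

end RegularWeakMultiplierBialgebra

namespace RightComod

variable {k : Type*} [Field k] {A : Type*} [NonUnitalRing A] [Module k A]
  [IsScalarTower k A A] [SMulCommClass k A A] {H : RegularWeakMultiplierBialgebra k A}
  {V : Type*} [AddCommGroup V] [Module k V] (c : RightComod H V)

/-- Forced by the existence of `ρ`: after multiplication by `1 ⊗ x` the element `λ(v ⊗ a)` turns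
into `ρ(v ⊗ x)(1 ⊗ a)`, in which `a` appears as a mere right factor. -/
theorem lam_mulR₂ (v : V) (a b : A) : c.lam (v ⊗ₜ (a * b)) = mulR₂ V b (c.lam (v ⊗ₜ a)) :=
  cancel_mulL₂ H.left_nondeg fun x => by
    rw [c.compat, mulL₂_mulR₂, c.compat, mulR₂_mulR₂]

/-- The map `v ↦ λ(v ⊗ a)`. -/
def lamAt (a : A) : V →ₗ[k] V ⊗[k] A := c.lam ∘ₗ tmulRight V a

theorem lamAt_apply (a : A) (v : V) : c.lamAt a v = c.lam (v ⊗ₜ a) := rfl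

/-- The map `(λ ⊗ A) λ¹³`. -/
def lam₂ : V ⊗[k] (A ⊗[k] A) →ₗ[k] V ⊗[k] (A ⊗[k] A) := leg12 c.lam A ∘ₗ leg13 c.lam A

theorem lam₂_tmul (v : V) (a b : A) : c.lam₂ (v ⊗ₜ (a ⊗ₜ b)) =
    TensorProduct.assoc k V A A ((c.lamAt a).rTensor A (c.lam (v ⊗ₜ b))) :=
  leg12_leg13_tmul c.lam v a b

theorem lam₂_E₁ (v : V) (w : A ⊗[k] A) : c.lam₂ (v ⊗ₜ H.E₁ w) = c.lam₂ (v ⊗ₜ w) :=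
  LinearMap.congr_fun c.norm (v ⊗ₜ w)

theorem lam₂_mulR₁ (v : V) (q : A) (w : A ⊗[k] A) :
    c.lam₂ (v ⊗ₜ mulR₁ A q w) = (mulR₁ A q).lTensor V (c.lam₂ (v ⊗ₜ w)) := by
  induction w with
  | zero => simp
  | add x y hx hy => simp only [map_add, TensorProduct.tmul_add, hx, hy]
  | tmul a b =>
    rw [mulR₁_tmul, lam₂_tmul, lam₂_tmul]
    generalize c.lam (v ⊗ₜ b) = t
    induction t with
    | zero => simp
    | add x y hx hy => simp only [map_add, hx, hy]
    | tmul w y => simp [lamAt_apply, lam_mulR₂, lTensor_mulR₁_assoc]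

/-- Both sides are `v₀ ⊗ Δ(v₁ p) t`. This is coassociativity with `T₁(p ⊗ d)` replaced by `Δ(p)(q ⊗
d)`, which `lam₂_mulR₁` permits. -/
theorem lam₂_comul (v : V) (p : A) (t : A ⊗[k] A) :
    c.lam₂ (v ⊗ₜ H.comul p t) = (H.comul.flip t).lTensor V (c.lam (v ⊗ₜ p)) := by
  induction t with
  | zero => simp
  | add x y hx hy => simp only [map_add, TensorProduct.tmul_add, hx, hy, LinearMap.lTensor_add,
      LinearMap.add_apply]
  | tmul q d =>
    rw [H.comul_tmul, lam₂_mulR₁]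
    have h := LinearMap.congr_fun c.coassoc (v ⊗ₜ (p ⊗ₜ d))
    simp only [LinearMap.comp_apply, LinearMap.lTensor_tmul, leg12_tmul] at h
    rw [lam₂, LinearMap.comp_apply, h]
    generalize c.lam (v ⊗ₜ p) = t
    induction t with
    | zero => simp
    | add x y hx hy => simp only [map_add, TensorProduct.add_tmul, hx, hy]
    | tmul w y => simp [H.comul_tmul]

/-- By `norm` one may replace `w` by `E w`, hence by `Δ(p) t`. Then the iterated coaction is `v₀ ⊗
Δ(v₁ p) t`, and `F` turns it into `v₀ ⊗ v₁ p F(E t)`, which is `λ` of `v ⊗ F(Δ(p) t)`. -/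
theorem lTensor_lam₂ (F : A ⊗[k] A →ₗ[k] A) (hF : ∀ y t, F (H.comul y t) = y * F (H.E₁ t))
    (v : V) (w : A ⊗[k] A) : F.lTensor V (c.lam₂ (v ⊗ₜ w)) = c.lam (v ⊗ₜ F (H.E₁ w)) := by
  obtain ⟨s, hs⟩ := H.exists_comul w
  rw [← lam₂_E₁, hs]
  clear hs
  induction s with
  | zero => simp
  | add x y hx hy => simp only [map_add, TensorProduct.tmul_add, hx, hy]
  | tmul p t =>
    rw [TensorProduct.lift.tmul, lam₂_comul, hF, lam_mulR₂]
    generalize c.lam (v ⊗ₜ p) = t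
    induction t with
    | zero => simp
    | add x y hx hy => simp only [map_add, hx, hy]
    | tmul w y => simp [hF]

/-- After the same reduction, the last two legs have the form `Δ(y) t`, which `E` fixes. -/
theorem lTensor_E₁_lam₂ (v : V) (w : A ⊗[k] A) :
    H.E₁.lTensor V (c.lam₂ (v ⊗ₜ w)) = c.lam₂ (v ⊗ₜ w) := by
  obtain ⟨s, hs⟩ := H.exists_comul w
  rw [← lam₂_E₁ c v w, hs]
  clear hs
  induction s with
  | zero => simp
  | add x y hx hy => simp only [map_add, TensorProduct.tmul_add, hx, hy]
  | tmul p t =>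
    rw [TensorProduct.lift.tmul, lam₂_comul]
    generalize c.lam (v ⊗ₜ p) = t
    induction t with
    | zero => simp
    | add x y hx hy => simp only [map_add, hx, hy]
    | tmul w y => simp [H.E₁_comul]

/-- The operator `v ↦ (V ⊗ ε) λ(v ⊗ a)`. -/
def rightAct : A →ₗ[k] V →ₗ[k] V :=
  ((TensorProduct.mk k V A).compr₂ (sliceRight V H.counit ∘ₗ c.lam)).flip

theorem rightAct_apply (a : A) (v : V) : c.rightAct a v = sliceRight V H.counit (c.lam (v ⊗ₜ a)) := rfl

/-- `(v₀ ◁ a) ⊗ v₁ b = v₀ ⊗ v₁ ⊓ᴸ(a) b`. -/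
theorem rTensor_rightAct_lam (a b : A) (v : V) :
    (c.rightAct a).rTensor A (c.lam (v ⊗ₜ b)) = c.lam (v ⊗ₜ H.piLAct a b) := by
  rw [RegularWeakMultiplierBialgebra.piLAct,
    ← c.lTensor_lam₂ (sliceLeft A H.counit) H.sliceLeft_comul, lam₂_tmul]
  generalize c.lam (v ⊗ₜ b) = t
  induction t with
  | zero => simp
  | add x y hx hy => simp only [map_add, hx, hy]
  | tmul w y =>
    simp only [LinearMap.rTensor_tmul, rightAct_apply, lamAt_apply]
    generalize c.lam (w ⊗ₜ a) = t
    induction t with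
    | zero => simp
    | add x y hx hy => simp only [map_add, TensorProduct.add_tmul, hx, hy]
    | tmul p q => simp [TensorProduct.smul_tmul]

/-- `λ((v ◁ a) ⊗ b) = λ(v ⊗ ⊓̄ᴿ(a) b)`. -/
theorem lam_rightAct (a b : A) (v : V) :
    c.lam (c.rightAct a v ⊗ₜ b) = c.lam (v ⊗ₜ H.piBarRAct a b) := by
  rw [RegularWeakMultiplierBialgebra.piBarRAct,
    ← c.lTensor_lam₂ (sliceRight A H.counit) H.sliceRight_comul, lam₂_tmul, rightAct_apply]
  generalize c.lam (v ⊗ₜ a) = t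
  induction t with
  | zero => simp
  | add x y hx hy => simp only [map_add, TensorProduct.add_tmul, hx, hy]
  | tmul w y =>
    simp only [LinearMap.rTensor_tmul, lamAt_apply, sliceRight_tmul]
    rw [← TensorProduct.smul_tmul', map_smul]
    generalize c.lam (w ⊗ₜ b) = t
    induction t with
    | zero => simp
    | add x y hx hy => simp only [map_add, TensorProduct.add_tmul, smul_add, hx, hy]
    | tmul p q => simp

theorem rightAct_rightAct (a b : A) (v : V) : c.rightAct b (c.rightAct a v) = c.rightAct (H.piBarRAct a b) v := by
  rw [rightAct_apply, lam_rightAct, rightAct_apply]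

end RightComod

end WeakMultiplier
end

/-! ### The regular comodule, and comodules over the opposite. -/

noncomputable section

namespace WeakMultiplier

namespace RegularWeakMultiplierBialgebra

variable {k : Type*} [Field k] {A : Type*} [NonUnitalRing A] [Module k A]
  [IsScalarTower k A A] [SMulCommClass k A A] (H : RegularWeakMultiplierBialgebra k A)

theorem comul_comul (a b : A) (t : A ⊗[k] A) :
    H.comul a (H.comul b t) = H.comul (a * b) t := by
  induction t with
  | zero => simp
  | add x y hx hy => simp only [map_add, hx, hy]
  | tmul q c => rw [comul_tmul, comul_mulR₁, comul_T₁, comul_tmul]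

/-- With a factor `x` on the first leg, the iterated coaction of `A` on itself becomes `x a₁ ⊗ Δ(a₂)
w`. In this form the comodule axioms for `A` reduce to `Δ(y) E = Δ(y)` and to the multiplicativity
of `Δ`. -/
theorem mulL₁_T₁_T₁ (x a : A) (w : A ⊗[k] A) :
    mulL₁ (k := k) (A ⊗[k] A) x (leg12 H.T₁ A (leg13 H.T₁ A (a ⊗ₜ w))) =
      (H.comul.flip w).lTensor A (H.T₂ (x ⊗ₜ a)) := by
  induction w with
  | zero => simp
  | add w w' hw hw' => simp only [TensorProduct.tmul_add, map_add, hw, hw', LinearMap.lTensor_add,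
      LinearMap.add_apply]
  | tmul b c =>
    have h1 : ∀ t : A ⊗[k] A, mulL₁ (k := k) (A ⊗[k] A) x
        (TensorProduct.assoc k A A A ((H.T₁ ∘ₗ tmulRight A b).rTensor A t)) =
          (mulR₁ A b).lTensor A (leg12 H.T₂ A (x ⊗ₜ t)) := by
      intro t
      induction t with
      | zero => simp
      | add t t' ht ht' => simp only [TensorProduct.tmul_add, map_add, ht, ht']
      | tmul p q => simp [mulL₁_assoc, H.T₁_T₂, lTensor_mulR₁_assoc]
    have h := LinearMap.congr_fun H.coassoc (x ⊗ₜ (a ⊗ₜ c))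
    simp only [LinearMap.comp_apply, LinearMap.lTensor_tmul, leg12_tmul] at h
    rw [leg12_leg13_tmul, h1, h]
    generalize H.T₂ (x ⊗ₜ a) = t
    induction t with
    | zero => simp
    | add t t' ht ht' => simp only [TensorProduct.add_tmul, map_add, ht, ht']
    | tmul p q => simp [comul_tmul]

/-- `A` as a right comodule over itself. -/
def regularComod : RightComod H A where
  lam := H.T₁
  rho := H.T₃
  compat v a b := H.T₁_T₃ a b v
  norm := by
    refine TensorProduct.ext' fun a w => cancel_mulL₁ H.left_nondeg fun x => ?_
    rw [LinearMap.comp_apply, LinearMap.comp_apply, LinearMap.lTensor_tmul, mulL₁_T₁_T₁,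
      LinearMap.comp_apply, mulL₁_T₁_T₁]
    congr 2
    ext1 y
    exact H.comul_E₁ y w
  coassoc := by
    refine TensorProduct.ext_threefold' fun a b c => cancel_mulL₁ H.left_nondeg fun x => ?_
    rw [LinearMap.comp_apply, LinearMap.comp_apply, LinearMap.lTensor_tmul, mulL₁_T₁_T₁,
      LinearMap.comp_apply, leg12_tmul, ← lTensor_mulL₁, mulL₁_assoc, H.T₁_T₂]
    generalize H.T₂ (x ⊗ₜ a) = t
    induction t with
    | zero => simp
    | add t t' ht ht' => simp only [TensorProduct.add_tmul, map_add, ht, ht']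
    | tmul p q => simp [comul_T₁]

end RegularWeakMultiplierBialgebra

namespace RightComod

variable {k : Type*} [Field k] {A : Type*} [NonUnitalRing A] [Module k A]
  [IsScalarTower k A A] [SMulCommClass k A A] {H : RegularWeakMultiplierBialgebra k A}
  {V : Type*} [AddCommGroup V] [Module k V] (c : RightComod H V)

theorem cancel_mulRight {x y : V ⊗[k] (A ⊗[k] A)}
    (h : ∀ s : A ⊗[k] A, (LinearMap.mulRight k s).lTensor V x =
      (LinearMap.mulRight k s).lTensor V y) (h0 : ∀ a : A, (∀ b : A, a * b = 0) → a = 0) :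
    x = y := by
  rw [← sub_eq_zero]
  refine lTensor_joint (fun s : A ⊗[k] A => LinearMap.mulRight k s) (fun w hw => ?_) _ fun s => ?_
  · exact tensor_right_nondeg h0 fun s => by simpa using hw s
  · rw [map_sub, sub_eq_zero]
    exact h s

/-- The condition `compat`, used once for each of the two legs in `A`. It transfers the properties
of the iterated `λ` to the iterated `ρ`. -/
theorem mulRight_rho₂ (v : V) (s t : A ⊗[k] A) :
    (LinearMap.mulRight k s).lTensor V (leg12 c.rho A (leg13 c.rho A (v ⊗ₜ t))) =
      (LinearMap.mulLeft k t).lTensor V (c.lam₂ (v ⊗ₜ s)) := by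
  induction t with
  | zero => simp
  | add x y hx hy =>
    have h : LinearMap.mulLeft k (x + y) = LinearMap.mulLeft k x + LinearMap.mulLeft k y :=
      LinearMap.ext fun z => by simp [add_mul]
    simp only [map_add, TensorProduct.tmul_add, hx, hy, h, LinearMap.lTensor_add,
      LinearMap.add_apply]
  | tmul x y =>
    induction s with
    | zero => simp
    | add s s' hs hs' =>
      have h : LinearMap.mulRight k (s + s') =
          LinearMap.mulRight k s + LinearMap.mulRight k s' :=
        LinearMap.ext fun z => by simp [mul_add]
      simp only [map_add, TensorProduct.tmul_add, hs, hs', h, LinearMap.lTensor_add,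
        LinearMap.add_apply]
    | tmul a b =>
      have h1 : ∀ (u : V ⊗[k] A) (q : A), (LinearMap.mulRight k (a ⊗ₜ[k] b)).lTensor V
          (TensorProduct.assoc k V A A (u ⊗ₜ q)) =
            TensorProduct.assoc k V A A (mulR₂ V a u ⊗ₜ (q * b)) := by
        intro u q
        induction u with
        | zero => simp
        | add x y hx hy => simp only [map_add, TensorProduct.add_tmul, hx, hy]
        | tmul w z => simp
      have h2 : ∀ (u : V ⊗[k] A) (q : A), (LinearMap.mulLeft k (x ⊗ₜ[k] y)).lTensor V
          (TensorProduct.assoc k V A A (u ⊗ₜ q)) =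
            TensorProduct.assoc k V A A (mulL₂ V x u ⊗ₜ (y * q)) := by
        intro u q
        induction u with
        | zero => simp
        | add x y hx hy => simp only [map_add, TensorProduct.add_tmul, hx, hy]
        | tmul w z => simp
      have h3 : ∀ u : V ⊗[k] A, (LinearMap.mulRight k (a ⊗ₜ[k] b)).lTensor V
          (TensorProduct.assoc k V A A ((c.rho ∘ₗ tmulRight V x).rTensor A u)) =
            TensorProduct.assoc k V A A ((mulL₂ V x ∘ₗ c.lamAt a).rTensor A (mulR₂ V b u)) := by
        intro u
        induction u with
        | zero => simp
        | add x y hx hy => simp only [map_add, hx, hy]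
        | tmul w z => simp [h1, ← c.compat, lamAt_apply]
      rw [leg12_leg13_tmul, h3, ← c.compat, lam₂_tmul]
      generalize c.lam (v ⊗ₜ b) = u
      induction u with
      | zero => simp
      | add x y hx hy => simp only [map_add, hx, hy]
      | tmul w z => simp [h2]

/-- Neither side changes when `s` is replaced by `E s`, on the left by `norm` and on the right by
`Δ(y) E = Δ(y)`. For `s = Δ(p) t` both sides are `v₀ ⊗ Δ(a v₁ p) t`, the factor `v₁` being read off
`λ(v ⊗ p)` on the left and off `ρ(v ⊗ a)` on the right. -/
theorem comul_lam₂ (v : V) (a : A) (s : A ⊗[k] A) :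
    (H.comul a).lTensor V (c.lam₂ (v ⊗ₜ s)) = (H.comul.flip s).lTensor V (c.rho (v ⊗ₜ a)) := by
  have h0 : H.comul.flip s = H.comul.flip (H.E₁ s) := by
    ext1 y
    exact (H.comul_E₁ y s).symm
  obtain ⟨s', hs⟩ := H.exists_comul s
  rw [← lam₂_E₁, h0, hs]
  clear hs
  induction s' with
  | zero => simp
  | add x y hx hy => simp only [map_add, TensorProduct.tmul_add, hx, hy, LinearMap.lTensor_add,
      LinearMap.add_apply]
  | tmul p t =>
    have h1 : ∀ u : V ⊗[k] A, (H.comul a).lTensor V ((H.comul.flip t).lTensor V u) =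
        (H.comul.flip t).lTensor V (mulL₂ V a u) := by
      intro u
      induction u with
      | zero => simp
      | add x y hx hy => simp only [map_add, hx, hy]
      | tmul w z => simp [H.comul_comul]
    rw [TensorProduct.lift.tmul, lam₂_comul, h1, c.compat]
    generalize c.rho (v ⊗ₜ a) = u
    induction u with
    | zero => simp
    | add x y hx hy => simp only [map_add, hx, hy]
    | tmul w z => simp [H.comul_comul]

/-- Tested against `s`, an `E` to the right of `t` acts from the left on the iterated `λ`, and there
it is absorbed by `lTensor_E₁_lam₂`. -/
theorem rho_norm : leg12 c.rho A ∘ₗ leg13 c.rho A ∘ₗ H.E₂.lTensor V =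
    leg12 c.rho A ∘ₗ leg13 c.rho A := by
  refine TensorProduct.ext' fun v t => cancel_mulRight (fun s => ?_) H.right_nondeg
  refine (c.mulRight_rho₂ v s (H.E₂ t)).trans (Eq.trans ?_ (c.mulRight_rho₂ v s t).symm)
  rw [← c.lTensor_E₁_lam₂]
  generalize c.lam₂ (v ⊗ₜ s) = u
  induction u with
  | zero => simp
  | add x y hx hy => simp only [map_add, hx, hy]
  | tmul w z => simp [← H.E_mul, H.E₁_E₁]

/-- Tested against `s`, the element `T₃(a ⊗ b)` acts on the iterated `λ` as `(1 ⊗ b) Δ(a)`, and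
`comul_lam₂` evaluates this. -/
theorem rho_coassoc : leg12 c.rho A ∘ₗ leg13 c.rho A ∘ₗ H.T₃.lTensor V =
    H.T₃.lTensor V ∘ₗ leg12 c.rho A := by
  refine TensorProduct.ext_threefold' fun v a b => cancel_mulRight (fun s => ?_) H.right_nondeg
  refine (c.mulRight_rho₂ v s (H.T₃ (a ⊗ₜ b))).trans ?_
  have h1 : (LinearMap.mulLeft k (H.T₃ (a ⊗ₜ b))).lTensor V (c.lam₂ (v ⊗ₜ s)) =
      (mulL₂ A b).lTensor V ((H.comul a).lTensor V (c.lam₂ (v ⊗ₜ s))) := by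
    generalize c.lam₂ (v ⊗ₜ s) = u
    induction u with
    | zero => simp
    | add x y hx hy => simp only [map_add, hx, hy]
    | tmul w z => simp [H.T₃_mul_eq]
  rw [h1, comul_lam₂]
  change _ = (LinearMap.mulRight k s).lTensor V (H.T₃.lTensor V
    (TensorProduct.assoc k V A A (c.rho (v ⊗ₜ a) ⊗ₜ b)))
  generalize c.rho (v ⊗ₜ a) = u
  induction u with
  | zero => simp
  | add x y hx hy => simp only [map_add, TensorProduct.add_tmul, hx, hy]
  | tmul w z => simp [H.T₃_mul_eq]

/-- A comodule as a comodule over the opposite. -/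
def op : RightComod H.op V where
  lam := c.rho
  rho := c.lam
  compat := fun v (a b : A) => (c.compat v b a).symm
  norm := c.rho_norm
  coassoc := c.rho_coassoc

end RightComod

end WeakMultiplier
end

/-! ### Fullness as a separation property, and the formula for `E (b ⊗ p q)`. -/

noncomputable section

namespace WeakMultiplier

section

variable {k : Type*} [Field k] {A : Type*} [NonUnitalRing A] [Module k A]
  [IsScalarTower k A A] [SMulCommClass k A A]

theorem lact_mul (m : Multiplier k A) (a b : A)
    (h : ∀ a : A, (∀ b : A, b * a = 0) → a = 0) : lact m (a * b) = lact m a * b := by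
  rw [← sub_eq_zero]
  apply h
  intro x
  rw [mul_sub, mul_lact, ← mul_assoc, ← mul_assoc, mul_lact, sub_self]

theorem multiplier_ext_lact (h : ∀ a : A, (∀ b : A, b * a = 0) → a = 0)
    (h' : ∀ a : A, (∀ b : A, a * b = 0) → a = 0) {m n : Multiplier k A}
    (hm : ∀ a, lact m a = lact n a) : m = n := by
  refine multiplier_ext h fun a => ?_
  rw [← sub_eq_zero]
  apply h'
  intro b
  rw [sub_mul, ← mul_lact, ← mul_lact, hm, sub_self]

theorem rTensor_slices {V P : Type*} [AddCommGroup V] [Module k V] [AddCommGroup P] [Module k P]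
    {x y : P ⊗[k] A} (h : ∀ ω : A →ₗ[k] k, sliceRight P ω x = sliceRight P ω y) : x = y := by
  rw [← sub_eq_zero]
  refine lTensor_joint (fun ω : A →ₗ[k] k => ω) (fun a ha => ?_) _ fun ω => ?_
  · exact (Module.forall_dual_apply_eq_zero_iff k a).1 ha
  · apply (TensorProduct.rid k P).injective
    rw [map_zero, map_sub, map_sub, sub_eq_zero]
    exact h ω

end

namespace RightComod

variable {k : Type*} [Field k] {A : Type*} [NonUnitalRing A] [Module k A]
  [IsScalarTower k A A] [SMulCommClass k A A] {H : RegularWeakMultiplierBialgebra k A}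
  {V : Type*} [AddCommGroup V] [Module k V] {c : RightComod H V}

/-- Slicing the second leg commutes with `f`, and the slices of `λ` span `V`. In this form fullness
is applied to maps out of `V`, notably to quotient maps. -/
theorem IsFull.hom_ext (hc : c.IsFull) {P : Type*} [AddCommGroup P] [Module k P]
    {f g : V →ₗ[k] P} (h : ∀ v a, f.rTensor A (c.lam (v ⊗ₜ a)) = g.rTensor A (c.lam (v ⊗ₜ a))) :
    f = g := by
  refine LinearMap.ext_on_range (v := fun x : {x : V | ∃ (v : V) (a : A) (ω : A →ₗ[k] k),
    x = sliceRight V ω (c.lam (v ⊗ₜ[k] a))} => x.1) (by rw [Subtype.range_coe]; exact hc) ?_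
  rintro ⟨_, v, a, ω, rfl⟩
  simp only [map_sliceRight, h]

theorem IsFull.eq_top (hc : c.IsFull) {X : Submodule k V}
    (h : ∀ v a, X.mkQ.rTensor A (c.lam (v ⊗ₜ a)) = 0) : X = ⊤ := by
  have h1 : X.mkQ = 0 := hc.hom_ext fun v a => by simp [h]
  rw [← Submodule.ker_mkQ X, h1, LinearMap.ker_zero]

/-- Take for `X` the span of the slices: modulo `X` all slices of `λ(v ⊗ a)` vanish, hence `λ(v ⊗
a)` itself does. -/
theorem isFull_of (h : ∀ X : Submodule k V,
    (∀ v a, X.mkQ.rTensor A (c.lam (v ⊗ₜ a)) = 0) → X = ⊤) : c.IsFull := by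
  refine h _ fun v a => rTensor_slices (V := V) fun ω => ?_
  rw [← map_sliceRight, map_zero, Submodule.mkQ_apply, Submodule.Quotient.mk_eq_zero]
  exact Submodule.subset_span ⟨v, a, ω, rfl⟩

/-- `λ` and `ρ` agree after multiplication on opposite sides, and non-degeneracy removes the
factors. Thus `λ` and `ρ` define the same notion of fullness. -/
theorem rTensor_lam_eq_zero_iff {P : Type*} [AddCommGroup P] [Module k P] (f : V →ₗ[k] P) :
    (∀ v a, f.rTensor A (c.lam (v ⊗ₜ a)) = 0) ↔ ∀ v a, f.rTensor A (c.rho (v ⊗ₜ a)) = 0 := by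
  constructor
  · intro h v a
    refine cancel_mulR₂ H.right_nondeg fun b => ?_
    rw [← rTensor_mulR₂, ← c.compat, rTensor_mulL₂, h, map_zero, map_zero]
  · intro h v a
    refine cancel_mulL₂ H.left_nondeg fun b => ?_
    rw [← rTensor_mulL₂, c.compat, rTensor_mulR₂, h, map_zero, map_zero]

theorem IsFull.op (hc : c.IsFull) : c.op.IsFull :=
  isFull_of fun X hX => hc.eq_top ((c.rTensor_lam_eq_zero_iff X.mkQ).2 hX)

end RightComod

namespace RegularWeakMultiplierBialgebra

variable {k : Type*} [Field k] {A : Type*} [NonUnitalRing A] [Module k A]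
  [IsScalarTower k A A] [SMulCommClass k A A] (H : RegularWeakMultiplierBialgebra k A)

/-- The map `a ↦ ⊓̄ᴿ(a) b`. -/
def piBarRMap (b : A) : A →ₗ[k] A := sliceRight A H.counit ∘ₗ H.E₁ ∘ₗ tmulLeft A b

theorem piBarRMap_apply (a b : A) : H.piBarRMap b a = H.piBarRAct a b := rfl

theorem mul_piBarRAct (x a b : A) : x * H.piBarRAct a b = H.regularComod.rightAct a x * b :=
  H.piBarR_multiplier a x b

/-- For `s = a ⊗ c` the left side is `z₁ ⊓̄ᴿ(a) b ⊗ z₂ c`. As `z₁ ⊓̄ᴿ(a)` is the right action on the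
regular comodule, `rTensor_rightAct_lam` moves it to the second leg, giving `z₁ b ⊗ z₂ ⊓ᴸ(a) c`. -/
theorem comul_rTensor_piBarRMap (z b : A) (s : A ⊗[k] A) :
    H.comul z ((H.piBarRMap b).rTensor A s) =
      mulR₁ A b (H.T₁ (z ⊗ₜ sliceLeft A H.counit (H.E₁ s))) := by
  induction s with
  | zero => simp
  | add x y hx hy => simp only [map_add, TensorProduct.tmul_add, hx, hy]
  | tmul a c =>
    have h := H.regularComod.rTensor_rightAct_lam a c z
    change LinearMap.rTensor A _ (H.T₁ _) = H.T₁ _ at h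
    rw [LinearMap.rTensor_tmul, comul_tmul, piBarRMap_apply, ← piLAct, ← h]
    generalize H.T₁ (z ⊗ₜ c) = u
    induction u with
    | zero => simp
    | add x y hx hy => simp only [map_add, hx, hy]
    | tmul p q => simp [mul_piBarRAct]

/-- The purpose of the right side is that `t` occurs only under `T₂ ⊗ A`, through which the axiom
`E₂_T₂` can move `E`. -/
theorem mulL₁_mul_rTensor_piBarRMap (x b : A) (t s : A ⊗[k] A) :
    mulL₁ A x (t * (H.piBarRMap b).rTensor A s) =
      TensorProduct.map (LinearMap.mulRight k b) (sliceLeft A H.counit ∘ₗ LinearMap.mulRight k s)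
        (leg12 H.T₂ A (x ⊗ₜ t)) := by
  induction s with
  | zero => simp
  | add s s' hs hs' =>
    have h : LinearMap.mulRight k (s + s') = LinearMap.mulRight k s + LinearMap.mulRight k s' :=
      LinearMap.ext fun z => by simp [mul_add]
    simp only [map_add, mul_add, hs, hs', h, LinearMap.comp_add, TensorProduct.map_add_right,
      LinearMap.add_apply]
  | tmul p c =>
    induction t with
    | zero => simp
    | add t t' ht ht' => simp only [TensorProduct.tmul_add, map_add, add_mul, ht, ht']
    | tmul y z =>
      have h1 : H.regularComod.rightAct p y = sliceRight A H.counit (H.T₁ (y ⊗ₜ p)) := rfl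
      simp only [LinearMap.rTensor_tmul, Algebra.TensorProduct.tmul_mul_tmul, mulL₁_tmul,
        piBarRMap_apply, mul_piBarRAct, leg12_tmul]
      rw [← mul_assoc, h1, ← sliceRight_mulL₁, H.T₁_T₂]
      generalize H.T₂ (x ⊗ₜ y) = u
      induction u with
      | zero => simp
      | add x y hx hy => simp only [map_add, TensorProduct.add_tmul, add_mul, hx, hy]
      | tmul u v => simp [TensorProduct.smul_tmul', smul_mul_assoc]

/-- `E (b ⊗ p q) = ⊓̄ᴿ(p₁) b ⊗ p₂ q`. -/
theorem E₁_tmul_mul (b p q : A) :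
    H.E₁ (b ⊗ₜ (p * q)) = (H.piBarRMap b).rTensor A (H.T₁ (p ⊗ₜ q)) := by
  -- The right side is fixed by `E`: multiplied by `t`, the `E` passes to the right of `t`, through
  -- `T₂` by `E₂_T₂`, and is finally absorbed by `T₁(p ⊗ q)`.
  have h1 : H.E₁ ((H.piBarRMap b).rTensor A (H.T₁ (p ⊗ₜ q))) =
      (H.piBarRMap b).rTensor A (H.T₁ (p ⊗ₜ q)) := by
    refine tensor_left_nondeg H.left_nondeg fun t => cancel_mulL₁ H.left_nondeg fun x => ?_
    have h := LinearMap.congr_fun H.E₂_T₂ (x ⊗ₜ t)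
    simp only [LinearMap.comp_apply, LinearMap.lTensor_tmul] at h
    rw [H.E_mul, mulL₁_mul_rTensor_piBarRMap, mulL₁_mul_rTensor_piBarRMap, ← h]
    generalize leg12 H.T₂ A (x ⊗ₜ t) = u
    induction u with
    | zero => simp
    | add x y hx hy => simp only [map_add, hx, hy]
    | tmul u v => simp [← H.E_mul, E₁_T₁_apply]
  rw [← h1]
  -- Both sides now have the form `E w`, so it is enough to compare the elements `Δ(z) w`. Both are
  -- `z₁ b ⊗ z₂ p q`, since `(ε ⊗ A) T₁ = μ`.
  refine H.E₁_eq_of_comul fun z => ?_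
  rw [comul_rTensor_piBarRMap, E₁_T₁_apply, H.counit_T₁_apply, comul_tmul]

/-- Apply `A ⊗ A ⊗ ε` to the axiom `E₁_T₁`. -/
theorem T₁_piBarRAct (c a b : A) :
    H.T₁ (H.piBarRAct c a ⊗ₜ b) = (lact (H.piBarR c)).lTensor A (H.T₁ (a ⊗ₜ b)) := by
  have h := congrArg ((sliceRight A H.counit).lTensor A)
    (LinearMap.congr_fun H.E₁_T₁ (a ⊗ₜ (b ⊗ₜ c)))
  simp only [LinearMap.comp_apply, leg12_tmul] at h
  have h1 : ∀ t : A ⊗[k] A, (sliceRight A H.counit).lTensor A (H.E₁.lTensor A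
      (TensorProduct.assoc k A A A (t ⊗ₜ c))) = (lact (H.piBarR c)).lTensor A t := by
    intro t
    induction t with
    | zero => simp
    | add x y hx hy => simp only [map_add, TensorProduct.add_tmul, hx, hy]
    | tmul u v => simp [WeakMultiplierBialgebra.lact_piBarR]
  have h2 : ∀ t : A ⊗[k] A, (sliceRight A H.counit).lTensor A (leg12 H.T₁ A
      ((TensorProduct.comm k A A).toLinearMap.lTensor A (TensorProduct.assoc k A A A (t ⊗ₜ b)))) =
        H.T₁ (sliceRight A H.counit t ⊗ₜ b) := by
    intro t
    induction t with
    | zero => simp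
    | add x y hx hy => simp only [map_add, TensorProduct.add_tmul, hx, hy]
    | tmul u v =>
      have h3 : ∀ t : A ⊗[k] A, (sliceRight A H.counit).lTensor A
          (TensorProduct.assoc k A A A (t ⊗ₜ v)) = H.counit v • t := by
        intro t
        induction t with
        | zero => simp
        | add x y hx hy => simp only [map_add, TensorProduct.add_tmul, smul_add, hx, hy]
        | tmul u v => simp
      simp [h3, ← TensorProduct.smul_tmul']
  exact (h2 _).symm.trans (h.symm.trans (h1 _))

theorem T₁_lact {r : Multiplier k A} (hr : r ∈ H.base) (a b : A) :
    H.T₁ (lact r a ⊗ₜ b) = (lact r).lTensor A (H.T₁ (a ⊗ₜ b)) := by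
  obtain ⟨c, rfl⟩ := H.mem_base.1 hr
  exact H.T₁_piBarRAct c a b

theorem mul_induction (H : RegularWeakMultiplierBialgebra k A) {p : A → Prop} (h0 : ∀ a b, p (a * b)) (h1 : ∀ a b, p a → p b → p (a + b))
    (a : A) : p a := by
  obtain ⟨t, rfl⟩ := H.mul_surjective a
  induction t with
  | zero => rw [map_zero]; simpa using h0 0 0
  | add x y hx hy => rw [map_add]; exact h1 _ _ hx hy
  | tmul x y => exact h0 x y

/-- `E (b ⊗ r a) = (1 ⊗ r) E (b ⊗ a)`. -/
theorem E₁_lact {r : Multiplier k A} (hr : r ∈ H.base) (b a : A) :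
    H.E₁ (b ⊗ₜ lact r a) = (lact r).lTensor A (H.E₁ (b ⊗ₜ a)) := by
  induction a using H.mul_induction with
  | h0 p q =>
    rw [lact_mul _ _ _ H.left_nondeg, E₁_tmul_mul, E₁_tmul_mul, H.T₁_lact hr]
    generalize H.T₁ (p ⊗ₜ q) = u
    induction u with
    | zero => simp
    | add x y hx hy => simp only [map_add, hx, hy]
    | tmul u v => simp
  | h1 x y hx hy => simp only [map_add, TensorProduct.tmul_add, hx, hy]

/-- `(E ⊗ 1)(a ⊗ Δ(b)(1 ⊗ c)) = (A ⊗ Δ)(E (a ⊗ b))(1 ⊗ 1 ⊗ c)`. -/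
theorem leg12_E₁_T₁ (a b c : A) : leg12 H.E₁ A (a ⊗ₜ H.T₁ (b ⊗ₜ c)) =
    H.T₁.lTensor A (TensorProduct.assoc k A A A (H.E₁ (a ⊗ₜ b) ⊗ₜ c)) := by
  -- For `s = x ⊗ y` both sides are `⊓̄ᴿ(p₁) a ⊗ p₂ x ⊗ p₃ y`, by `E₁_tmul_mul` in the first two
  -- legs. The lemma follows for `b = p d`, because `Δ(p d)(1 ⊗ c) = Δ(p) T₁(d ⊗ c)`.
  have key : ∀ (p : A) (s : A ⊗[k] A), leg12 H.E₁ A (a ⊗ₜ H.comul p s) =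
      (H.piBarRMap a).rTensor (A ⊗[k] A) (leg12 H.T₁ A (leg13 H.T₁ A (p ⊗ₜ s))) := by
    intro p s
    induction s with
    | zero => simp
    | add x y hx hy => simp only [map_add, TensorProduct.tmul_add, hx, hy]
    | tmul x y =>
      have h1 : ∀ (t : A ⊗[k] A) (v : A), (H.piBarRMap a).rTensor (A ⊗[k] A)
          (TensorProduct.assoc k A A A (t ⊗ₜ v)) =
            TensorProduct.assoc k A A A ((H.piBarRMap a).rTensor A t ⊗ₜ v) := by
        intro t v
        induction t with
        | zero => simp
        | add x y hx hy => simp only [map_add, TensorProduct.add_tmul, hx, hy]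
        | tmul u v => simp
      rw [comul_tmul, leg12_leg13_tmul]
      generalize H.T₁ (p ⊗ₜ y) = u
      induction u with
      | zero => simp
      | add x y hx hy => simp only [map_add, TensorProduct.tmul_add, hx, hy]
      | tmul u v => simp [h1, E₁_tmul_mul]
  induction b using H.mul_induction with
  | h0 p d =>
    have h := LinearMap.congr_fun H.regularComod.coassoc (p ⊗ₜ (d ⊗ₜ c))
    change leg12 H.T₁ A (leg13 H.T₁ A (p ⊗ₜ H.T₁ (d ⊗ₜ c))) = H.T₁.lTensor A
      (TensorProduct.assoc k A A A (H.T₁ (p ⊗ₜ d) ⊗ₜ c)) at h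
    rw [← comul_T₁, key, h, E₁_tmul_mul]
    generalize H.T₁ (p ⊗ₜ d) = u
    induction u with
    | zero => simp
    | add x y hx hy => simp only [map_add, TensorProduct.add_tmul, hx, hy]
    | tmul u v => simp
  | h1 x y hx hy => simp only [map_add, TensorProduct.add_tmul, TensorProduct.tmul_add, hx, hy]

end RegularWeakMultiplierBialgebra

end WeakMultiplier
end

/-! ### The base algebra: equality of the two ranges, coseparability, non-degeneracy. -/

noncomputable section

namespace WeakMultiplier

namespace RegularWeakMultiplierBialgebra

variable {k : Type*} [Field k] {A : Type*} [NonUnitalRing A] [Module k A]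
  [IsScalarTower k A A] [SMulCommClass k A A] (H : RegularWeakMultiplierBialgebra k A)

/-- The base algebra, as a type of its own. -/
def Base := ↥H.base

set_option synthInstance.maxHeartbeats 400000 in
instance : NonUnitalRing H.Base := inferInstanceAs (NonUnitalRing H.base)

set_option synthInstance.maxHeartbeats 400000 in
instance : Module k H.Base := inferInstanceAs (Module k H.base)

set_option synthInstance.maxHeartbeats 400000 in
instance : IsScalarTower k H.Base H.Base := inferInstanceAs (IsScalarTower k H.base H.base)

set_option synthInstance.maxHeartbeats 400000 in
instance : SMulCommClass k H.Base H.Base := inferInstanceAs (SMulCommClass k H.base H.base)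

/-- The inclusion of the base algebra into the multiplier algebra. -/
def baseIncl : H.Base →ₗ[k] Multiplier k A := H.base.toSubmodule.subtype

theorem baseIncl_injective : Function.Injective H.baseIncl := Subtype.val_injective

theorem baseIncl_mem (r : H.Base) : H.baseIncl r ∈ H.base := r.2

theorem baseIncl_mul (r s : H.Base) : H.baseIncl (r * s) = H.baseIncl r * H.baseIncl s := rfl

/-- The map `⊓̄ᴿ` as a map to the base algebra. -/
def toBase : A →ₗ[k] H.Base where
  toFun a := ⟨H.piBarR a, a, rfl⟩
  map_add' a b := Subtype.ext (map_add H.piBarR a b)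
  map_smul' c a := Subtype.ext (map_smul H.piBarR c a)

@[simp] theorem toBase_coe (a : A) : H.baseIncl (H.toBase a) = H.piBarR a := rfl

theorem toBase_surjective : Function.Surjective H.toBase := by
  rintro ⟨_, a, rfl⟩
  exact ⟨a, rfl⟩

theorem base_ext {r s : H.Base} (h : ∀ a, lact (H.baseIncl r) a = lact (H.baseIncl s) a) : r = s :=
  H.baseIncl_injective (multiplier_ext_lact H.left_nondeg H.right_nondeg h)

theorem base_ext_ract {r s : H.Base} (h : ∀ a, ract (H.baseIncl r) a = ract (H.baseIncl s) a) : r = s :=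
  H.baseIncl_injective (multiplier_ext H.left_nondeg h)

/-- `R` acts faithfully on `A`, and joint injectivity survives tensoring. Hence an element of `R ⊗
A` such as `E (1 ⊗ a)` is determined by its products with all `b ⊗ 1`. -/
theorem base_tensor_ext {V : Type*} [AddCommGroup V] [Module k V] {x y : H.Base ⊗[k] V}
    (h : ∀ b, (lactAt b ∘ₗ H.baseIncl).rTensor V x = (lactAt b ∘ₗ H.baseIncl).rTensor V y) :
    x = y := by
  rw [← sub_eq_zero]
  refine rTensor_joint (fun b : A => lactAt (k := k) b ∘ₗ H.baseIncl) (fun r hr => ?_) _ fun b => ?_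
  · exact H.base_ext fun a => hr a
  · rw [map_sub, sub_eq_zero]
    exact h b

/-- A linear section of the multiplication. -/
def mulSection : A →ₗ[k] A ⊗[k] A :=
  ((LinearMap.mul' k A).exists_rightInverse_of_surjective
    (LinearMap.range_eq_top.2 H.mul_surjective)).choose

theorem mul'_mulSection (a : A) : LinearMap.mul' k A (H.mulSection a) = a :=
  LinearMap.congr_fun ((LinearMap.mul' k A).exists_rightInverse_of_surjective
    (LinearMap.range_eq_top.2 H.mul_surjective)).choose_spec a

/-- The element `E (1 ⊗ a)` of `R ⊗ A`. -/
def baseL : A →ₗ[k] H.Base ⊗[k] A := H.toBase.rTensor A ∘ₗ H.T₁ ∘ₗ H.mulSection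

theorem lactAt_toBase_T₁ (b : A) (t : A ⊗[k] A) :
    (lactAt b ∘ₗ H.baseIncl).rTensor A (H.toBase.rTensor A (H.T₁ t)) =
      H.E₁ (b ⊗ₜ LinearMap.mul' k A t) := by
  induction t with
  | zero => simp
  | add x y hx hy => simp only [map_add, TensorProduct.tmul_add, hx, hy]
  | tmul p q =>
    rw [LinearMap.mul'_apply, E₁_tmul_mul, ← LinearMap.rTensor_comp_apply]
    rfl

theorem lactAt_baseL (b a : A) :
    (lactAt b ∘ₗ H.baseIncl).rTensor A (H.baseL a) = H.E₁ (b ⊗ₜ a) := by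
  rw [baseL, LinearMap.comp_apply, LinearMap.comp_apply, lactAt_toBase_T₁, mul'_mulSection]

/-- Both sides act on `b` as `E (b ⊗ p q)`. In particular `baseL` does not depend on the section of
the multiplication used to define it. -/
theorem baseL_mul (p q : A) : H.baseL (p * q) = H.toBase.rTensor A (H.T₁ (p ⊗ₜ q)) :=
  H.base_tensor_ext fun b => by
    rw [lactAt_baseL, lactAt_toBase_T₁, LinearMap.mul'_apply]

/-- The formula `E₁_tmul_mul` for the opposite: `(b ⊗ p q) E = b ⊓ᴿ(q₁) ⊗ p q₂`. -/
theorem E₂_mul_tmul (b p q : A) : H.E₂ (b ⊗ₜ (p * q)) =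
    (ractAt b ∘ₗ H.piR).rTensor A (H.T₃ (q ⊗ₜ p)) :=
  H.op.E₁_tmul_mul b q p

/-- The element `(1 ⊗ a) E` of `M(A) ⊗ A`. -/
def rightE : A →ₗ[k] Multiplier k A ⊗[k] A :=
  H.piR.rTensor A ∘ₗ H.T₃ ∘ₗ (TensorProduct.comm k A A).toLinearMap ∘ₗ H.mulSection

theorem ractAt_piR_T₃ (b : A) (t : A ⊗[k] A) :
    (ractAt b).rTensor A (H.piR.rTensor A (H.T₃ (TensorProduct.comm k A A t))) =
      H.E₂ (b ⊗ₜ LinearMap.mul' k A t) := by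
  induction t with
  | zero => simp
  | add x y hx hy => simp only [map_add, TensorProduct.tmul_add, hx, hy]
  | tmul p q =>
    rw [LinearMap.mul'_apply, E₂_mul_tmul, ← LinearMap.rTensor_comp_apply]
    rfl

theorem ractAt_rightE (b a : A) : (ractAt b).rTensor A (H.rightE a) = H.E₂ (b ⊗ₜ a) := by
  have h := H.ractAt_piR_T₃ b (H.mulSection a)
  rw [mul'_mulSection] at h
  exact h

theorem multiplier_tensor_ext_ract (H : RegularWeakMultiplierBialgebra k A)
    {V : Type*} [AddCommGroup V] [Module k V] {x y : Multiplier k A ⊗[k] V}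
    (h : ∀ b, (ractAt b).rTensor V x = (ractAt b).rTensor V y) : x = y := by
  rw [← sub_eq_zero]
  refine rTensor_joint (fun b : A => ractAt (k := k) b) (fun r hr => ?_) _ fun b => ?_
  · exact multiplier_ext H.left_nondeg fun a => hr a
  · rw [map_sub, sub_eq_zero]
    exact h b

theorem rightE_mul (p q : A) : H.rightE (p * q) = H.piR.rTensor A (H.T₃ (q ⊗ₜ p)) :=
  H.multiplier_tensor_ext_ract fun b => by
    have h := H.ractAt_piR_T₃ b (p ⊗ₜ q)
    rw [LinearMap.mul'_apply] at h
    rw [ractAt_rightE, ← h, TensorProduct.comm_tmul]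

/-- `(1 ⊗ a) (E (1 ⊗ b)) = ((1 ⊗ a) E) (1 ⊗ b)`. -/
theorem mulL₂_baseL (a b : A) : mulL₂ (Multiplier k A) a (H.baseIncl.rTensor A (H.baseL b)) =
    mulR₂ (Multiplier k A) b (H.rightE a) := by
  refine H.multiplier_tensor_ext_ract fun y => cancel_mulR₁ H.right_nondeg fun x => ?_
  have h : ∀ z : Multiplier k A ⊗[k] A, mulR₁ A x ((ractAt y).rTensor A z) =
      mulL₁ A y ((lactAt x).rTensor A z) := by
    intro z
    induction z with
    | zero => simp
    | add x y hx hy => simp only [map_add, hx, hy]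
    | tmul m a =>
      have h1 : ract m y * x = y * lact m x := (mul_lact m y x).symm
      exact congrArg (· ⊗ₜ[k] a) h1
  have h2 := H.lactAt_baseL x b
  rw [LinearMap.rTensor_comp, LinearMap.comp_apply] at h2
  rw [h, rTensor_mulL₂, h2, rTensor_mulR₂, ractAt_rightE, mulL₂_tmul_mul, mulR₂_tmul_mul, H.E_mul]

/-- For a right full comultiplication, `⊓ᴿ` and `⊓̄ᴿ` have the same range. -/
theorem range_piR (hH : H.IsRightFull) : LinearMap.range H.piR = LinearMap.range H.piBarR := by
  have hfull : H.regularComod.IsFull := hH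
  apply le_antisymm
  -- Modulo `X` the first legs of `E (1 ⊗ b)` vanish, so by `mulL₂_baseL` those of `(1 ⊗ a) E`
  -- vanish too. For `a = p q` the latter are the values of `⊓ᴿ` at the first legs of `T₃(q ⊗ p)`,
  -- which span `A` by right fullness.
  · let X := LinearMap.range H.piBarR
    have h0 : X.mkQ ∘ₗ H.baseIncl = 0 := LinearMap.ext fun r =>
      (Submodule.Quotient.mk_eq_zero X).2 r.2
    have h1 : ∀ a, X.mkQ.rTensor A (H.rightE a) = 0 := fun a =>
      cancel_mulR₂ H.right_nondeg fun b => by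
        rw [← rTensor_mulR₂, ← mulL₂_baseL, rTensor_mulL₂, ← LinearMap.rTensor_comp_apply, h0]
        simp
    have h2 : X.mkQ ∘ₗ H.piR = 0 := hfull.op.hom_ext fun (q p : A) => by
      have h3 := h1 (p * q)
      rw [rightE_mul, ← LinearMap.rTensor_comp_apply] at h3
      rw [LinearMap.rTensor_zero]
      exact h3
    rintro _ ⟨a, rfl⟩
    exact (Submodule.Quotient.mk_eq_zero X).1 (LinearMap.congr_fun h2 a)
  -- The same comparison in the other direction, with fullness read off `T₁`.
  · let X := LinearMap.range H.piR
    have h0 : X.mkQ ∘ₗ H.piR = 0 := LinearMap.ext fun a =>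
      (Submodule.Quotient.mk_eq_zero X).2 ⟨a, rfl⟩
    have h1 : ∀ a, X.mkQ.rTensor A (H.baseIncl.rTensor A (H.baseL a)) = 0 := fun b =>
      cancel_mulL₂ H.left_nondeg fun a => by
        rw [← rTensor_mulL₂, mulL₂_baseL, rTensor_mulR₂, rightE, LinearMap.comp_apply,
          ← LinearMap.rTensor_comp_apply, h0]
        simp
    have h2 : X.mkQ ∘ₗ H.piBarR = 0 := hfull.hom_ext fun p q => by
      have h3 := h1 (p * q)
      rw [baseL_mul, ← LinearMap.rTensor_comp_apply, ← LinearMap.rTensor_comp_apply] at h3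
      rw [LinearMap.rTensor_zero]
      exact h3
    rintro _ ⟨a, rfl⟩
    exact (Submodule.Quotient.mk_eq_zero X).1 (LinearMap.congr_fun h2 a)

theorem baseL_lact (r : H.Base) (a : A) :
    H.baseL (lact (H.baseIncl r) a) = (lact (H.baseIncl r)).lTensor H.Base (H.baseL a) :=
  H.base_tensor_ext fun b => by
    rw [lactAt_baseL, H.E₁_lact (H.baseIncl_mem r), ← H.lactAt_baseL, rTensor_lTensor]

/-- `E (⊓̄ᴿ(b) x ⊗ a) = E (x ⊗ ⊓ᴸ(b) a)`. -/
theorem E₁_piBarRAct (b x a : A) :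
    H.E₁ (H.piBarRAct b x ⊗ₜ a) = H.E₁ (x ⊗ₜ H.piLAct b a) :=
  H.E₁_eq_of_comul fun z => by
    rw [H.comul_tmul z x, piLAct, ← comul_rTensor_piBarRMap, LinearMap.rTensor_tmul,
      piBarRMap_apply]

theorem rTensor_mulRight_baseL (b a : A) :
    (LinearMap.mulRight k (H.toBase b)).rTensor A (H.baseL a) = H.baseL (H.piLAct b a) :=
  H.base_tensor_ext fun x => by
    rw [lactAt_baseL, ← E₁_piBarRAct, ← H.lactAt_baseL, ← LinearMap.rTensor_comp_apply]
    rfl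

/-- `x ⊓̄ᴿ(a)` is `x₁ ε(x₂ a)`, so it only involves the functionals `ε(x · )`. With
`baseFunctional_toBase`, the kernel of `⊓̄ᴿ` is exactly the common kernel of these functionals. -/
theorem piBarR_eq_zero_of_counit {a : A} (h : ∀ x, H.counit (x * a) = 0) : H.piBarR a = 0 :=
  multiplier_ext H.left_nondeg fun x => by
    change sliceRight A H.counit (H.T₁ (x ⊗ₜ a)) = 0
    apply H.left_nondeg
    intro y
    rw [← sliceRight_mulL₁, H.T₁_T₂]
    generalize H.T₂ (y ⊗ₜ x) = u
    induction u with
    | zero => simp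
    | add x y hx hy => simp only [map_add, hx, hy, add_zero]
    | tmul p q => simp [h]

/-- The functional `⊓̄ᴿ(a) ↦ ε(x a)` on the base algebra. -/
def baseFunctional (x : A) : H.Base →ₗ[k] k := H.counit ∘ₗ ractAt x ∘ₗ H.baseIncl

theorem baseFunctional_toBase (x a : A) :
    H.baseFunctional x (H.toBase a) = H.counit (x * a) := by
  rw [← H.counit_T₁_apply, counit_slice]
  rfl

/-- `⊓̄ᴿ(a) ↦ ∑ ⊓̄ᴿ(aᵢ) ⊗ rᵢ` for `E (1 ⊗ a) = ∑ rᵢ ⊗ aᵢ`. -/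
def baseComul : A →ₗ[k] H.Base ⊗[k] H.Base :=
  (TensorProduct.comm k H.Base H.Base).toLinearMap ∘ₗ H.toBase.lTensor H.Base ∘ₗ H.baseL

/-- This is why `baseComul` factors through `⊓̄ᴿ`. The functionals `baseFunctional x` separate `R`;
applied to the leg `⊓̄ᴿ(aᵢ)` they give the slice `(R ⊗ ε)((1 ⊗ x) E (1 ⊗ c))`, and bracketing `E`
with `1 ⊗ x` instead leaves only values `ε(q c)`. -/
theorem baseComul_congr {a b : A} (h : ∀ x, H.counit (x * a) = H.counit (x * b)) :
    H.baseComul a = H.baseComul b := by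
  have key : ∀ c, (∀ x, H.counit (x * c) = 0) → H.toBase.lTensor H.Base (H.baseL c) = 0 := by
    intro c hc
    refine lTensor_joint H.baseFunctional (fun r hr => ?_) _ fun x => ?_
    · obtain ⟨a, rfl⟩ := H.toBase_surjective r
      exact H.baseIncl_injective (H.piBarR_eq_zero_of_counit fun x => by rw [← baseFunctional_toBase, hr])
    · have h1 : H.baseFunctional x ∘ₗ H.toBase = H.counit ∘ₗ LinearMap.mulLeft k x :=
        LinearMap.ext fun a => H.baseFunctional_toBase x a
      rw [← LinearMap.lTensor_comp_apply, h1]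
      apply (TensorProduct.rid k H.Base).injective
      have h2 : sliceRight H.Base H.counit (mulL₂ H.Base x (H.baseL c)) = 0 := by
        apply H.baseIncl_injective
        rw [map_zero, map_sliceRight, rTensor_mulL₂, mulL₂_baseL]
        generalize H.rightE x = u
        induction u with
        | zero => simp
        | add x y hx hy => simp only [map_add, hx, hy, add_zero]
        | tmul p q => simp [hc]
      rw [map_zero, ← h2, mulL₂, sliceRight_lTensor]
      rfl
  have h1 : H.toBase.lTensor H.Base (H.baseL (a - b)) = 0 :=
    key _ fun x => by rw [mul_sub, map_sub, h, sub_self]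
  rw [map_sub, map_sub, sub_eq_zero] at h1
  exact congrArg (TensorProduct.comm k H.Base H.Base) h1

theorem toBase_mul (a b : A) : H.toBase a * H.toBase b = H.toBase (H.piBarRAct a b) :=
  H.baseIncl_injective (H.piBarR_mul a b)

/-- Multiplication by `⊓̄ᴿ(a)` on the leg `⊓̄ᴿ(bᵢ)` is `⊓̄ᴿ(a)` acting on `bᵢ`, and this is `E (1 ⊗
r b) = (1 ⊗ r) E (1 ⊗ b)`. -/
theorem mulLeft_baseComul (a b : A) :
    (LinearMap.mulLeft k (H.toBase a)).rTensor H.Base (H.baseComul b) =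
      H.baseComul (H.piBarRAct a b) := by
  have h1 := H.baseL_lact (H.toBase a) b
  change H.baseL (H.piBarRAct a b) = _ at h1
  have h2 : ∀ u : H.Base ⊗[k] A, (LinearMap.mulLeft k (H.toBase a)).rTensor H.Base
      (TensorProduct.comm k H.Base H.Base (H.toBase.lTensor H.Base u)) =
        TensorProduct.comm k H.Base H.Base (H.toBase.lTensor H.Base
          ((lact (H.baseIncl (H.toBase a))).lTensor H.Base u)) := by
    intro u
    induction u with
    | zero => simp
    | add x y hx hy => simp only [map_add, hx, hy]
    | tmul p q =>
      simp only [LinearMap.lTensor_tmul, TensorProduct.comm_tmul, LinearMap.rTensor_tmul,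
        LinearMap.mulLeft_apply, toBase_mul]
      rfl
  refine (h2 _).trans ?_
  rw [← h1]
  rfl

/-- Here `⊓̄ᴿ(b)` multiplies the leg `rᵢ` from the right, and `E₁_piBarRAct` moves it to the other
leg of `E (1 ⊗ a)` as `⊓ᴸ(b)`. -/
theorem mulRight_baseComul (a b : A) :
    (LinearMap.mulRight k (H.toBase b)).lTensor H.Base (H.baseComul a) =
      H.baseComul (H.piLAct b a) := by
  have h2 : ∀ u : H.Base ⊗[k] A, (LinearMap.mulRight k (H.toBase b)).lTensor H.Base
      (TensorProduct.comm k H.Base H.Base (H.toBase.lTensor H.Base u)) =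
        TensorProduct.comm k H.Base H.Base (H.toBase.lTensor H.Base
          ((LinearMap.mulRight k (H.toBase b)).rTensor A u)) := by
    intro u
    induction u with
    | zero => simp
    | add x y hx hy => simp only [map_add, hx, hy]
    | tmul p q => simp
  refine (h2 _).trans ?_
  rw [rTensor_mulRight_baseL]
  rfl

/-- `x ⊓̄ᴿ(a) b` and `x ⊓ᴸ(b) a` are the two slices by `ε` of the single element `Δ(x)(b ⊗ a)`, so
`ε` takes the same value on both. -/
theorem counit_mul_piBarRAct (x a b : A) :
    H.counit (x * H.piBarRAct a b) = H.counit (x * H.piLAct b a) := by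
  rw [piLAct, ← sliceLeft_comul, mul_piBarRAct, comul_tmul, counit_slice, sliceRight_mulR₁]
  rfl

/-- The coseparability identity `r δ(s) = δ(r) s`. The elements `⊓̄ᴿ(a) b` and `⊓ᴸ(b) a` of `A` need
not be equal, but the functionals `ε(x · )` do not separate them. -/
theorem mulLeft_baseComul_eq (a b : A) :
    (LinearMap.mulLeft k (H.toBase a)).rTensor H.Base (H.baseComul b) =
      (LinearMap.mulRight k (H.toBase b)).lTensor H.Base (H.baseComul a) := by
  rw [mulLeft_baseComul, mulRight_baseComul]
  exact H.baseComul_congr fun x => H.counit_mul_piBarRAct x a b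

/-- Acting on `x`, the product `∑ ⊓̄ᴿ(aᵢ) rᵢ` yields `(A ⊗ ε)(E E (x ⊗ a))`, and `E` is idempotent.
-/
theorem mul'_baseComul (a : A) : LinearMap.mul' k H.Base (H.baseComul a) = H.toBase a := by
  refine H.base_ext fun x => ?_
  have h1 : ∀ u : H.Base ⊗[k] A, lact (H.baseIncl (LinearMap.mul' k H.Base
      (TensorProduct.comm k H.Base H.Base (H.toBase.lTensor H.Base u)))) x =
        sliceRight A H.counit (H.E₁ ((lactAt x ∘ₗ H.baseIncl).rTensor A u)) := by
    intro u
    have h2 : ∀ r : H.Base, lact (H.baseIncl r) x = lactAt x (H.baseIncl r) := fun _ => rfl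
    rw [h2]
    induction u with
    | zero => simp
    | add x y hx hy => simp only [map_add, hx, hy]
    | tmul p q => rfl
  refine (h1 _).trans ?_
  rw [lactAt_baseL, E₁_E₁]
  rfl

/-- `A` is spanned by the elements `⊓̄ᴿ(q) p`, because `a b = (A ⊗ ε)(E T₄(b ⊗ a))`; so `r` kills
`A` as soon as it kills `R` from the left. -/
theorem base_right_nondeg (r : H.Base) (h : ∀ s, r * s = 0) : r = 0 := by
  refine H.base_ext fun a => ?_
  change lact (H.baseIncl r) a = 0
  induction a using H.mul_induction with
  | h0 a b =>
    rw [← H.counit_T₄, ← E₁_T₄_apply]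
    generalize H.T₄ (b ⊗ₜ a) = u
    induction u with
    | zero => simp
    | add x y hx hy => simp only [map_add, hx, hy, add_zero]
    | tmul p q =>
      have h1 := congrArg (fun s : H.Base => lact (H.baseIncl s) p) (h (H.toBase q))
      exact h1
  | h1 a b ha hb => rw [map_add, ha, hb, add_zero]

theorem mul_eq_counit_E₂ (a b : A) :
    a * b = sliceRight A H.counit (H.E₂ (H.T₂ (a ⊗ₜ b))) := by
  have h := H.op.E₁_T₄_apply (show Op A ⊗[k] Op A from a ⊗ₜ[k] b)
  change H.E₂ (H.T₂ (a ⊗ₜ b)) = H.T₂ (a ⊗ₜ b) at h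
  rw [h, H.counit_T₂_apply]

/-- Dually `A` is spanned by the elements `p ⊓ᴿ(q)`. The equality of ranges is needed for `⊓ᴿ(q)` to
belong to `R`. -/
theorem base_left_nondeg (hr : LinearMap.range H.piR = LinearMap.range H.piBarR) (r : H.Base)
    (h : ∀ s, s * r = 0) : r = 0 := by
  refine H.base_ext_ract fun a => ?_
  change ract (H.baseIncl r) a = 0
  induction a using H.mul_induction with
  | h0 a b =>
    rw [H.mul_eq_counit_E₂]
    generalize H.T₂ (a ⊗ₜ b) = u
    induction u with
    | zero => simp
    | add x y hx hy => simp only [map_add, hx, hy, add_zero]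
    | tmul p q =>
      have h0 : H.piR q ∈ LinearMap.range H.piBarR := hr ▸ ⟨q, rfl⟩
      have h1 := congrArg (fun s : H.Base => ract (H.baseIncl s) p) (h ⟨H.piR q, h0⟩)
      exact h1
  | h1 a b ha hb => rw [map_add, ha, hb, add_zero]

end RegularWeakMultiplierBialgebra

end WeakMultiplier
end

/-! ### Firm modules over a coseparable algebra. -/

noncomputable section

namespace FirmBimodules

namespace BimoduleStr

variable {k : Type*} [Field k] {R : Type*} [NonUnitalRing R] [Module k R]
  [IsScalarTower k R R] [SMulCommClass k R R] {M : Type*} [AddCommGroup M] [Module k M]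
  (B : BimoduleStr k R M) {δ : R →ₗ[k] R ⊗[k] R}

/-- The map `m ⊗ r ↦ ∑ m r₁ ⊗ r₂` for `δ(r) = ∑ r₁ ⊗ r₂`. -/
def coactRight (δ : R →ₗ[k] R ⊗[k] R) : M ⊗[k] R →ₗ[k] M ⊗[k] R :=
  (TensorProduct.lift B.right.flip).rTensor R ∘ₗ
    (TensorProduct.assoc k M R R).symm.toLinearMap ∘ₗ δ.lTensor M

theorem coactRight_tmul (m : M) (r : R) :
    B.coactRight δ (m ⊗ₜ r) = (B.right.flip m).rTensor R (δ r) := by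
  simp only [coactRight, LinearMap.comp_apply, LinearMap.lTensor_tmul]
  generalize δ r = t
  induction t with
  | zero => simp
  | add x y hx hy => simp only [map_add, TensorProduct.tmul_add, hx, hy]
  | tmul a b => simp

/-- By `r δ(s) = δ(r) s`, multiplying `m δ(r)` by `s` gives `(m r) δ(s)`. So after multiplication by
`s` only the image of `x` under the action remains visible. -/
theorem mulRight_coactRight (h2 : ∀ r s, (LinearMap.mulLeft k r).rTensor R (δ s) =
      (LinearMap.mulRight k s).lTensor R (δ r)) (s : R) (x : M ⊗[k] R) :
    (LinearMap.mulRight k s).lTensor M (B.coactRight δ x) =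
      (B.right.flip (TensorProduct.lift B.right.flip x)).rTensor R (δ s) := by
  induction x with
  | zero => simp
  | add x y hx hy =>
    simp only [map_add, hx, hy, LinearMap.rTensor_add, LinearMap.add_apply]
  | tmul m r =>
    have h3 : ∀ m, (B.right.flip (B.right r m)) = B.right.flip m ∘ₗ LinearMap.mulLeft k r :=
      fun m => LinearMap.ext fun s => by simp [B.right_mul]
    rw [coactRight_tmul, TensorProduct.lift.tmul, LinearMap.flip_apply, h3,
      LinearMap.rTensor_comp_apply, h2]
    exact (WeakMultiplier.rTensor_lTensor _ _ _).symm

theorem coactRight_eq_zero (h2 : ∀ r s, (LinearMap.mulLeft k r).rTensor R (δ s) =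
      (LinearMap.mulRight k s).lTensor R (δ r)) (hR : ∀ r : R, (∀ s, r * s = 0) → r = 0)
    {x : M ⊗[k] R} (hx : ∀ s, B.right s (TensorProduct.lift B.right.flip x) = 0) :
    B.coactRight δ x = 0 := by
  refine WeakMultiplier.lTensor_joint (fun s : R => LinearMap.mulRight k s) hR _ fun s => ?_
  rw [mulRight_coactRight B h2, show B.right.flip (TensorProduct.lift B.right.flip x) = 0 from
    LinearMap.ext hx, LinearMap.rTensor_zero, LinearMap.zero_apply]

theorem proj_coactRight (h1 : ∀ r, LinearMap.mul' k R (δ r) = r) (x : M ⊗[k] R) :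
    RelTensor.proj B.right (regular k R).left (B.coactRight δ x) =
      RelTensor.proj B.right (regular k R).left x := by
  induction x with
  | zero => simp
  | add x y hx hy => simp only [map_add, hx, hy]
  | tmul m r =>
    rw [coactRight_tmul]
    conv_rhs => rw [← h1 r]
    generalize δ r = t
    induction t with
    | zero => simp
    | add x y hx hy => simp only [map_add, TensorProduct.tmul_add, hx, hy]
    | tmul a b => exact RelTensor.proj_balanced m a b

/-- If `δ` splits the multiplication of `R`, then a bimodule with `M R = M` is firm as a right
module. -/
theorem rightMap_bijective (h1 : ∀ r, LinearMap.mul' k R (δ r) = r)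
    (h2 : ∀ r s, (LinearMap.mulLeft k r).rTensor R (δ s) =
      (LinearMap.mulRight k s).lTensor R (δ r)) (hR : ∀ r : R, (∀ s, r * s = 0) → r = 0)
    (hs : Function.Surjective (TensorProduct.lift B.right.flip)) :
    Function.Bijective B.rightMap := by
  constructor
  · rw [injective_iff_map_eq_zero]
    intro y hy
    obtain ⟨x, rfl⟩ := RelTensor.proj_surjective y
    -- If the action sends `x` to zero, then `∑ m δ(r)` is killed by every `s`, hence is zero by
    -- non-degeneracy. But it represents the same class as `x` in `M ⊗_R R`, as `δ` splits the
    -- multiplication.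
    rw [← proj_coactRight B h1, coactRight_eq_zero B h2 hR, map_zero]
    intro s
    have h3 : TensorProduct.lift B.right.flip x = 0 := (RelTensor.lift_proj _ _ x).symm.trans hy
    rw [h3, map_zero]
  · intro m
    obtain ⟨x, rfl⟩ := hs m
    exact ⟨RelTensor.proj _ _ x, RelTensor.lift_proj _ _ x⟩

/-- Write `m` as the image of some `x` under the action. The argument for injectivity only needs `m
s = 0` for all `s`; it shows that `x` is zero in `M ⊗_R R`, so `m = 0`. -/
theorem eq_zero_of_right (h1 : ∀ r, LinearMap.mul' k R (δ r) = r)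
    (h2 : ∀ r s, (LinearMap.mulLeft k r).rTensor R (δ s) =
      (LinearMap.mulRight k s).lTensor R (δ r)) (hR : ∀ r : R, (∀ s, r * s = 0) → r = 0)
    (hs : Function.Surjective (TensorProduct.lift B.right.flip)) {m : M}
    (hm : ∀ s, B.right s m = 0) : m = 0 := by
  obtain ⟨x, rfl⟩ := hs m
  have h3 := proj_coactRight B h1 x
  rw [coactRight_eq_zero B h2 hR hm, map_zero] at h3
  refine (RelTensor.lift_proj (ρ := B.right) (l := (regular k R).left)
    (TensorProduct.lift B.right.flip) (by simp [B.right_mul]) x).symm.trans ?_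
  rw [← h3, map_zero]

/-- The map `r ⊗ m ↦ ∑ r₁ ⊗ r₂ m` for `δ(r) = ∑ r₁ ⊗ r₂`. -/
def coactLeft (δ : R →ₗ[k] R ⊗[k] R) : R ⊗[k] M →ₗ[k] R ⊗[k] M :=
  (TensorProduct.lift B.left).lTensor R ∘ₗ
    (TensorProduct.assoc k R R M).toLinearMap ∘ₗ δ.rTensor M

theorem coactLeft_tmul (m : M) (r : R) :
    B.coactLeft δ (r ⊗ₜ m) = (B.left.flip m).lTensor R (δ r) := by
  simp only [coactLeft, LinearMap.comp_apply, LinearMap.rTensor_tmul]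
  generalize δ r = t
  induction t with
  | zero => simp
  | add x y hx hy => simp only [map_add, TensorProduct.add_tmul, hx, hy]
  | tmul a b => simp

theorem mulLeft_coactLeft (h2 : ∀ r s, (LinearMap.mulLeft k r).rTensor R (δ s) =
      (LinearMap.mulRight k s).lTensor R (δ r)) (s : R) (x : R ⊗[k] M) :
    (LinearMap.mulLeft k s).rTensor M (B.coactLeft δ x) =
      (B.left.flip (TensorProduct.lift B.left x)).lTensor R (δ s) := by
  induction x with
  | zero => simp
  | add x y hx hy =>
    simp only [map_add, hx, hy, LinearMap.lTensor_add, LinearMap.add_apply]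
  | tmul r m =>
    have h3 : B.left.flip (B.left r m) = B.left.flip m ∘ₗ LinearMap.mulRight k r :=
      LinearMap.ext fun s => by simp [B.left_mul]
    rw [coactLeft_tmul, TensorProduct.lift.tmul, h3, LinearMap.lTensor_comp_apply, ← h2]
    exact WeakMultiplier.rTensor_lTensor _ _ _

theorem coactLeft_eq_zero (h2 : ∀ r s, (LinearMap.mulLeft k r).rTensor R (δ s) =
      (LinearMap.mulRight k s).lTensor R (δ r)) (hR : ∀ r : R, (∀ s, s * r = 0) → r = 0)
    {x : R ⊗[k] M} (hx : ∀ s, B.left s (TensorProduct.lift B.left x) = 0) :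
    B.coactLeft δ x = 0 := by
  refine WeakMultiplier.rTensor_joint (fun s : R => LinearMap.mulLeft k s) hR _ fun s => ?_
  rw [mulLeft_coactLeft B h2, show B.left.flip (TensorProduct.lift B.left x) = 0 from
    LinearMap.ext hx, LinearMap.lTensor_zero, LinearMap.zero_apply]

theorem proj_coactLeft (h1 : ∀ r, LinearMap.mul' k R (δ r) = r) (x : R ⊗[k] M) :
    RelTensor.proj (regular k R).right B.left (B.coactLeft δ x) =
      RelTensor.proj (regular k R).right B.left x := by
  induction x with
  | zero => simp
  | add x y hx hy => simp only [map_add, hx, hy]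
  | tmul r m =>
    rw [coactLeft_tmul]
    conv_rhs => rw [← h1 r]
    generalize δ r = t
    induction t with
    | zero => simp
    | add x y hx hy => simp only [map_add, TensorProduct.add_tmul, hx, hy]
    | tmul a b => exact (RelTensor.proj_balanced a b m).symm

/-- The mirror image of `rightMap_bijective` with the same `δ`, since the condition `r δ(s) = δ(r)
s` is symmetric under reversal. -/
theorem leftMap_bijective (h1 : ∀ r, LinearMap.mul' k R (δ r) = r)
    (h2 : ∀ r s, (LinearMap.mulLeft k r).rTensor R (δ s) =
      (LinearMap.mulRight k s).lTensor R (δ r)) (hR : ∀ r : R, (∀ s, s * r = 0) → r = 0)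
    (hs : Function.Surjective (TensorProduct.lift B.left)) :
    Function.Bijective B.leftMap := by
  constructor
  · rw [injective_iff_map_eq_zero]
    intro y hy
    obtain ⟨x, rfl⟩ := RelTensor.proj_surjective y
    rw [← proj_coactLeft B h1, coactLeft_eq_zero B h2 hR, map_zero]
    intro s
    have h3 : TensorProduct.lift B.left x = 0 := (RelTensor.lift_proj _ _ x).symm.trans hy
    rw [h3, map_zero]
  · intro m
    obtain ⟨x, rfl⟩ := hs m
    exact ⟨RelTensor.proj _ _ x, RelTensor.lift_proj _ _ x⟩

end BimoduleStr

end FirmBimodules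

namespace WeakMultiplier

namespace RegularWeakMultiplierBialgebra

variable {k : Type*} [Field k] {A : Type*} [NonUnitalRing A] [Module k A]
  [IsScalarTower k A A] [SMulCommClass k A A] (H : RegularWeakMultiplierBialgebra k A)

/-- A linear section of `⊓̄ᴿ : A → R`. -/
def baseSection : H.Base →ₗ[k] A :=
  (H.toBase.exists_rightInverse_of_surjective
    (LinearMap.range_eq_top.2 H.toBase_surjective)).choose

@[simp] theorem toBase_baseSection (r : H.Base) : H.toBase (H.baseSection r) = r :=
  LinearMap.congr_fun (H.toBase.exists_rightInverse_of_surjective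
    (LinearMap.range_eq_top.2 H.toBase_surjective)).choose_spec r

/-- The comultiplication of the coseparable base algebra. -/
def baseSplit : H.Base →ₗ[k] H.Base ⊗[k] H.Base := H.baseComul ∘ₗ H.baseSection

theorem mul'_baseSplit (r : H.Base) : LinearMap.mul' k H.Base (H.baseSplit r) = r :=
  (H.mul'_baseComul _).trans (H.toBase_baseSection r)

theorem mulLeft_baseSplit (r s : H.Base) :
    (LinearMap.mulLeft k r).rTensor H.Base (H.baseSplit s) =
      (LinearMap.mulRight k s).lTensor H.Base (H.baseSplit r) := by
  have h := H.mulLeft_baseComul_eq (H.baseSection r) (H.baseSection s)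
  rwa [toBase_baseSection, toBase_baseSection] at h

variable {H} in
/-- The map `⊓ᴿ` as a map to the base algebra. -/
def toBase' (hr : LinearMap.range H.piR = LinearMap.range H.piBarR) : A →ₗ[k] H.Base where
  toFun a := ⟨H.piR a, by
    have h : H.piR a ∈ LinearMap.range H.piR := ⟨a, rfl⟩
    rw [hr] at h
    exact h⟩
  map_add' a b := Subtype.ext (map_add H.piR a b)
  map_smul' c a := Subtype.ext (map_smul H.piR c a)

variable (hr : LinearMap.range H.piR = LinearMap.range H.piBarR)

@[simp] theorem baseIncl_toBase' (a : A) : H.baseIncl (toBase' hr a) = H.piR a := rfl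

theorem toBase'_surjective : Function.Surjective (toBase' hr) := by
  intro r
  have h : H.baseIncl r ∈ LinearMap.range H.piBarR := r.2
  rw [← hr] at h
  obtain ⟨a, ha⟩ := h
  exact ⟨a, H.baseIncl_injective ha⟩

/-- A linear section of `⊓ᴿ : A → R`. -/
def baseSection' : H.Base →ₗ[k] A :=
  ((toBase' hr).exists_rightInverse_of_surjective
    (LinearMap.range_eq_top.2 (H.toBase'_surjective hr))).choose

@[simp] theorem toBase'_baseSection' (r : H.Base) : toBase' hr (H.baseSection' hr r) = r :=
  LinearMap.congr_fun ((toBase' hr).exists_rightInverse_of_surjective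
    (LinearMap.range_eq_top.2 (H.toBase'_surjective hr))).choose_spec r

theorem exists_piR (hr : LinearMap.range H.piR = LinearMap.range H.piBarR) (r : H.Base) : ∃ a, H.piR a = H.baseIncl r := by
  have h : H.baseIncl r ∈ LinearMap.range H.piBarR := r.2
  rw [← hr] at h
  exact h

end RegularWeakMultiplierBialgebra

end WeakMultiplier
end

/-! ### Full comodules as firm bimodules over the base algebra. -/

noncomputable section

namespace WeakMultiplier

namespace RegularWeakMultiplierBialgebra

variable {k : Type*} [Field k] {A : Type*} [NonUnitalRing A] [Module k A]
  [IsScalarTower k A A] [SMulCommClass k A A] (H : RegularWeakMultiplierBialgebra k A)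

/-- `A` is spanned by the elements `⊓ᴸ(p) q`, because `a b = (ε ⊗ A)(E T₁(a ⊗ b))`. -/
theorem linearMap_eq_zero_of_piLAct {P : Type*} [AddCommGroup P] [Module k P] {f : A →ₗ[k] P}
    (hf : ∀ a b, f (H.piLAct a b) = 0) : f = 0 := by
  refine LinearMap.ext fun x => ?_
  rw [LinearMap.zero_apply]
  induction x using H.mul_induction with
  | h0 a b =>
    rw [← H.counit_T₁_apply, ← H.E₁_T₁_apply]
    generalize H.T₁ (a ⊗ₜ b) = t
    induction t with
    | zero => simp
    | add x y hx hy => simp only [map_add, hx, hy, add_zero]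
    | tmul p q => exact hf p q
  | h1 a b ha hb => rw [map_add, ha, hb, add_zero]

/-- `x ⊓ᴸ(a) b` is obtained by applying `ε ⊗ A` to `(x₁ ◁ a) ⊗ x₂ b`, and on the regular comodule `◁
a` is right multiplication by `⊓̄ᴿ(a)`. -/
theorem piLAct_eq_zero {a : A} (ha : H.piBarR a = 0) (b : A) : H.piLAct a b = 0 := by
  apply H.left_nondeg
  intro x
  have h1 : H.regularComod.rightAct a = 0 := by
    refine LinearMap.ext fun y => ?_
    change ract (H.piBarR a) y = 0
    rw [ha]
    rfl
  have h2 := H.regularComod.rTensor_rightAct_lam a b x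
  rw [h1, LinearMap.rTensor_zero, LinearMap.zero_apply] at h2
  rw [← H.counit_T₁_apply]
  change sliceLeft A H.counit (H.regularComod.lam (x ⊗ₜ H.piLAct a b)) = 0
  rw [← h2, map_zero]

/-- `x ⊓ᴸ(a) = (ε ⊗ A) T₄(a ⊗ x)`. -/
def actPiL (a : A) : A →ₗ[k] A := sliceLeft A H.counit ∘ₗ H.T₄ ∘ₗ tmulLeft A a

theorem mul_piLAct (a x y : A) : x * H.piLAct a y = H.actPiL a x * y := by
  rw [piLAct, ← sliceLeft_mulL₂, H.counit_E₁, H.T₁_T₄, sliceLeft_mulR₂]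
  rfl

theorem counit_actPiL (a x : A) : H.counit (H.actPiL a x) = H.counit (x * a) := by
  rw [← H.counit_T₄, ← counit_slice]
  rfl

theorem piR_mul (a b : A) : H.piR b * H.piR a = H.piR (ract (H.piR a) b) := by
  refine multiplier_ext_lact H.left_nondeg H.right_nondeg fun x => ?_
  have h := H.op.piBarR_mul (show Op A from a) (show Op A from b)
  exact congrArg (fun m : Multiplier k (Op A) => ract m (show Op A from x)) h

end RegularWeakMultiplierBialgebra

namespace RightComod

open FirmBimodules RegularWeakMultiplierBialgebra

variable {k : Type*} [Field k] {A : Type*} [NonUnitalRing A] [Module k A]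
  [IsScalarTower k A A] [SMulCommClass k A A] {H : RegularWeakMultiplierBialgebra k A}
  {V : Type*} [AddCommGroup V] [Module k V] (c : RightComod H V)

/-- The operator `v ↦ (V ⊗ ε) ρ(v ⊗ a)`. -/
def leftAct : A →ₗ[k] V →ₗ[k] V :=
  ((TensorProduct.mk k V A).compr₂ (sliceRight V H.counit ∘ₗ c.rho)).flip

theorem leftAct_apply (a : A) (v : V) :
    c.leftAct a v = sliceRight V H.counit (c.rho (v ⊗ₜ a)) := rfl

theorem leftAct_leftAct (a b : A) (v : V) :
    c.leftAct b (c.leftAct a v) = c.leftAct (ract (H.piR a) b) v :=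
  c.op.rightAct_rightAct (show Op A from a) (show Op A from b) v

theorem rTensor_rightAct_rho (a b : A) (v : V) :
    (c.rightAct a).rTensor A (c.rho (v ⊗ₜ b)) = (H.actPiL a).lTensor V (c.rho (v ⊗ₜ b)) := by
  refine cancel_mulR₂ H.right_nondeg fun y => ?_
  have h : ∀ t : V ⊗[k] A, mulR₂ V y ((H.actPiL a).lTensor V t) =
      mulR₂ V (H.piLAct a y) t := by
    intro t
    induction t with
    | zero => simp
    | add x y hx hy => simp only [map_add, hx, hy]
    | tmul w z => simp [H.mul_piLAct]
  rw [← rTensor_mulR₂, ← c.compat, rTensor_mulL₂, rTensor_rightAct_lam, c.compat, h]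

theorem rightAct_leftAct_eq (a b : A) (v : V) :
    c.rightAct a (c.leftAct b v) = sliceRight V H.counit (mulR₂ V a (c.rho (v ⊗ₜ b))) := by
  rw [leftAct_apply, map_sliceRight, rTensor_rightAct_rho]
  generalize c.rho (v ⊗ₜ b) = t
  induction t with
  | zero => simp
  | add x y hx hy => simp only [map_add, hx, hy]
  | tmul w z => simp [H.counit_actPiL]

/-- Both composites are the slice by `ε` of the one element `(1 ⊗ b) λ(v ⊗ a) = ρ(v ⊗ b)(1 ⊗ a)`. -/
theorem rightAct_leftAct (a b : A) (v : V) :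
    c.rightAct a (c.leftAct b v) = c.leftAct b (c.rightAct a v) := by
  rw [rightAct_leftAct_eq, ← c.compat]
  exact (c.op.rightAct_leftAct_eq (show Op A from b) (show Op A from a) v).symm

/-- This makes the action of `R` well defined. Fullness reduces the claim to `(v₀ ◁ a) ⊗ v₁ b = v₀ ⊗
v₁ ⊓ᴸ(a) b`, and `⊓̄ᴿ(a) = 0` forces `⊓ᴸ(a) = 0`. -/
theorem rightAct_eq_zero (hc : c.IsFull) {a : A} (ha : H.piBarR a = 0) : c.rightAct a = 0 :=
  hc.hom_ext fun v b => by
    rw [rTensor_rightAct_lam, H.piLAct_eq_zero ha, TensorProduct.tmul_zero, map_zero,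
      LinearMap.rTensor_zero, LinearMap.zero_apply]

/-- Modulo the span of the elements `v ◁ a`, the same formula makes `λ(v ⊗ ⊓ᴸ(a) b)` vanish. Since
the elements `⊓ᴸ(a) b` span `A`, all of `λ` vanishes, and fullness applies. -/
theorem rightAct_surjective (hc : c.IsFull) :
    Function.Surjective (TensorProduct.lift c.rightAct) := by
  rw [← LinearMap.range_eq_top]
  refine hc.eq_top fun v a => ?_
  let X := LinearMap.range (TensorProduct.lift c.rightAct)
  have h : X.mkQ.rTensor A ∘ₗ c.lam ∘ₗ tmulLeft A v = 0 :=
    H.linearMap_eq_zero_of_piLAct fun a b => by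
      have h1 : X.mkQ ∘ₗ c.rightAct a = 0 := LinearMap.ext fun w =>
        (Submodule.Quotient.mk_eq_zero X).2 ⟨a ⊗ₜ w, TensorProduct.lift.tmul _ _⟩
      change X.mkQ.rTensor A (c.lam (v ⊗ₜ H.piLAct a b)) = 0
      rw [← rTensor_rightAct_lam, ← LinearMap.rTensor_comp_apply, h1, LinearMap.rTensor_zero,
        LinearMap.zero_apply]
  exact LinearMap.congr_fun h a

theorem leftAct_surjective (hc : c.IsFull) :
    Function.Surjective (TensorProduct.lift c.leftAct) :=
  c.op.rightAct_surjective hc.op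

/-- The right action `v ⊓̄ᴿ(a) = (V ⊗ ε) λ(v ⊗ a)` of the base algebra. -/
def baseRight : H.Base →ₗ[k] V →ₗ[k] V := c.rightAct ∘ₗ H.baseSection

variable {c}

theorem IsFull.baseRight_eq (hc : c.IsFull) {r : H.Base} {a : A} (h : H.piBarR a = H.baseIncl r) :
    c.baseRight r = c.rightAct a := by
  rw [← sub_eq_zero]
  refine (map_sub c.rightAct _ _).symm.trans (c.rightAct_eq_zero hc ?_)
  rw [map_sub, h, ← H.toBase_coe, H.toBase_baseSection, sub_self]

theorem IsFull.baseRight_toBase (hc : c.IsFull) (a : A) :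
    c.baseRight (H.toBase a) = c.rightAct a :=
  hc.baseRight_eq rfl

variable (hr : LinearMap.range H.piR = LinearMap.range H.piBarR)

variable (c) in
/-- The left action `⊓ᴿ(a) v = (V ⊗ ε) ρ(v ⊗ a)` of the base algebra. -/
def baseLeft : H.Base →ₗ[k] V →ₗ[k] V := c.leftAct ∘ₗ H.baseSection' hr

theorem IsFull.baseLeft_eq (hc : c.IsFull) {r : H.Base} {a : A} (h : H.piR a = H.baseIncl r) :
    c.baseLeft hr r = c.leftAct a := by
  rw [← sub_eq_zero]
  refine (map_sub c.leftAct _ _).symm.trans (c.op.rightAct_eq_zero hc.op ?_)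
  have h1 : H.piR (H.baseSection' hr r - a) = 0 := by
    rw [map_sub, h, ← H.baseIncl_toBase' hr, H.toBase'_baseSection', sub_self]
  -- The left multiplication of `⊓̄ᴿ` for the opposite is the right multiplication of `⊓ᴿ` for `A`.
  refine multiplier_ext_lact H.right_nondeg H.left_nondeg fun (x : A) => ?_
  exact congrArg (fun m => ract m x) h1

theorem IsFull.baseLeft_toBase' (hc : c.IsFull) (a : A) :
    c.baseLeft hr (toBase' hr a) = c.leftAct a :=
  hc.baseLeft_eq hr rfl

/-- A full comodule as a bimodule over the base algebra. -/
def IsFull.bimod (hc : c.IsFull) : BimoduleStr k H.Base V where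
  left := c.baseLeft hr
  right := c.baseRight
  left_mul r s v := by
    obtain ⟨a, ha⟩ := H.exists_piR hr r
    obtain ⟨b, hb⟩ := H.exists_piR hr s
    rw [hc.baseLeft_eq hr ha, hc.baseLeft_eq hr hb, leftAct_leftAct, ← hc.baseLeft_eq hr]
    rw [← H.piR_mul, ha, hb, H.baseIncl_mul]
  right_mul r s v := by
    obtain ⟨a, rfl⟩ := H.toBase_surjective r
    obtain ⟨b, rfl⟩ := H.toBase_surjective s
    rw [H.toBase_mul, hc.baseRight_toBase, hc.baseRight_toBase, hc.baseRight_toBase,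
      rightAct_rightAct]
  left_right r s v := by
    obtain ⟨a, ha⟩ := H.exists_piR hr r
    obtain ⟨b, rfl⟩ := H.toBase_surjective s
    rw [hc.baseLeft_eq hr ha, hc.baseRight_toBase, rightAct_leftAct]

theorem IsFull.bimod_right_surjective (hc : c.IsFull) :
    Function.Surjective (TensorProduct.lift (hc.bimod hr).right.flip) := by
  intro v
  obtain ⟨t, rfl⟩ := c.rightAct_surjective hc v
  refine ⟨TensorProduct.comm k _ _ (H.toBase.rTensor V t), ?_⟩
  induction t with
  | zero => simp
  | add x y hx hy => simp only [map_add, hx, hy]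
  | tmul a v => exact LinearMap.congr_fun (hc.baseRight_toBase a) v

theorem IsFull.bimod_left_surjective (hc : c.IsFull) :
    Function.Surjective (TensorProduct.lift (hc.bimod hr).left) := by
  intro v
  obtain ⟨t, rfl⟩ := c.leftAct_surjective hc v
  refine ⟨(toBase' hr).rTensor V t, ?_⟩
  induction t with
  | zero => simp
  | add x y hx hy => simp only [map_add, hx, hy]
  | tmul a v => exact LinearMap.congr_fun (hc.baseLeft_toBase' hr a) v

theorem IsFull.bimod_isFirm (hc : c.IsFull) : (hc.bimod hr).IsFirm where
  left := BimoduleStr.leftMap_bijective _ H.mul'_baseSplit H.mulLeft_baseSplit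
    (H.base_left_nondeg hr) (hc.bimod_left_surjective hr)
  right := BimoduleStr.rightMap_bijective _ H.mul'_baseSplit H.mulLeft_baseSplit
    H.base_right_nondeg (hc.bimod_right_surjective hr)

end RightComod

/-- The actions of the base algebra on the full comodules. -/
def baseActions {k : Type u} [Field k] {A : Type v} [NonUnitalRing A] [Module k A]
    [IsScalarTower k A A] [SMulCommClass k A A] (H : RegularWeakMultiplierBialgebra k A)
    (hr : LinearMap.range H.piR = LinearMap.range H.piBarR) : BaseActions H where
  range_eq := hr
  str V := V.full.bimod hr
  firm V := V.full.bimod_isFirm hr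
  right_eq V r a h v := LinearMap.congr_fun (V.full.baseRight_eq (r := r) h) v
  left_eq V r a h v := LinearMap.congr_fun (V.full.baseLeft_eq hr (r := r) h) v

end WeakMultiplier
end

/-! ### How the coactions interact with the base algebra. -/

noncomputable section

namespace WeakMultiplier

namespace RegularWeakMultiplierBialgebra

variable {k : Type*} [Field k] {A : Type*} [NonUnitalRing A] [Module k A]
  [IsScalarTower k A A] [SMulCommClass k A A] (H : RegularWeakMultiplierBialgebra k A)

/-- The action of the base algebra on `A` from the left. -/
def baseLact : H.Base →ₗ[k] A →ₗ[k] A where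
  toFun r := lact (H.baseIncl r)
  map_add' _ _ := rfl
  map_smul' _ _ := rfl

/-- The action of the base algebra on `A` from the right. -/
def baseRact : H.Base →ₗ[k] A →ₗ[k] A where
  toFun r := ract (H.baseIncl r)
  map_add' _ _ := rfl
  map_smul' _ _ := rfl

/-- Passing to the opposite exchanges `⊓ᴿ` and `⊓̄ᴿ` and interchanges left and right
multiplications. -/
theorem op_piR_eq_iff {x y : A} : H.op.piR (show Op A from x) = H.op.piBarR (show Op A from y) ↔
    H.piBarR x = H.piR y := by
  constructor
  · intro h
    refine multiplier_ext_lact H.left_nondeg H.right_nondeg fun z => ?_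
    exact congrArg (fun m : Multiplier k (Op A) => ract m (show Op A from z)) h
  · intro h
    refine multiplier_ext H.right_nondeg fun (z : A) => ?_
    exact congrArg (fun m : Multiplier k A => lact m z) h

theorem op_range_piR (hr : LinearMap.range H.piR = LinearMap.range H.piBarR) :
    LinearMap.range H.op.piR = LinearMap.range H.op.piBarR := by
  apply le_antisymm
  · rintro _ ⟨x, rfl⟩
    obtain ⟨y, hy⟩ := hr.ge ⟨(show A from x), rfl⟩
    exact ⟨(show Op A from y), (H.op_piR_eq_iff.2 hy.symm).symm⟩
  · rintro _ ⟨x, rfl⟩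
    obtain ⟨y, hy⟩ := hr.le ⟨(show A from x), rfl⟩
    exact ⟨(show Op A from y), H.op_piR_eq_iff.2 hy⟩

/-- `(R ⊗ ε)(E (1 ⊗ a)) = ⊓̄ᴿ(a)`. -/
theorem sliceRight_baseL (a : A) : sliceRight H.Base H.counit (H.baseL a) = H.toBase a :=
  H.base_ext fun b => by
    change (lactAt b ∘ₗ H.baseIncl) (sliceRight H.Base H.counit (H.baseL a)) = _
    rw [map_sliceRight, lactAt_baseL]
    rfl

end RegularWeakMultiplierBialgebra

namespace RightComod

open FirmBimodules RegularWeakMultiplierBialgebra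

variable {k : Type*} [Field k] {A : Type*} [NonUnitalRing A] [Module k A]
  [IsScalarTower k A A] [SMulCommClass k A A] {H : RegularWeakMultiplierBialgebra k A}
  {V : Type*} [AddCommGroup V] [Module k V] (c : RightComod H V)

/-- `ρ((a ▷ v) ⊗ b) = ρ(v ⊗ b ⊓ᴿ(a))`. -/
theorem rho_leftAct (a b : A) (v : V) :
    c.rho (c.leftAct a v ⊗ₜ b) = c.rho (v ⊗ₜ ract (H.piR a) b) :=
  c.op.lam_rightAct (show Op A from a) (show Op A from b) v

theorem lam_leftAct (a b : A) (v : V) :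
    c.lam (c.leftAct a v ⊗ₜ b) = (lact (H.piR a)).lTensor V (c.lam (v ⊗ₜ b)) := by
  refine cancel_mulL₂ H.left_nondeg fun x => ?_
  have h : ∀ t : V ⊗[k] A, mulL₂ V x ((lact (H.piR a)).lTensor V t) =
      mulL₂ V (ract (H.piR a) x) t := by
    intro t
    induction t with
    | zero => simp
    | add x y hx hy => simp only [map_add, hx, hy]
    | tmul w z => simp [mul_lact]
  rw [c.compat, rho_leftAct, ← c.compat, h]

theorem rho_rightAct (a b : A) (v : V) :
    c.rho (c.rightAct a v ⊗ₜ b) = (ract (H.piBarR a)).lTensor V (c.rho (v ⊗ₜ b)) :=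
  c.op.lam_leftAct (show Op A from a) (show Op A from b) v

variable {c} (hr : LinearMap.range H.piR = LinearMap.range H.piBarR)

/-- Fullness is not needed here, since `baseRight` is defined through a fixed section of `⊓̄ᴿ`. This
and the next three rules make the coactions on `V ⊗ W` balanced over `R`. -/
theorem lam_baseRight (r : H.Base) (b : A) (v : V) :
    c.lam (c.baseRight r v ⊗ₜ b) = c.lam (v ⊗ₜ lact (H.baseIncl r) b) := by
  refine (c.lam_rightAct (H.baseSection r) b v).trans ?_
  conv_rhs => rw [← H.toBase_baseSection r]
  rfl

theorem rho_baseRight (r : H.Base) (b : A) (v : V) :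
    c.rho (c.baseRight r v ⊗ₜ b) = (ract (H.baseIncl r)).lTensor V (c.rho (v ⊗ₜ b)) := by
  refine (c.rho_rightAct (H.baseSection r) b v).trans ?_
  conv_rhs => rw [← H.toBase_baseSection r]
  rfl

theorem lam_baseLeft (r : H.Base) (b : A) (v : V) :
    c.lam (c.baseLeft hr r v ⊗ₜ b) = (lact (H.baseIncl r)).lTensor V (c.lam (v ⊗ₜ b)) := by
  refine (c.lam_leftAct (H.baseSection' hr r) b v).trans ?_
  conv_rhs => rw [← H.toBase'_baseSection' hr r]
  rfl

theorem rho_baseLeft (r : H.Base) (b : A) (v : V) :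
    c.rho (c.baseLeft hr r v ⊗ₜ b) = c.rho (v ⊗ₜ ract (H.baseIncl r) b) := by
  refine (c.rho_leftAct (H.baseSection' hr r) b v).trans ?_
  conv_rhs => rw [← H.toBase'_baseSection' hr r]
  rfl

variable (c) in
/-- The map `r ⊗ b ↦ v₀ r ⊗ v₁ b`. -/
def lamBaseRight (v : V) : H.Base ⊗[k] A →ₗ[k] V ⊗[k] A :=
  TensorProduct.lift ((LinearMap.llcomp k A (V ⊗[k] A) (V ⊗[k] A)).flip (c.lam ∘ₗ tmulLeft A v) ∘ₗ
    LinearMap.rTensorHom A ∘ₗ c.baseRight)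

@[simp] theorem lamBaseRight_tmul (v : V) (r : H.Base) (b : A) :
    c.lamBaseRight v (r ⊗ₜ b) = (c.baseRight r).rTensor A (c.lam (v ⊗ₜ b)) := rfl

/-- `v₀ rᵢ ⊗ v₁ bᵢ = λ(v ⊗ b)` for `E (1 ⊗ b) = ∑ rᵢ ⊗ bᵢ`. -/
theorem IsFull.lamBaseRight_baseL (hc : c.IsFull) (v : V) (b : A) :
    c.lamBaseRight v (H.baseL b) = c.lam (v ⊗ₜ b) := by
  -- For `b = p q` one has `E (1 ⊗ b) = ⊓̄ᴿ(p₁) ⊗ p₂ q`, and the sum is collected into `λ(v ⊗ ⊓ᴸ(p₁)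
  -- p₂ q)`. Here `⊓ᴸ(p₁) p₂ q = p q` because `E` fixes `T₁(p ⊗ q)`.
  have h1 : ∀ t : A ⊗[k] A, c.lamBaseRight v (H.toBase.rTensor A t) =
      c.lam (v ⊗ₜ sliceLeft A H.counit (H.E₁ t)) := by
    intro t
    induction t with
    | zero => simp
    | add x y hx hy => simp only [map_add, TensorProduct.tmul_add, hx, hy]
    | tmul p q =>
      rw [LinearMap.rTensor_tmul, lamBaseRight_tmul, hc.baseRight_toBase, rTensor_rightAct_lam]
      rfl
  induction b using H.mul_induction with
  | h0 p q => rw [H.baseL_mul, h1, H.E₁_T₁_apply, H.counit_T₁_apply]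
  | h1 a b ha hb => rw [map_add, map_add, ha, hb, TensorProduct.tmul_add, map_add]

/-- Each product `v s` with `s` in `R` is a slice of some `λ(v ⊗ b)`, and by `eq_zero_of_right` the
elements of `R` together detect `v`. Hence the maps `λ( · ⊗ b)` are jointly injective. -/
theorem IsFull.eq_zero_of_lam (hr : LinearMap.range H.piR = LinearMap.range H.piBarR)
    (hc : c.IsFull) {v : V} (hv : ∀ b, c.lam (v ⊗ₜ b) = 0) : v = 0 := by
  refine BimoduleStr.eq_zero_of_right (hc.bimod hr) H.mul'_baseSplit H.mulLeft_baseSplit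
    H.base_right_nondeg (hc.bimod_right_surjective hr) fun s => ?_
  change sliceRight V H.counit (c.lam (v ⊗ₜ _)) = 0
  rw [hv, map_zero]

variable (c) in
/-- The map `w ⊗ y ↦ ∑ rᵢ w ⊗ yᵢ` for `E (1 ⊗ y) = ∑ rᵢ ⊗ yᵢ`. -/
def baseLeftE : V ⊗[k] A →ₗ[k] V ⊗[k] A :=
  TensorProduct.lift ((LinearMap.llcomp k A (H.Base ⊗[k] A) (V ⊗[k] A)).flip H.baseL ∘ₗ
    LinearMap.rTensorHom A ∘ₗ (c.baseLeft hr).flip)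

@[simp] theorem baseLeftE_tmul (w : V) (y : A) :
    c.baseLeftE hr (w ⊗ₜ y) = ((c.baseLeft hr).flip w).rTensor A (H.baseL y) := rfl

/-- As `λ(r w ⊗ b) = (1 ⊗ r) λ(w ⊗ b)`, applying `λ( · ⊗ b)` to the first leg turns the action of
`E` through `R` on `V` into `E` itself on two legs in `A`. -/
theorem rTensor_lamAt_baseLeftE (b : A) (t : V ⊗[k] A) :
    TensorProduct.assoc k V A A ((c.lamAt b).rTensor A (c.baseLeftE hr t)) =
      H.E₁.lTensor V (TensorProduct.assoc k V A A ((c.lamAt b).rTensor A t)) := by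
  induction t with
  | zero => simp
  | add x y hx hy => simp only [map_add, hx, hy]
  | tmul w y =>
    have h1 : c.lamAt b ∘ₗ (c.baseLeft hr).flip w =
        (LinearMap.lTensorHom V ∘ₗ H.baseLact).flip (c.lam (w ⊗ₜ b)) :=
      LinearMap.ext fun r => lam_baseLeft hr r b w
    rw [baseLeftE_tmul, ← LinearMap.rTensor_comp_apply, h1, LinearMap.rTensor_tmul, lamAt_apply]
    generalize c.lam (w ⊗ₜ b) = s
    induction s with
    | zero => simp
    | add x y hx hy =>
      simp only [map_add, TensorProduct.add_tmul, LinearMap.rTensor_add, LinearMap.add_apply, hx,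
        hy]
    | tmul v z =>
      rw [TensorProduct.assoc_tmul, LinearMap.lTensor_tmul, ← H.lactAt_baseL]
      generalize H.baseL y = u
      induction u with
      | zero => simp
      | add x y hx hy => simp only [map_add, TensorProduct.tmul_add, hx, hy]
      | tmul r q => rfl

/-- `E λ(v ⊗ a) = λ(v ⊗ a)`. -/
theorem IsFull.baseLeftE_lam (hc : c.IsFull) (v : V) (a : A) :
    c.baseLeftE hr (c.lam (v ⊗ₜ a)) = c.lam (v ⊗ₜ a) := by
  rw [← sub_eq_zero]
  -- The jointly injective maps `λ( · ⊗ b)` on the first leg reduce the claim to the invariance of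
  -- the iterated coaction under `E`.
  refine rTensor_joint c.lamAt (fun w hw => IsFull.eq_zero_of_lam hr hc hw) _ fun b => ?_
  apply (TensorProduct.assoc k V A A).injective
  rw [map_sub, map_sub, rTensor_lamAt_baseLeftE, ← c.lam₂_tmul, c.lTensor_E₁_lam₂, sub_self,
    map_zero]

/-- Apply `V ⊗ ε` to `baseLeftE_lam`, where `(R ⊗ ε)(E (1 ⊗ y)) = ⊓̄ᴿ(y)`. Any lift `g` with `⊓ᴿ(g
y) = ⊓̄ᴿ(y)` is allowed, so that the lemma also serves the opposite, where the lift is built from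
the other section. -/
theorem IsFull.leftAct_lam (hr : LinearMap.range H.piR = LinearMap.range H.piBarR)
    (hc : c.IsFull) {g : A →ₗ[k] A} (hg : ∀ y, H.piR (g y) = H.piBarR y) (v : V) (a : A) :
    TensorProduct.lift (c.leftAct ∘ₗ g) (TensorProduct.comm k V A (c.lam (v ⊗ₜ a))) =
      c.rightAct a v := by
  have h1 : ∀ t : V ⊗[k] A, sliceRight V H.counit (c.baseLeftE hr t) =
      TensorProduct.lift (c.leftAct ∘ₗ g) (TensorProduct.comm k V A t) := by
    intro t
    induction t with
    | zero => simp
    | add x y hx hy => simp only [map_add, hx, hy]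
    | tmul w y =>
      rw [baseLeftE_tmul, ← map_sliceRight, H.sliceRight_baseL]
      exact LinearMap.congr_fun (hc.baseLeft_eq hr ((hg y).trans (H.toBase_coe y).symm)) w
  rw [← h1, hc.baseLeftE_lam hr]
  rfl

/-- `∑ r_{y} w = v ⊓̄ᴿ(a)` for `λ(v ⊗ a) = ∑ w ⊗ y` and `r_y = ⊓̄ᴿ(y)`. -/
theorem IsFull.baseLeft_lam (hc : c.IsFull) (v : V) (a : A) :
    TensorProduct.lift (c.baseLeft hr ∘ₗ H.toBase) (TensorProduct.comm k V A (c.lam (v ⊗ₜ a))) =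
      c.rightAct a v :=
  hc.leftAct_lam hr (g := H.baseSection' hr ∘ₗ H.toBase) (fun y => by
    rw [LinearMap.comp_apply, ← H.baseIncl_toBase' hr, H.toBase'_baseSection', H.toBase_coe]) v a

/-- `∑ w r_y = ⊓ᴿ(a) v` for `ρ(v ⊗ a) = ∑ w ⊗ y` and `r_y = ⊓ᴿ(y)`. -/
theorem IsFull.baseRight_rho (hc : c.IsFull) (v : V) (a : A) :
    TensorProduct.lift (c.baseRight ∘ₗ toBase' hr) (TensorProduct.comm k V A (c.rho (v ⊗ₜ a))) =
      c.leftAct a v := by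
  have hg : ∀ y : A, H.piBarR (H.baseSection (toBase' hr y)) = H.piR y := fun y => by
    rw [← H.toBase_coe, H.toBase_baseSection, H.baseIncl_toBase']
  exact hc.op.leftAct_lam (H.op_range_piR hr) (g := (H.baseSection ∘ₗ toBase' hr : A →ₗ[k] A))
    (fun (y : A) => H.op_piR_eq_iff.2 (hg y)) v a

end RightComod

end WeakMultiplier
end

/-! ### The comodule `V ⊗ W`. -/

noncomputable section

namespace WeakMultiplier

namespace RightComod

open FirmBimodules RegularWeakMultiplierBialgebra

variable {k : Type*} [Field k] {A : Type*} [NonUnitalRing A] [Module k A]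
  [IsScalarTower k A A] [SMulCommClass k A A] {H : RegularWeakMultiplierBialgebra k A}
  {V W P : Type*} [AddCommGroup V] [Module k V] [AddCommGroup W] [Module k W]
  [AddCommGroup P] [Module k P] (c : RightComod H V) (d : RightComod H W)

/-- The map `w ⊗ y ↦ λ_V(v ⊗ y)¹³ (1 ⊗ w ⊗ 1)`. -/
def prodLamAux : V →ₗ[k] W ⊗[k] A →ₗ[k] (V ⊗[k] W) ⊗[k] A :=
  TensorProduct.curry ((TensorProduct.assoc k V W A).symm.toLinearMap ∘ₗ leg13 c.lam W)

theorem prodLamAux_tmul (v : V) (w : W) (y : A) : c.prodLamAux v (w ⊗ₜ y) =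
    (tmulRight (k := k) V w).rTensor A (c.lam (v ⊗ₜ y)) := by
  change (TensorProduct.assoc k V W A).symm ((TensorProduct.comm k A W).toLinearMap.lTensor V
    (TensorProduct.assoc k V A W (c.lam (v ⊗ₜ y) ⊗ₜ w))) = _
  generalize c.lam (v ⊗ₜ y) = t
  induction t with
  | zero => simp
  | add x y hx hy => simp only [map_add, TensorProduct.add_tmul, hx, hy]
  | tmul p q => simp

theorem prodLam_tmul (v : V) (w : W) (a : A) :
    prodLam c d ((v ⊗ₜ w) ⊗ₜ a) = c.prodLamAux v (d.lam (w ⊗ₜ a)) := rfl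

/-- The map `v ⊗ y ↦ v ⊗ ρ_W(w ⊗ y)`. -/
def prodRhoAux (w : W) : V ⊗[k] A →ₗ[k] (V ⊗[k] W) ⊗[k] A :=
  (TensorProduct.assoc k V W A).symm.toLinearMap ∘ₗ (d.rho ∘ₗ tmulLeft A w).lTensor V

theorem prodRhoAux_tmul (v : V) (w : W) (y : A) : d.prodRhoAux w (v ⊗ₜ[k] y) =
    (tmulLeft (k := k) W v).rTensor A (d.rho (w ⊗ₜ y)) := by
  simp only [prodRhoAux, LinearMap.comp_apply, LinearMap.lTensor_tmul, LinearEquiv.coe_coe,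
    TensorProduct.mk_apply]
  generalize d.rho (w ⊗ₜ y) = t
  induction t with
  | zero => simp
  | add x y hx hy => simp only [map_add, TensorProduct.tmul_add, hx, hy]
  | tmul p q => simp

theorem prodRho_tmul (v : V) (w : W) (a : A) :
    prodRho c d ((v ⊗ₜ w) ⊗ₜ a) = d.prodRhoAux w (c.rho (v ⊗ₜ a)) := by
  change (TensorProduct.assoc k V W A).symm (d.rho.lTensor V
    ((TensorProduct.comm k A W).toLinearMap.lTensor V
      (TensorProduct.assoc k V A W (c.rho (v ⊗ₜ a) ⊗ₜ w)))) = _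
  generalize c.rho (v ⊗ₜ a) = t
  induction t with
  | zero => simp
  | add x y hx hy => simp only [map_add, TensorProduct.add_tmul, hx, hy]
  | tmul p q => simp [prodRhoAux]

/-- The map `w ⊗ t ↦ ((λ_V ⊗ A) λ_V¹³)(v ⊗ t)` with `w` put in the second place. -/
def prodLamAux₂ (v : V) : W ⊗[k] (A ⊗[k] A) →ₗ[k] (V ⊗[k] W) ⊗[k] (A ⊗[k] A) :=
  TensorProduct.lift ((LinearMap.llcomp k (A ⊗[k] A) (V ⊗[k] (A ⊗[k] A))
      ((V ⊗[k] W) ⊗[k] (A ⊗[k] A))).flip (c.lam₂ ∘ₗ tmulLeft (A ⊗[k] A) v) ∘ₗ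
    LinearMap.rTensorHom (A ⊗[k] A) ∘ₗ (TensorProduct.mk k V W).flip)

theorem prodLamAux₂_tmul (v : V) (w : W) (t : A ⊗[k] A) : c.prodLamAux₂ v (w ⊗ₜ t) =
    (tmulRight (k := k) V w).rTensor (A ⊗[k] A) (c.lam₂ (v ⊗ₜ t)) := rfl

theorem assoc_prodLamAux (v : V) (s : W ⊗[k] A) (y : A) :
    TensorProduct.assoc k (V ⊗[k] W) A A
      ((c.prodLamAux.flip s).rTensor A (c.lam (v ⊗ₜ y))) =
        c.prodLamAux₂ v (TensorProduct.assoc k W A A (s ⊗ₜ y)) := by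
  induction s with
  | zero => simp
  | add x y hx hy =>
    simp only [map_add, TensorProduct.add_tmul, LinearMap.rTensor_add, LinearMap.add_apply, hx, hy]
  | tmul w x =>
    have h1 : c.prodLamAux.flip (w ⊗ₜ x) = (tmulRight (k := k) V w).rTensor A ∘ₗ c.lamAt x :=
      LinearMap.ext fun u => c.prodLamAux_tmul u w x
    rw [h1, TensorProduct.assoc_tmul, prodLamAux₂_tmul, lam₂_tmul]
    generalize c.lam (v ⊗ₜ y) = t
    induction t with
    | zero => simp
    | add x y hx hy => simp only [map_add, hx, hy]
    | tmul p q =>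
      simp only [LinearMap.rTensor_tmul, LinearMap.comp_apply]
      generalize c.lamAt x p = u
      induction u with
      | zero => simp
      | add x y hx hy => simp only [map_add, TensorProduct.add_tmul, hx, hy]
      | tmul p q => simp

/-- The iterated coaction of `V ⊗ W` is that of `W` followed by that of `V`. So `norm` for the
product only needs `norm` for `W`, and coassociativity follows one factor at a time. -/
theorem prodLam₂ (v : V) (w : W) (t : A ⊗[k] A) :
    leg12 (prodLam c d) A (leg13 (prodLam c d) A ((v ⊗ₜ w) ⊗ₜ t)) =
      c.prodLamAux₂ v (d.lam₂ (w ⊗ₜ t)) := by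
  induction t with
  | zero => simp
  | add x y hx hy => simp only [map_add, TensorProduct.tmul_add, hx, hy]
  | tmul a b =>
    rw [leg12_leg13_tmul, prodLam_tmul, lam₂_tmul]
    generalize d.lam (w ⊗ₜ b) = t
    induction t with
    | zero => simp
    | add x y hx hy => simp only [map_add, hx, hy]
    | tmul w y =>
      rw [prodLamAux_tmul, LinearMap.rTensor_tmul, lamAt_apply, ← assoc_prodLamAux,
        ← LinearMap.rTensor_comp_apply]
      rfl

theorem mulL₂_prodLamAux (v : V) (a : A) (s : W ⊗[k] A) :
    mulL₂ (V ⊗[k] W) a (c.prodLamAux v s) = ((TensorProduct.assoc k V W A).symm.toLinearMap ∘ₗ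
      ((LinearMap.lTensorHom W ∘ₗ LinearMap.mul k A).flip s).lTensor V) (c.rho (v ⊗ₜ a)) := by
  induction s with
  | zero => simp
  | add x y hx hy =>
    simp only [map_add, LinearMap.lTensor_add, LinearMap.add_apply, LinearMap.comp_add, hx, hy]
  | tmul w y =>
    rw [prodLamAux_tmul, ← rTensor_mulL₂, c.compat]
    generalize c.rho (v ⊗ₜ a) = t
    induction t with
    | zero => simp
    | add x y hx hy => simp only [map_add, hx, hy]
    | tmul p q => rfl

/-- The comodule `V ⊗ W`. -/
def prod : RightComod H (V ⊗[k] W) where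
  lam := prodLam c d
  rho := prodRho c d
  compat t a b := by
    induction t with
    | zero => simp
    | add x y hx hy => simp only [TensorProduct.add_tmul, map_add, hx, hy]
    | tmul v w =>
      rw [prodLam_tmul, prodRho_tmul, mulL₂_prodLamAux]
      generalize c.rho (v ⊗ₜ a) = t
      induction t with
      | zero => simp
      | add x y hx hy => simp only [map_add, hx, hy]
      | tmul v x =>
        have h : d.prodRhoAux w (v ⊗ₜ x) = (TensorProduct.assoc k V W A).symm
          (v ⊗ₜ d.rho (w ⊗ₜ x)) := rfl
        rw [LinearMap.comp_apply, LinearMap.lTensor_tmul, h]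
        change (TensorProduct.assoc k V W A).symm (v ⊗ₜ mulL₂ W x (d.lam (w ⊗ₜ b))) = _
        rw [d.compat]
        generalize d.rho (w ⊗ₜ x) = u
        induction u with
        | zero => simp
        | add x y hx hy => simp only [map_add, TensorProduct.tmul_add, hx, hy]
        | tmul p q => simp
  norm := by
    refine TensorProduct.ext_threefold fun v w t => ?_
    rw [LinearMap.comp_apply, LinearMap.comp_apply, LinearMap.lTensor_tmul, prodLam₂, lam₂_E₁,
      ← prodLam₂]
    rfl
  coassoc := by
    refine TensorProduct.ext' fun x t => ?_
    induction x with
    | zero => simp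
    | add x y hx hy => simp only [TensorProduct.add_tmul, map_add, hx, hy]
    | tmul v w =>
    induction t with
    | zero => simp
    | add x y hx hy => simp only [TensorProduct.tmul_add, map_add, hx, hy]
    | tmul a b =>
      have h := LinearMap.congr_fun d.coassoc (w ⊗ₜ (a ⊗ₜ b))
      have h' : ∀ y, c.lam₂ (v ⊗ₜ H.T₁ (y ⊗ₜ b)) = H.T₁.lTensor V
          (TensorProduct.assoc k V A A (c.lam (v ⊗ₜ y) ⊗ₜ b)) := fun y =>
        LinearMap.congr_fun c.coassoc (v ⊗ₜ (y ⊗ₜ b))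
      simp only [LinearMap.comp_apply, LinearMap.lTensor_tmul, leg12_tmul] at h
      rw [LinearMap.comp_apply, LinearMap.comp_apply, LinearMap.lTensor_tmul, prodLam₂, lam₂,
        LinearMap.comp_apply, h, LinearMap.comp_apply, leg12_tmul, prodLam_tmul]
      generalize d.lam (w ⊗ₜ a) = s
      induction s with
      | zero => simp
      | add x y hx hy => simp only [TensorProduct.add_tmul, map_add, hx, hy]
      | tmul w y =>
        rw [prodLamAux_tmul, TensorProduct.assoc_tmul, LinearMap.lTensor_tmul, prodLamAux₂_tmul,
          h']
        generalize c.lam (v ⊗ₜ y) = s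
        induction s with
        | zero => simp
        | add x y hx hy => simp only [TensorProduct.add_tmul, map_add, hx, hy]
        | tmul v z =>
          simp only [LinearMap.rTensor_tmul, TensorProduct.assoc_tmul, LinearMap.lTensor_tmul]

end RightComod

end WeakMultiplier
end

/-! ### The comodule `V ⊗_R W` and its underlying bimodule. -/

noncomputable section

namespace FirmBimodules

namespace RelTensor

variable {k : Type*} [Field k] {R M N P Q : Type*} [AddCommGroup R] [Module k R]
  [AddCommGroup M] [Module k M] [AddCommGroup N] [Module k N] [AddCommGroup P] [Module k P]
  [AddCommGroup Q] [Module k Q] {ρ : R →ₗ[k] M →ₗ[k] M} {l : R →ₗ[k] N →ₗ[k] N}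

/-- The universal property of `M ⊗_R N ⊗ P`. -/
def liftTensor (f : (M ⊗[k] N) ⊗[k] P →ₗ[k] Q)
    (h : ∀ m r n p, f ((ρ r m ⊗ₜ n) ⊗ₜ p) = f ((m ⊗ₜ l r n) ⊗ₜ p)) :
    RelTensor ρ l ⊗[k] P →ₗ[k] Q :=
  TensorProduct.lift (lift (TensorProduct.curry f) fun m r n => LinearMap.ext (h m r n))

theorem liftTensor_proj (f : (M ⊗[k] N) ⊗[k] P →ₗ[k] Q)
    (h : ∀ m r n p, f ((ρ r m ⊗ₜ n) ⊗ₜ p) = f ((m ⊗ₜ l r n) ⊗ₜ p)) (x : M ⊗[k] N) (p : P) :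
    liftTensor f h (proj ρ l x ⊗ₜ p) = f (x ⊗ₜ p) := by
  rw [liftTensor, TensorProduct.lift.tmul, lift_proj]
  rfl

end RelTensor

end FirmBimodules

namespace WeakMultiplier

namespace RightComod

open FirmBimodules RegularWeakMultiplierBialgebra

variable {k : Type*} [Field k] {A : Type*} [NonUnitalRing A] [Module k A]
  [IsScalarTower k A A] [SMulCommClass k A A] {H : RegularWeakMultiplierBialgebra k A}
  {V W P : Type*} [AddCommGroup V] [Module k V] [AddCommGroup W] [Module k W]
  [AddCommGroup P] [Module k P]

theorem leg12_leg13_map (c : RightComod H V) (p : V →ₗ[k] P) {lam : P ⊗[k] A →ₗ[k] P ⊗[k] A}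
    (hl : lam ∘ₗ p.rTensor A = p.rTensor A ∘ₗ c.lam) (v : V) (t : A ⊗[k] A) :
    leg12 lam A (leg13 lam A (p v ⊗ₜ t)) = p.rTensor (A ⊗[k] A) (c.lam₂ (v ⊗ₜ t)) := by
  have hl' : ∀ s, lam (p.rTensor A s) = p.rTensor A (c.lam s) := LinearMap.congr_fun hl
  induction t with
  | zero => simp
  | add x y hx hy => simp only [map_add, TensorProduct.tmul_add, hx, hy]
  | tmul a b =>
    have h1 := hl' (v ⊗ₜ b)
    rw [LinearMap.rTensor_tmul] at h1
    rw [leg12_leg13_tmul, h1, lam₂_tmul]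
    generalize c.lam (v ⊗ₜ b) = t
    induction t with
    | zero => simp
    | add x y hx hy => simp only [map_add, hx, hy]
    | tmul v b =>
      have h2 := hl' (v ⊗ₜ a)
      rw [LinearMap.rTensor_tmul] at h2
      simp only [LinearMap.rTensor_tmul, LinearMap.comp_apply, lamAt_apply, h2,
        TensorProduct.mk_apply, LinearMap.flip_apply]
      generalize c.lam (v ⊗ₜ a) = t
      induction t with
      | zero => simp
      | add x y hx hy => simp only [map_add, TensorProduct.add_tmul, hx, hy]
      | tmul v a => simp

/-- The comodule structure induced along an epimorphism. -/
def ofSurjective (c : RightComod H V) (p : V →ₗ[k] P) (hp : Function.Surjective p)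
    (lam rho : P ⊗[k] A →ₗ[k] P ⊗[k] A)
    (hl : lam ∘ₗ p.rTensor A = p.rTensor A ∘ₗ c.lam)
    (hl' : rho ∘ₗ p.rTensor A = p.rTensor A ∘ₗ c.rho) : RightComod H P where
  lam := lam
  rho := rho
  compat x a b := by
    obtain ⟨v, rfl⟩ := hp x
    have h1 : lam (p v ⊗ₜ b) = p.rTensor A (c.lam (v ⊗ₜ b)) := LinearMap.congr_fun hl (v ⊗ₜ b)
    have h2 : rho (p v ⊗ₜ a) = p.rTensor A (c.rho (v ⊗ₜ a)) := LinearMap.congr_fun hl' (v ⊗ₜ a)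
    rw [h1, h2, ← rTensor_mulL₂, c.compat, rTensor_mulR₂]
  norm := by
    refine TensorProduct.ext' fun x t => ?_
    obtain ⟨v, rfl⟩ := hp x
    rw [LinearMap.comp_apply, LinearMap.comp_apply, LinearMap.lTensor_tmul,
      leg12_leg13_map c p hl, lam₂_E₁, ← leg12_leg13_map c p hl]
    rfl
  coassoc := by
    refine TensorProduct.ext_threefold' fun x a b => ?_
    obtain ⟨v, rfl⟩ := hp x
    have h1 : lam (p v ⊗ₜ a) = p.rTensor A (c.lam (v ⊗ₜ a)) := LinearMap.congr_fun hl (v ⊗ₜ a)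
    have h2 := LinearMap.congr_fun c.coassoc (v ⊗ₜ (a ⊗ₜ b))
    change c.lam₂ (v ⊗ₜ H.T₁ (a ⊗ₜ b)) =
      H.T₁.lTensor V (TensorProduct.assoc k V A A (c.lam (v ⊗ₜ a) ⊗ₜ b)) at h2
    rw [LinearMap.comp_apply, LinearMap.comp_apply, LinearMap.lTensor_tmul,
      leg12_leg13_map c p hl, h2, LinearMap.comp_apply, leg12_tmul, h1, rTensor_lTensor]
    congr 1
    generalize c.lam (v ⊗ₜ a) = t
    induction t with
    | zero => simp
    | add x y hx hy => simp only [map_add, TensorProduct.add_tmul, hx, hy]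
    | tmul v a => simp

variable (hr : LinearMap.range H.piR = LinearMap.range H.piBarR)
  {c : RightComod H V} {d : RightComod H W}

theorem prodLamAux_baseRight (r : H.Base) (v : V) (s : W ⊗[k] A) :
    c.prodLamAux (c.baseRight r v) s = c.prodLamAux v ((lact (H.baseIncl r)).lTensor W s) := by
  induction s with
  | zero => simp
  | add x y hx hy => simp only [map_add, hx, hy]
  | tmul w y => rw [prodLamAux_tmul, lam_baseRight, LinearMap.lTensor_tmul, prodLamAux_tmul]

/-- `λ_V(v r ⊗ y) = λ_V(v ⊗ r y)` and `λ_W(r w ⊗ a) = (1 ⊗ r) λ_W(w ⊗ a)`: in both cases `r` is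
inserted between `v₁` and `w₁`. -/
theorem prodLam_balanced (v : V) (r : H.Base) (w : W) (a : A) :
    prodLam c d ((c.baseRight r v ⊗ₜ w) ⊗ₜ a) = prodLam c d ((v ⊗ₜ d.baseLeft hr r w) ⊗ₜ a) := by
  rw [prodLam_tmul, prodLam_tmul, prodLamAux_baseRight, lam_baseLeft]

theorem prodRhoAux_baseLeft (r : H.Base) (w : W) (s : V ⊗[k] A) :
    d.prodRhoAux (d.baseLeft hr r w) s = d.prodRhoAux w ((ract (H.baseIncl r)).lTensor V s) := by
  induction s with
  | zero => simp
  | add x y hx hy => simp only [map_add, hx, hy]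
  | tmul v y => rw [prodRhoAux_tmul, rho_baseLeft, LinearMap.lTensor_tmul, prodRhoAux_tmul]

theorem prodRho_balanced (v : V) (r : H.Base) (w : W) (a : A) :
    prodRho c d ((c.baseRight r v ⊗ₜ w) ⊗ₜ a) = prodRho c d ((v ⊗ₜ d.baseLeft hr r w) ⊗ₜ a) := by
  rw [prodRho_tmul, prodRho_tmul, prodRhoAux_baseLeft, rho_baseRight]

/-- The map on `V ⊗_R W ⊗ A` induced by a balanced map on `V ⊗ W ⊗ A`. -/
def descend (f : (V ⊗[k] W) ⊗[k] A →ₗ[k] (V ⊗[k] W) ⊗[k] A)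
    (hf : ∀ v r w a, f ((c.baseRight r v ⊗ₜ w) ⊗ₜ a) = f ((v ⊗ₜ d.baseLeft hr r w) ⊗ₜ a)) :
    RelTensor c.baseRight (d.baseLeft hr) ⊗[k] A →ₗ[k]
      RelTensor c.baseRight (d.baseLeft hr) ⊗[k] A :=
  RelTensor.liftTensor ((RelTensor.proj c.baseRight (d.baseLeft hr)).rTensor A ∘ₗ f)
    (fun v r w a => congrArg ((RelTensor.proj c.baseRight (d.baseLeft hr)).rTensor A) (hf v r w a))

theorem descend_comp (f : (V ⊗[k] W) ⊗[k] A →ₗ[k] (V ⊗[k] W) ⊗[k] A)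
    (hf : ∀ v r w a, f ((c.baseRight r v ⊗ₜ w) ⊗ₜ a) = f ((v ⊗ₜ d.baseLeft hr r w) ⊗ₜ a)) :
    descend hr f hf ∘ₗ (RelTensor.proj c.baseRight (d.baseLeft hr)).rTensor A =
      (RelTensor.proj c.baseRight (d.baseLeft hr)).rTensor A ∘ₗ f :=
  TensorProduct.ext' fun x a => by
    rw [LinearMap.comp_apply, LinearMap.rTensor_tmul, descend, RelTensor.liftTensor_proj]

variable (c d) in
/-- The comodule `V ⊗_R W`. -/
def relProd : RightComod H (RelTensor c.baseRight (d.baseLeft hr)) :=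
  (c.prod d).ofSurjective (RelTensor.proj _ _) RelTensor.proj_surjective
    (descend hr (prodLam c d) (prodLam_balanced hr)) (descend hr (prodRho c d) (prodRho_balanced hr))
    (descend_comp hr _ (prodLam_balanced hr)) (descend_comp hr _ (prodRho_balanced hr))

theorem isInduced_relProd : IsInduced c d (RelTensor.proj _ _) (relProd hr c d) :=
  ⟨descend_comp hr _ (prodLam_balanced hr), descend_comp hr _ (prodRho_balanced hr)⟩

/-- If `λ_W(w ⊗ a) = ∑ w' ⊗ y`, the left side is `∑ (v ◁ y) ⊗ w' = ∑ v ⊗ ⊓̄ᴿ(y) w'` in `V ⊗_R W`,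
and `∑ ⊓̄ᴿ(y) w' = w ◁ a` by `baseLeft_lam`. -/
theorem rightAct_relProd (hd : d.IsFull) (hc : c.IsFull) (v : V) (w : W) (a : A) :
    (relProd hr c d).rightAct a (RelTensor.proj _ _ (v ⊗ₜ w)) =
      RelTensor.proj _ _ (v ⊗ₜ d.rightAct a w) := by
  have h1 := LinearMap.congr_fun (isInduced_relProd hr (c := c) (d := d)).1 ((v ⊗ₜ w) ⊗ₜ a)
  rw [LinearMap.comp_apply, LinearMap.rTensor_tmul, LinearMap.comp_apply, prodLam_tmul] at h1
  rw [rightAct_apply, h1, ← map_sliceRight, ← hd.baseLeft_lam hr]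
  generalize d.lam (w ⊗ₜ a) = t
  induction t with
  | zero => simp
  | add x y hx hy => simp only [map_add, TensorProduct.tmul_add, hx, hy]
  | tmul w y =>
    rw [prodLamAux_tmul, ← map_sliceRight]
    change RelTensor.proj _ _ (c.rightAct y v ⊗ₜ w) =
      RelTensor.proj _ _ (v ⊗ₜ d.baseLeft hr (H.toBase y) w)
    rw [← hc.baseRight_toBase, RelTensor.proj_balanced]

theorem leftAct_relProd (hd : d.IsFull) (hc : c.IsFull) (v : V) (w : W) (a : A) :
    (relProd hr c d).leftAct a (RelTensor.proj _ _ (v ⊗ₜ w)) =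
      RelTensor.proj _ _ (c.leftAct a v ⊗ₜ w) := by
  have h1 := LinearMap.congr_fun (isInduced_relProd hr (c := c) (d := d)).2 ((v ⊗ₜ w) ⊗ₜ a)
  rw [LinearMap.comp_apply, LinearMap.rTensor_tmul, LinearMap.comp_apply, prodRho_tmul] at h1
  rw [leftAct_apply, h1, ← map_sliceRight, ← hc.baseRight_rho hr]
  generalize c.rho (v ⊗ₜ a) = t
  induction t with
  | zero => simp
  | add x y hx hy => simp only [map_add, TensorProduct.add_tmul, hx, hy]
  | tmul v y =>
    rw [prodRhoAux_tmul, ← map_sliceRight]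
    change RelTensor.proj _ _ (v ⊗ₜ d.leftAct y w) =
      RelTensor.proj _ _ (c.baseRight (toBase' hr y) v ⊗ₜ w)
    rw [← hd.baseLeft_toBase' hr, RelTensor.proj_balanced]

/-- A subspace modulo which the coaction vanishes contains every element `x ◁ a`. These span `V ⊗_R
W`, because `(v ⊗ w) ◁ a = v ⊗ (w ◁ a)` and the elements `w ◁ a` span `W`. -/
theorem relProd_isFull (hc : c.IsFull) (hd : d.IsFull) : (relProd hr c d).IsFull := by
  refine isFull_of fun X hX => ?_
  have h1 : ∀ a x, (relProd hr c d).rightAct a x ∈ X := fun a x => by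
    rw [← Submodule.Quotient.mk_eq_zero X, ← Submodule.mkQ_apply, rightAct_apply, map_sliceRight,
      hX, map_zero]
  rw [eq_top_iff]
  rintro x -
  obtain ⟨x, rfl⟩ := RelTensor.proj_surjective x
  induction x with
  | zero => simp
  | add x y hx hy => rw [map_add]; exact X.add_mem hx hy
  | tmul v w =>
    obtain ⟨t, rfl⟩ := d.rightAct_surjective hd w
    induction t with
    | zero => simp
    | add x y hx hy => rw [map_add, TensorProduct.tmul_add, map_add]; exact X.add_mem hx hy
    | tmul a w =>
      rw [TensorProduct.lift.tmul, ← rightAct_relProd hr hd hc]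
      exact h1 _ _

/-- An equality of structures on one and the same space; this is what makes the forgetful functor
strict on monoidal products. -/
theorem bimod_relProd (hc : c.IsFull) (hd : d.IsFull) :
    (relProd_isFull hr hc hd).bimod hr = (hc.bimod hr).tensor (hd.bimod hr) := by
  refine BimoduleStr.ext (LinearMap.ext fun r => RelTensor.hom_ext fun v w => ?_)
    (LinearMap.ext fun r => RelTensor.hom_ext fun v w => ?_)
  · exact leftAct_relProd hr hd hc v w _
  · exact rightAct_relProd hr hd hc v w _

end RightComod

end WeakMultiplier
end

/-! ### The base algebra as a full comodule. -/

noncomputable section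

namespace WeakMultiplier

namespace RegularWeakMultiplierBialgebra

open FirmBimodules

variable {k : Type*} [Field k] {A : Type*} [NonUnitalRing A] [Module k A]
  [IsScalarTower k A A] [SMulCommClass k A A] (H : RegularWeakMultiplierBialgebra k A)
  (hr : LinearMap.range H.piR = LinearMap.range H.piBarR)

/-- The element `(1 ⊗ a) E` of `R ⊗ A`. -/
def baseR : A →ₗ[k] H.Base ⊗[k] A :=
  (toBase' hr).rTensor A ∘ₗ H.T₃ ∘ₗ (TensorProduct.comm k A A).toLinearMap ∘ₗ H.mulSection

theorem baseIncl_baseR (a : A) : H.baseIncl.rTensor A (H.baseR hr a) = H.rightE a := by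
  rw [baseR, LinearMap.comp_apply, ← LinearMap.rTensor_comp_apply]
  rfl

theorem ractAt_baseR (b a : A) :
    (ractAt b ∘ₗ H.baseIncl).rTensor A (H.baseR hr a) = H.E₂ (b ⊗ₜ a) := by
  rw [LinearMap.rTensor_comp_apply, baseIncl_baseR, ractAt_rightE]

theorem sliceRight_baseR (a : A) :
    sliceRight H.Base H.counit (H.baseR hr a) = toBase' hr a :=
  H.base_ext_ract fun b => by
    change (ractAt b ∘ₗ H.baseIncl) (sliceRight H.Base H.counit (H.baseR hr a)) = _
    rw [map_sliceRight, ractAt_baseR]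
    rfl

theorem baseIncl_rTensor_injective {V : Type*} [AddCommGroup V] [Module k V] :
    Function.Injective (H.baseIncl.rTensor V) := fun x y h =>
  H.base_tensor_ext fun b => by
    rw [LinearMap.rTensor_comp_apply, h, LinearMap.rTensor_comp_apply]

theorem mulL₂_baseL_lact (r : H.Base) (a b : A) :
    mulL₂ H.Base a (H.baseL (lact (H.baseIncl r) b)) =
      mulR₂ H.Base b (H.baseR hr (ract (H.baseIncl r) a)) := by
  apply H.baseIncl_rTensor_injective
  have h : ∀ t : H.Base ⊗[k] A, mulL₂ H.Base a ((lact (H.baseIncl r)).lTensor H.Base t) =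
      mulL₂ H.Base (ract (H.baseIncl r) a) t := by
    intro t
    induction t with
    | zero => simp
    | add x y hx hy => simp only [map_add, hx, hy]
    | tmul p q => simp [mul_lact]
  rw [baseL_lact, h, rTensor_mulL₂, mulL₂_baseL, rTensor_mulR₂, baseIncl_baseR]

/-- The map `λ(r ⊗ a) = E (1 ⊗ r a)`. -/
def baseLam : H.Base ⊗[k] A →ₗ[k] H.Base ⊗[k] A := H.baseL ∘ₗ TensorProduct.lift H.baseLact

/-- The map `ρ(r ⊗ a) = (1 ⊗ a r) E`. -/
def baseRho : H.Base ⊗[k] A →ₗ[k] H.Base ⊗[k] A := H.baseR hr ∘ₗ TensorProduct.lift H.baseRact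

theorem baseLam_tmul (r : H.Base) (a : A) :
    H.baseLam (r ⊗ₜ a) = H.baseL (lact (H.baseIncl r) a) := rfl

theorem lactAt_assoc_rTensor (x : A) (t : H.Base ⊗[k] A) (b : A) :
    (lactAt x ∘ₗ H.baseIncl).rTensor (A ⊗[k] A) (TensorProduct.assoc k H.Base A A (t ⊗ₜ b)) =
      TensorProduct.assoc k A A A ((lactAt x ∘ₗ H.baseIncl).rTensor A t ⊗ₜ b) := by
  induction t with
  | zero => simp
  | add x y hx hy => simp only [map_add, TensorProduct.add_tmul, hx, hy]
  | tmul p q => rfl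

/-- Tested on `x` in the first leg, the iterated coaction of `R` is left multiplication by `(E ⊗
1)(1 ⊗ E)(1 ⊗ 1 ⊗ r)`. The comodule axioms then become statements about `E`, `Δ` and `r` in `A ⊗ A ⊗
A`. -/
theorem lactAt_baseLam₂ (x : A) (r : H.Base) (t : A ⊗[k] A) :
    (lactAt x ∘ₗ H.baseIncl).rTensor (A ⊗[k] A)
        (leg12 H.baseLam A (leg13 H.baseLam A (r ⊗ₜ t))) =
      leg12 H.E₁ A (x ⊗ₜ H.E₁ ((lact (H.baseIncl r)).lTensor A t)) := by
  induction t with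
  | zero => simp
  | add x y hx hy => simp only [map_add, TensorProduct.tmul_add, hx, hy]
  | tmul a b =>
    rw [leg12_leg13_tmul, baseLam_tmul, LinearMap.lTensor_tmul, ← H.lactAt_baseL]
    generalize H.baseL (lact (H.baseIncl r) b) = t
    induction t with
    | zero => simp
    | add x y hx hy => simp only [map_add, TensorProduct.tmul_add, hx, hy]
    | tmul s y =>
      have h : (H.baseLam ∘ₗ tmulRight H.Base a) s = H.baseL (lact (H.baseIncl s) a) := rfl
      rw [LinearMap.rTensor_tmul, h, lactAt_assoc_rTensor, lactAt_baseL, LinearMap.rTensor_tmul,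
        leg12_tmul]
      rfl

/-- The base algebra as a comodule. -/
def baseComod : RightComod H H.Base where
  lam := H.baseLam
  rho := H.baseRho hr
  compat r a b := H.mulL₂_baseL_lact hr r a b
  norm := by
    refine TensorProduct.ext' fun r t => H.base_tensor_ext fun x => ?_
    have h : ∀ t, (lact (H.baseIncl r)).lTensor A (H.E₁ t) =
        H.E₁ ((lact (H.baseIncl r)).lTensor A t) := by
      intro t
      induction t with
      | zero => simp
      | add x y hx hy => simp only [map_add, hx, hy]
      | tmul p q => exact (H.E₁_lact (H.baseIncl_mem r) p q).symm
    rw [LinearMap.comp_apply, LinearMap.comp_apply, LinearMap.lTensor_tmul, lactAt_baseLam₂,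
      LinearMap.comp_apply, lactAt_baseLam₂, h, E₁_E₁]
  coassoc := by
    refine TensorProduct.ext_threefold' fun r a b => H.base_tensor_ext fun x => ?_
    have h : (lact (H.baseIncl r)).lTensor A (H.T₁ (a ⊗ₜ b)) =
        H.T₁ (lact (H.baseIncl r) a ⊗ₜ b) := (H.T₁_lact (H.baseIncl_mem r) a b).symm
    rw [LinearMap.comp_apply, LinearMap.comp_apply, LinearMap.lTensor_tmul, lactAt_baseLam₂, h,
      E₁_T₁_apply, leg12_E₁_T₁, LinearMap.comp_apply, leg12_tmul, rTensor_lTensor,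
      lactAt_assoc_rTensor, baseLam_tmul, lactAt_baseL]

/-- Since `A` is spanned by the elements `⊓̄ᴿ(q) p`, each `E (1 ⊗ a)` is a sum of values of the
coaction. Its first legs for `a = p q` are `⊓̄ᴿ(p₁)`, and right fullness turns these into all of
`R`. -/
theorem baseComod_isFull (hH : H.IsRightFull) : (H.baseComod hr).IsFull := by
  refine RightComod.isFull_of fun X hX => ?_
  have hfull : H.regularComod.IsFull := hH
  have h1 : X.mkQ.rTensor A ∘ₗ H.baseL = 0 := by
    refine LinearMap.ext fun x => ?_
    rw [LinearMap.zero_apply]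
    induction x using H.mul_induction with
    | h0 a b =>
      rw [← H.counit_T₄, ← E₁_T₄_apply]
      generalize H.T₄ (b ⊗ₜ a) = u
      induction u with
      | zero => simp
      | add x y hx hy => simp only [map_add, hx, hy, add_zero]
      | tmul p q => exact hX (H.toBase q) p
    | h1 a b ha hb => rw [map_add, ha, hb, add_zero]
  have h2 : X.mkQ ∘ₗ H.toBase = 0 := hfull.hom_ext fun p q => by
    have h3 := LinearMap.congr_fun h1 (p * q)
    rw [LinearMap.comp_apply, baseL_mul, ← LinearMap.rTensor_comp_apply] at h3
    rw [LinearMap.rTensor_zero]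
    exact h3
  rw [eq_top_iff]
  rintro r -
  obtain ⟨a, rfl⟩ := H.toBase_surjective r
  exact (Submodule.Quotient.mk_eq_zero X).1 (LinearMap.congr_fun h2 a)

theorem rightAct_baseComod (r : H.Base) (a : A) :
    (H.baseComod hr).rightAct a r = r * H.toBase a := by
  obtain ⟨b, rfl⟩ := H.toBase_surjective r
  rw [toBase_mul]
  exact H.sliceRight_baseL _

theorem leftAct_baseComod (r : H.Base) (a : A) :
    (H.baseComod hr).leftAct a r = toBase' hr a * r := by
  obtain ⟨b, rfl⟩ := H.toBase'_surjective hr r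
  have h : toBase' hr a * toBase' hr b = toBase' hr (ract (H.piR b) a) :=
    H.baseIncl_injective (H.piR_mul b a)
  rw [h]
  exact H.sliceRight_baseR hr _

theorem bimod_baseComod (hH : H.IsRightFull) :
    (H.baseComod_isFull hr hH).bimod hr = regular k H.Base := by
  refine BimoduleStr.ext (LinearMap.ext fun r => LinearMap.ext fun s => ?_)
    (LinearMap.ext fun r => LinearMap.ext fun s => ?_)
  · refine (H.leftAct_baseComod hr s _).trans ?_
    rw [toBase'_baseSection', regular_left]
  · refine (H.rightAct_baseComod hr s _).trans ?_
    rw [toBase_baseSection, regular_right]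

/-- `R` is itself a full comodule, hence a firm bimodule, and the resulting bimodule is the regular
one. -/
theorem isFirmAlgebra_base (hH : H.IsRightFull) : IsFirmAlgebra k H.Base where
  isFirm := H.bimod_baseComod (H.range_piR hH) hH ▸
    (H.baseComod_isFull (H.range_piR hH) hH).bimod_isFirm (H.range_piR hH)

end RegularWeakMultiplierBialgebra

end WeakMultiplier
end

/-! ### Isomorphisms along equal bimodule structures, and lifting of the coherence maps to
comodules. -/

noncomputable section

namespace FirmBimodules

namespace FirmBimod

variable {k : Type u} [Field k] {R : Type v} [NonUnitalRing R] [Module k R]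
  [IsScalarTower k R R] [SMulCommClass k R R] {M : Type v} [AddCommGroup M] [Module k M]

theorem mk_congr {s t : BimoduleStr k R M} (h : s = t) (hs : s.IsFirm) (ht : t.IsFirm) :
    FirmBimod.mk M s hs = FirmBimod.mk M t ht := by
  subst h
  rfl

/-- The identity map as an isomorphism between a bimodule and one with an equal structure. -/
def congrIso {s t : BimoduleStr k R M} (h : s = t) (hs : s.IsFirm) (ht : t.IsFirm) :
    FirmBimod.mk M s hs ≅ FirmBimod.mk M t ht := eqToIso (mk_congr h hs ht)

section Twisted

variable [hR : IsFirmAlgebra k R] (X Y Z : FirmBimod k R)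

/-- The identity map as an isomorphism to the tensor product with an equal bimodule structure. -/
def tensorCongr {s : BimoduleStr k R (RelTensor X.str.right Y.str.left)}
    (h : X.str.tensor Y.str = s) (hs : s.IsFirm) : X ⊗ Y ≅ FirmBimod.mk _ s hs :=
  congrIso h (BimoduleStr.tensor_isFirm X.firm Y.firm) hs

/-- With the structures `s` and `s'` kept as variables, the equalities can be substituted away,
after which the comparison isomorphisms are identities. The coherence isomorphisms below are
computed in the same way. -/
theorem tensorCongr_map {X Y X' Y' : FirmBimod k R}
    {s : BimoduleStr k R (RelTensor X.str.right Y.str.left)}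
    (h : X.str.tensor Y.str = s) (hs : s.IsFirm)
    {s' : BimoduleStr k R (RelTensor X'.str.right Y'.str.left)}
    (h' : X'.str.tensor Y'.str = s') (hs' : s'.IsFirm) (f : X ⟶ X') (g : Y ⟶ Y')
    (F : FirmBimod.mk _ s hs ⟶ FirmBimod.mk _ s' hs')
    (hF : ∀ x y, Hom.lin F (RelTensor.proj _ _ (x ⊗ₜ y)) =
      RelTensor.proj _ _ (Hom.lin f x ⊗ₜ Hom.lin g y)) :
    F = (tensorCongr X Y h hs).inv ≫ (f ⊗ₘ g) ≫ (tensorCongr X' Y' h' hs').hom := by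
  subst h h'
  exact hom_ext (RelTensor.hom_ext hF)

/-- The associator for tensor products with equal bimodule structures. -/
def assocCongr {s : BimoduleStr k R (RelTensor X.str.right Y.str.left)}
    (h : X.str.tensor Y.str = s) (hs : s.IsFirm)
    {s' : BimoduleStr k R (RelTensor s.right Z.str.left)}
    (h' : s.tensor Z.str = s') (hs' : s'.IsFirm)
    {t : BimoduleStr k R (RelTensor Y.str.right Z.str.left)}
    (e : Y.str.tensor Z.str = t) (ht : t.IsFirm)
    {t' : BimoduleStr k R (RelTensor X.str.right t.left)}
    (e' : X.str.tensor t = t') (ht' : t'.IsFirm) :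
    FirmBimod.mk _ s' hs' ≅ FirmBimod.mk _ t' ht' :=
  ((tensorCongr ⟨_, s, hs⟩ Z h' hs').symm ≪≫ ((tensorCongr X Y h hs).symm ⊗ᵢ .refl Z)) ≪≫
    α_ X Y Z ≪≫ ((.refl X ⊗ᵢ tensorCongr Y Z e ht) ≪≫ tensorCongr X ⟨_, t, ht⟩ e' ht')

theorem assocCongr_proj {s : BimoduleStr k R (RelTensor X.str.right Y.str.left)}
    (h : X.str.tensor Y.str = s) (hs : s.IsFirm)
    {s' : BimoduleStr k R (RelTensor s.right Z.str.left)}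
    (h' : s.tensor Z.str = s') (hs' : s'.IsFirm)
    {t : BimoduleStr k R (RelTensor Y.str.right Z.str.left)}
    (e : Y.str.tensor Z.str = t) (ht : t.IsFirm)
    {t' : BimoduleStr k R (RelTensor X.str.right t.left)}
    (e' : X.str.tensor t = t') (ht' : t'.IsFirm) (x : X.carrier) (y : Y.carrier)
    (z : Z.carrier) :
    Hom.lin (assocCongr X Y Z h hs h' hs' e ht e' ht').hom
      (RelTensor.proj _ _ (RelTensor.proj _ _ (x ⊗ₜ y) ⊗ₜ z)) =
      RelTensor.proj _ _ (x ⊗ₜ RelTensor.proj _ _ (y ⊗ₜ z)) := by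
  subst h h' e e'
  rfl

variable {s : BimoduleStr k R R} (h : regular k R = s) (hs : s.IsFirm)

/-- The identity map as an isomorphism to the unit with an equal bimodule structure. -/
def unitCongr : 𝟙_ (FirmBimod k R) ≅ FirmBimod.mk R s hs := congrIso h hR.isFirm hs

/-- The left unitor for equal bimodule structures. -/
def leftCongr {t : BimoduleStr k R (RelTensor s.right X.str.left)}
    (e : s.tensor X.str = t) (ht : t.IsFirm) : FirmBimod.mk _ t ht ≅ X :=
  ((tensorCongr ⟨R, s, hs⟩ X e ht).symm ≪≫ ((unitCongr h hs).symm ⊗ᵢ .refl X)) ≪≫ λ_ X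

theorem leftCongr_proj {t : BimoduleStr k R (RelTensor s.right X.str.left)}
    (e : s.tensor X.str = t) (ht : t.IsFirm) (r : R) (x : X.carrier) :
    Hom.lin (leftCongr X h hs e ht).hom (RelTensor.proj _ _ (r ⊗ₜ x)) = X.str.left r x := by
  subst h e
  exact BimoduleStr.leftMap_proj X.str r x

/-- The right unitor for equal bimodule structures. -/
def rightCongr {t : BimoduleStr k R (RelTensor X.str.right s.left)}
    (e : X.str.tensor s = t) (ht : t.IsFirm) : FirmBimod.mk _ t ht ≅ X :=
  ((tensorCongr X ⟨R, s, hs⟩ e ht).symm ≪≫ (.refl X ⊗ᵢ (unitCongr h hs).symm)) ≪≫ ρ_ X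

theorem rightCongr_proj {t : BimoduleStr k R (RelTensor X.str.right s.left)}
    (e : X.str.tensor s = t) (ht : t.IsFirm) (x : X.carrier) (r : R) :
    Hom.lin (rightCongr X h hs e ht).hom (RelTensor.proj _ _ (x ⊗ₜ r)) = X.str.right r x := by
  subst h e
  exact BimoduleStr.rightMap_proj X.str r x

end Twisted

end FirmBimod

end FirmBimodules

namespace WeakMultiplier

/-- The monoidal structure induced along a functor that preserves the unit and the monoidal product
of objects makes it a strict monoidal functor. -/
theorem isStrictMonoidal_induced {C D : Type*} [Category* C] [Category* D]
    [MonoidalCategoryStruct C] [MonoidalCategory D] (F : C ⥤ D) [F.Faithful]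
    (fData : Monoidal.InducingFunctorData F) (h0 : F.obj (𝟙_ C) = 𝟙_ D)
    (ht : ∀ X Y : C, F.obj (X ⊗ Y) = F.obj X ⊗ F.obj Y)
    (hε : fData.εIso = eqToIso h0.symm) (hμ : ∀ X Y, fData.μIso X Y = eqToIso (ht X Y).symm) :
    @IsStrictMonoidal C D _ _ (Monoidal.induced F fData) _ F := by
  let _ := Monoidal.induced F fData
  exact
    { obj_unit := h0
      obj_tensor := ht
      map_tensor := fun f g => by
        refine (fData.tensorHom_eq f g).trans ?_
        rw [hμ, hμ]
        simp
      map_associator := fun X Y Z => by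
        refine (fData.associator_eq X Y Z).trans ?_
        rw [hμ, hμ, hμ, hμ]
        simp [eqToHom_whiskerRight, whiskerLeft_eqToHom]
      map_leftUnitor := fun X => by
        refine (fData.leftUnitor_eq X).trans ?_
        rw [hμ, hε]
        simp [eqToHom_whiskerRight]
      map_rightUnitor := fun X => by
        refine (fData.rightUnitor_eq X).trans ?_
        rw [hμ, hε]
        simp [whiskerLeft_eqToHom] }

open FirmBimodules RegularWeakMultiplierBialgebra RightComod

namespace RightComod

variable {k : Type*} [Field k] {A : Type*} [NonUnitalRing A] [Module k A]
  [IsScalarTower k A A] [SMulCommClass k A A] {H : RegularWeakMultiplierBialgebra k A}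
  {V W P V' W' : Type*} [AddCommGroup V] [Module k V] [AddCommGroup W] [Module k W]
  [AddCommGroup P] [Module k P] [AddCommGroup V'] [Module k V'] [AddCommGroup W'] [Module k W']
  (hr : LinearMap.range H.piR = LinearMap.range H.piBarR)
  {c : RightComod H V} {d : RightComod H W} {e : RightComod H P}
  {c' : RightComod H V'} {d' : RightComod H W'}

theorem lam_relProd (v : V) (w : W) (a : A) :
    (relProd hr c d).lam (RelTensor.proj _ _ (v ⊗ₜ w) ⊗ₜ a) =
      (RelTensor.proj _ _).rTensor A (c.prodLamAux v (d.lam (w ⊗ₜ a))) :=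
  LinearMap.congr_fun (isInduced_relProd hr (c := c) (d := d)).1 ((v ⊗ₜ w) ⊗ₜ a)

theorem lam_symm {f : V →ₗ[k] W} {g : W →ₗ[k] V} (h1 : f ∘ₗ g = LinearMap.id)
    (h2 : g ∘ₗ f = LinearMap.id)
    (h : ∀ v a, d.lam (f v ⊗ₜ a) = f.rTensor A (c.lam (v ⊗ₜ a))) (w : W) (a : A) :
    c.lam (g w ⊗ₜ a) = g.rTensor A (d.lam (w ⊗ₜ a)) := by
  have h3 := h (g w) a
  rw [show f (g w) = w from LinearMap.congr_fun h1 w] at h3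
  rw [h3, ← LinearMap.rTensor_comp_apply, h2, LinearMap.rTensor_id_apply]

theorem lam_relProd_map {f : V →ₗ[k] V'} {g : W →ₗ[k] W'}
    (hf : ∀ v a, c'.lam (f v ⊗ₜ a) = f.rTensor A (c.lam (v ⊗ₜ a)))
    (hg : ∀ w a, d'.lam (g w ⊗ₜ a) = g.rTensor A (d.lam (w ⊗ₜ a)))
    {F : RelTensor c.baseRight (d.baseLeft hr) →ₗ[k] RelTensor c'.baseRight (d'.baseLeft hr)}
    (hF : ∀ v w, F (RelTensor.proj _ _ (v ⊗ₜ w)) = RelTensor.proj _ _ (f v ⊗ₜ g w))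
    (x : RelTensor c.baseRight (d.baseLeft hr)) (a : A) :
    (relProd hr c' d').lam (F x ⊗ₜ a) = F.rTensor A ((relProd hr c d).lam (x ⊗ₜ a)) := by
  obtain ⟨x, rfl⟩ := RelTensor.proj_surjective x
  induction x with
  | zero => simp
  | add x y hx hy => simp only [map_add, TensorProduct.add_tmul, hx, hy]
  | tmul v w =>
    rw [hF, lam_relProd, lam_relProd, hg]
    generalize d.lam (w ⊗ₜ a) = t
    induction t with
    | zero => simp
    | add x y hx hy => simp only [map_add, hx, hy]
    | tmul w y =>
      rw [LinearMap.rTensor_tmul, prodLamAux_tmul, prodLamAux_tmul, hf]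
      generalize c.lam (v ⊗ₜ y) = t
      induction t with
      | zero => simp
      | add x y hx hy => simp only [map_add, hx, hy]
      | tmul v z =>
        simp only [LinearMap.rTensor_tmul, TensorProduct.mk_apply, LinearMap.flip_apply, hF]

/-- Both bracketings have the coaction `v₀ ⊗ w₀ ⊗ p₀ ⊗ v₁ w₁ p₁ a`. -/
theorem lam_relProd_assoc
    {F : RelTensor (relProd hr c d).baseRight (e.baseLeft hr) →ₗ[k]
      RelTensor c.baseRight ((relProd hr d e).baseLeft hr)}
    (hF : ∀ v w p, F (RelTensor.proj _ _ (RelTensor.proj _ _ (v ⊗ₜ w) ⊗ₜ p)) =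
      RelTensor.proj _ _ (v ⊗ₜ RelTensor.proj _ _ (w ⊗ₜ p)))
    (x : RelTensor (relProd hr c d).baseRight (e.baseLeft hr)) (a : A) :
    (relProd hr c (relProd hr d e)).lam (F x ⊗ₜ a) =
      F.rTensor A ((relProd hr (relProd hr c d) e).lam (x ⊗ₜ a)) := by
  obtain ⟨x, rfl⟩ := RelTensor.proj_surjective x
  induction x with
  | zero => simp
  | add x y hx hy => simp only [map_add, TensorProduct.add_tmul, hx, hy]
  | tmul x p =>
  obtain ⟨x, rfl⟩ := RelTensor.proj_surjective x
  induction x with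
  | zero => simp
  | add x y hx hy => simp only [map_add, TensorProduct.add_tmul, hx, hy]
  | tmul v w =>
    rw [hF, lam_relProd, lam_relProd, lam_relProd]
    generalize e.lam (p ⊗ₜ a) = t
    induction t with
    | zero => simp
    | add x y hx hy => simp only [map_add, hx, hy]
    | tmul p y =>
      rw [prodLamAux_tmul, prodLamAux_tmul, lam_relProd]
      generalize d.lam (w ⊗ₜ y) = t
      induction t with
      | zero => simp
      | add x y hx hy => simp only [map_add, hx, hy]
      | tmul w y =>
        rw [prodLamAux_tmul, LinearMap.rTensor_tmul, LinearMap.rTensor_tmul, prodLamAux_tmul]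
        generalize c.lam (v ⊗ₜ y) = t
        induction t with
        | zero => simp
        | add x y hx hy => simp only [map_add, hx, hy]
        | tmul v z =>
          simp only [LinearMap.rTensor_tmul, TensorProduct.mk_apply, LinearMap.flip_apply, hF]

/-- `baseLeftE_lam` gives `λ(r w ⊗ a) = E (1 ⊗ r) λ(w ⊗ a)`, with the first leg of `E` acting on `W`
through `R`. This is the coaction `E (1 ⊗ r y)` of `R` applied to the leg `y` of `λ(w ⊗ a)`. -/
theorem lam_relProd_left (hd : d.IsFull)
    {F : RelTensor (H.baseComod hr).baseRight (d.baseLeft hr) →ₗ[k] W}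
    (hF : ∀ r w, F (RelTensor.proj _ _ (r ⊗ₜ w)) = d.baseLeft hr r w)
    (x : RelTensor (H.baseComod hr).baseRight (d.baseLeft hr)) (a : A) :
    d.lam (F x ⊗ₜ a) = F.rTensor A ((relProd hr (H.baseComod hr) d).lam (x ⊗ₜ a)) := by
  obtain ⟨x, rfl⟩ := RelTensor.proj_surjective x
  induction x with
  | zero => simp
  | add x y hx hy => simp only [map_add, TensorProduct.add_tmul, hx, hy]
  | tmul r w =>
    rw [hF, lam_relProd, ← hd.baseLeftE_lam hr, lam_baseLeft]
    generalize d.lam (w ⊗ₜ a) = t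
    induction t with
    | zero => simp
    | add x y hx hy => simp only [map_add, hx, hy]
    | tmul w y =>
      have h : (H.baseComod hr).lam (r ⊗ₜ y) = H.baseL (lact (H.baseIncl r) y) := rfl
      rw [prodLamAux_tmul, LinearMap.lTensor_tmul, baseLeftE_tmul, h]
      generalize H.baseL (lact (H.baseIncl r) y) = t
      induction t with
      | zero => simp
      | add x y hx hy => simp only [map_add, hx, hy]
      | tmul r z =>
        simp only [LinearMap.rTensor_tmul, TensorProduct.mk_apply, LinearMap.flip_apply, hF]

/-- `λ(v r ⊗ a) = λ(v ⊗ r a)`, and `lamBaseRight_baseL` expands this along `E (1 ⊗ r a)`, which is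
the coaction of `R`. -/
theorem lam_relProd_right (hc : c.IsFull)
    {F : RelTensor c.baseRight ((H.baseComod hr).baseLeft hr) →ₗ[k] V}
    (hF : ∀ v r, F (RelTensor.proj _ _ (v ⊗ₜ r)) = c.baseRight r v)
    (x : RelTensor c.baseRight ((H.baseComod hr).baseLeft hr)) (a : A) :
    c.lam (F x ⊗ₜ a) = F.rTensor A ((relProd hr c (H.baseComod hr)).lam (x ⊗ₜ a)) := by
  obtain ⟨x, rfl⟩ := RelTensor.proj_surjective x
  induction x with
  | zero => simp
  | add x y hx hy => simp only [map_add, TensorProduct.add_tmul, hx, hy]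
  | tmul v r =>
    have h : (H.baseComod hr).lam (r ⊗ₜ a) = H.baseL (lact (H.baseIncl r) a) := rfl
    rw [hF, lam_relProd, lam_baseRight, ← hc.lamBaseRight_baseL, h]
    generalize H.baseL (lact (H.baseIncl r) a) = t
    induction t with
    | zero => simp
    | add x y hx hy => simp only [map_add, hx, hy]
    | tmul s y =>
      rw [prodLamAux_tmul, lamBaseRight_tmul]
      generalize c.lam (v ⊗ₜ y) = t
      induction t with
      | zero => simp
      | add x y hx hy => simp only [map_add, hx, hy]
      | tmul v z =>
        simp only [LinearMap.rTensor_tmul, TensorProduct.mk_apply, LinearMap.flip_apply, hF]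

end RightComod

namespace FullComod

variable {k : Type u} [Field k] {A : Type v} [NonUnitalRing A] [Module k A]
  [IsScalarTower k A A] [SMulCommClass k A A] {H : RegularWeakMultiplierBialgebra k A}

/-- A linear map compatible with `λ` is a morphism of comodules. -/
def homMk {X Y : FullComod H} (f : X.carrier →ₗ[k] Y.carrier)
    (h : ∀ x a, Y.str.lam (f x ⊗ₜ a) = f.rTensor A (X.str.lam (x ⊗ₜ a))) : X ⟶ Y where
  lin := f
  comm_lam := TensorProduct.ext' h
  -- `λ` determines `ρ` through `compat` and non-degeneracy.
  comm_rho := TensorProduct.ext' fun x a => cancel_mulR₂ H.right_nondeg fun b => by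
    rw [LinearMap.comp_apply, LinearMap.rTensor_tmul, ← Y.str.compat, h, LinearMap.comp_apply,
      ← rTensor_mulL₂, X.str.compat, rTensor_mulR₂]

theorem hom_lam {X Y : FullComod H} (f : X ⟶ Y) (x : X.carrier) (a : A) :
    Y.str.lam (Hom.lin f x ⊗ₜ a) = (Hom.lin f).rTensor A (X.str.lam (x ⊗ₜ a)) :=
  LinearMap.congr_fun (Hom.comm_lam f) (x ⊗ₜ a)

variable (hr : LinearMap.range H.piR = LinearMap.range H.piBarR)

/-- The forgetful functor to the firm bimodules over the base algebra. -/
def forget : FullComod H ⥤ FirmBimod k H.Base where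
  obj V := ⟨V.carrier, V.full.bimod hr, V.full.bimod_isFirm hr⟩
  map f := ⟨Hom.lin f,
    fun r x => (BaseActions.map_slice _ _ _).trans
      (congrArg _ (LinearMap.congr_fun (Hom.comm_rho f) (x ⊗ₜ H.baseSection' hr r)).symm),
    fun r x => (BaseActions.map_slice _ _ _).trans
      (congrArg _ (LinearMap.congr_fun (Hom.comm_lam f) (x ⊗ₜ H.baseSection r)).symm)⟩
  map_id _ := rfl
  map_comp _ _ := rfl

instance : (forget hr).Faithful where
  map_injective h := Hom.ext (congrArg FirmBimod.Hom.lin h)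

/-- An isomorphism of bimodules that is compatible with `λ` is an isomorphism of comodules. -/
def isoMk {X Y : FullComod H} (e : (forget hr).obj X ≅ (forget hr).obj Y)
    (h : ∀ x a, Y.str.lam (FirmBimod.Hom.lin e.hom x ⊗ₜ a) =
      LinearMap.rTensor A (FirmBimod.Hom.lin e.hom) (X.str.lam (x ⊗ₜ a))) : X ≅ Y where
  hom := homMk (FirmBimod.Hom.lin e.hom) h
  inv := homMk (FirmBimod.Hom.lin e.inv) (lam_symm (d := Y.str) (c := X.str)
    (f := FirmBimod.Hom.lin e.hom) (g := FirmBimod.Hom.lin e.inv)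
    (congrArg FirmBimod.Hom.lin e.inv_hom_id) (congrArg FirmBimod.Hom.lin e.hom_inv_id) h)
  hom_inv_id := Hom.ext (congrArg FirmBimod.Hom.lin e.hom_inv_id)
  inv_hom_id := Hom.ext (congrArg FirmBimod.Hom.lin e.inv_hom_id)

/-- The comodule `X ⊗_R Y`. -/
def tensor (X Y : FullComod H) : FullComod H where
  carrier := RelTensor X.str.baseRight (Y.str.baseLeft hr)
  str := relProd hr X.str Y.str
  full := relProd_isFull hr X.full Y.full

theorem forget_tensor (X Y : FullComod H) : (forget hr).obj (tensor hr X Y) =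
    FirmBimod.tensor ((forget hr).obj X) ((forget hr).obj Y) :=
  FirmBimod.mk_congr (bimod_relProd hr X.full Y.full) _ _

/-- The comodule map `f ⊗_R g`. -/
def tensorMap {X X' Y Y' : FullComod H} (f : X ⟶ X') (g : Y ⟶ Y') :
    tensor hr X Y ⟶ tensor hr X' Y' :=
  homMk (X := tensor hr X Y) (Y := tensor hr X' Y')
    (RelTensor.map (Hom.lin f) (Hom.lin g) (FirmBimod.Hom.map_right ((forget hr).map f))
      (FirmBimod.Hom.map_left ((forget hr).map g)))
    (lam_relProd_map hr (hom_lam f) (hom_lam g) (RelTensor.map_proj _ _ _ _))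

theorem tensorMap_proj {X X' Y Y' : FullComod H} (f : X ⟶ X') (g : Y ⟶ Y') (x : X.carrier)
    (y : Y.carrier) : Hom.lin (tensorMap hr f g) (RelTensor.proj _ _ (x ⊗ₜ y)) =
      RelTensor.proj X'.str.baseRight (Y'.str.baseLeft hr) (Hom.lin f x ⊗ₜ Hom.lin g y) := rfl

/-- The base algebra as a full comodule. -/
def unit (hH : H.IsRightFull) : FullComod H where
  carrier := H.Base
  str := H.baseComod hr
  full := H.baseComod_isFull hr hH

variable [hR : IsFirmAlgebra k H.Base]

theorem forget_unit (hH : H.IsRightFull) : (forget hr).obj (unit hr hH) =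
    FirmBimod.unit k H.Base :=
  FirmBimod.mk_congr (H.bimod_baseComod hr hH) _ _

/-- The identity map as an isomorphism between the tensor products of bimodules and comodules. -/
def tensorIso (X Y : FullComod H) :
    (forget hr).obj X ⊗ (forget hr).obj Y ≅ (forget hr).obj (tensor hr X Y) :=
  FirmBimod.tensorCongr ((forget hr).obj X) ((forget hr).obj Y)
    (bimod_relProd hr X.full Y.full).symm ((relProd_isFull hr X.full Y.full).bimod_isFirm hr)

/-- The identity map as an isomorphism between the units. -/
def unitIso (hH : H.IsRightFull) : 𝟙_ (FirmBimod k H.Base) ≅ (forget hr).obj (unit hr hH) :=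
  FirmBimod.unitCongr (H.bimod_baseComod hr hH).symm ((H.baseComod_isFull hr hH).bimod_isFirm hr)

/-- The associator of the bimodules underlying comodules. -/
def forgetAssoc (X Y Z : FullComod H) : (forget hr).obj (tensor hr (tensor hr X Y) Z) ≅
    (forget hr).obj (tensor hr X (tensor hr Y Z)) :=
  FirmBimod.assocCongr ((forget hr).obj X) ((forget hr).obj Y) ((forget hr).obj Z)
    (bimod_relProd hr X.full Y.full).symm (tensor hr X Y |>.full.bimod_isFirm hr)
    (bimod_relProd hr (tensor hr X Y).full Z.full).symm
    (tensor hr (tensor hr X Y) Z |>.full.bimod_isFirm hr)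
    (bimod_relProd hr Y.full Z.full).symm (tensor hr Y Z |>.full.bimod_isFirm hr)
    (bimod_relProd hr X.full (tensor hr Y Z).full).symm
    (tensor hr X (tensor hr Y Z) |>.full.bimod_isFirm hr)

/-- The left unitor of the bimodule underlying a comodule. -/
def forgetLeft (hH : H.IsRightFull) (X : FullComod H) :
    (forget hr).obj (tensor hr (unit hr hH) X) ≅ (forget hr).obj X :=
  FirmBimod.leftCongr ((forget hr).obj X) (H.bimod_baseComod hr hH).symm
    ((unit hr hH).full.bimod_isFirm hr) (bimod_relProd hr (unit hr hH).full X.full).symm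
    (tensor hr (unit hr hH) X |>.full.bimod_isFirm hr)

/-- The right unitor of the bimodule underlying a comodule. -/
def forgetRight (hH : H.IsRightFull) (X : FullComod H) :
    (forget hr).obj (tensor hr X (unit hr hH)) ≅ (forget hr).obj X :=
  FirmBimod.rightCongr ((forget hr).obj X) (H.bimod_baseComod hr hH).symm
    ((unit hr hH).full.bimod_isFirm hr) (bimod_relProd hr X.full (unit hr hH).full).symm
    (tensor hr X (unit hr hH) |>.full.bimod_isFirm hr)

theorem forget_map_isoMk {X Y : FullComod H} (e : (forget hr).obj X ≅ (forget hr).obj Y)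
    (h : ∀ x a, Y.str.lam (FirmBimod.Hom.lin e.hom x ⊗ₜ a) =
      LinearMap.rTensor A (FirmBimod.Hom.lin e.hom) (X.str.lam (x ⊗ₜ a))) :
    (forget hr).map (isoMk hr e h).hom = e.hom := rfl

end FullComod

end WeakMultiplier
end

/-! ### The monoidal category of full comodules and the strictness of the forgetful functor. -/

noncomputable section

namespace WeakMultiplier

open FirmBimodules RegularWeakMultiplierBialgebra RightComod

namespace FullComod

variable {k : Type u} [Field k] {A : Type v} [NonUnitalRing A] [Module k A]
  [IsScalarTower k A A] [SMulCommClass k A A] {H : RegularWeakMultiplierBialgebra k A}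
  (hr : LinearMap.range H.piR = LinearMap.range H.piBarR) [hR : IsFirmAlgebra k H.Base]

theorem forgetAssoc_proj (X Y Z : FullComod H) (x : X.carrier) (y : Y.carrier) (z : Z.carrier) :
    FirmBimod.Hom.lin (forgetAssoc hr X Y Z).hom
      (RelTensor.proj (tensor hr X Y).str.baseRight (Z.str.baseLeft hr)
        (RelTensor.proj X.str.baseRight (Y.str.baseLeft hr) (x ⊗ₜ y) ⊗ₜ z)) =
      RelTensor.proj X.str.baseRight ((tensor hr Y Z).str.baseLeft hr)
        (x ⊗ₜ RelTensor.proj Y.str.baseRight (Z.str.baseLeft hr) (y ⊗ₜ z)) :=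
  FirmBimod.assocCongr_proj ((forget hr).obj X) ((forget hr).obj Y) ((forget hr).obj Z)
    _ _ _ _ _ _ _ _ x y z

theorem forgetLeft_proj (hH : H.IsRightFull) (X : FullComod H) (r : H.Base) (x : X.carrier) :
    FirmBimod.Hom.lin (forgetLeft hr hH X).hom
      (RelTensor.proj (H.baseComod hr).baseRight (X.str.baseLeft hr) (r ⊗ₜ x)) =
      X.str.baseLeft hr r x :=
  FirmBimod.leftCongr_proj ((forget hr).obj X) _ _ _ _ r x

theorem forgetRight_proj (hH : H.IsRightFull) (X : FullComod H) (x : X.carrier) (r : H.Base) :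
    FirmBimod.Hom.lin (forgetRight hr hH X).hom
      (RelTensor.proj X.str.baseRight ((H.baseComod hr).baseLeft hr) (x ⊗ₜ r)) =
      X.str.baseRight r x :=
  FirmBimod.rightCongr_proj ((forget hr).obj X) _ _ _ _ x r

/-- The monoidal product, the unit and the coherence isomorphisms of full comodules. -/
@[reducible]
def monoidalStruct (hH : H.IsRightFull) : MonoidalCategoryStruct (FullComod H) where
  tensorObj := tensor hr
  whiskerLeft X _ _ f := tensorMap hr (𝟙 X) f
  whiskerRight f Y := tensorMap hr f (𝟙 Y)
  tensorHom := tensorMap hr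
  tensorUnit := unit hr hH
  associator X Y Z := isoMk hr (forgetAssoc hr X Y Z) (lam_relProd_assoc hr
    (F := FirmBimod.Hom.lin (forgetAssoc hr X Y Z).hom) (forgetAssoc_proj hr X Y Z))
  leftUnitor X := isoMk hr (forgetLeft hr hH X) (lam_relProd_left hr X.full
    (F := FirmBimod.Hom.lin (forgetLeft hr hH X).hom) (forgetLeft_proj hr hH X))
  rightUnitor X := isoMk hr (forgetRight hr hH X) (lam_relProd_right hr X.full
    (F := FirmBimod.Hom.lin (forgetRight hr hH X).hom) (forgetRight_proj hr hH X))

theorem forget_tensorMap {X X' Y Y' : FullComod H} (f : X ⟶ X') (g : Y ⟶ Y') :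
    (forget hr).map (tensorMap hr f g) = (tensorIso hr X Y).inv ≫
      ((forget hr).map f ⊗ₘ (forget hr).map g) ≫ (tensorIso hr X' Y').hom :=
  FirmBimod.tensorCongr_map (X := (forget hr).obj X) (Y := (forget hr).obj Y)
    (X' := (forget hr).obj X') (Y' := (forget hr).obj Y') _ _ _ _ ((forget hr).map f)
    ((forget hr).map g) ((forget hr).map (tensorMap hr f g)) (tensorMap_proj hr f g)

/-- The data exhibiting the monoidal structure as induced from the one of firm bimodules. -/
def inducingData (hH : H.IsRightFull) : letI := monoidalStruct hr hH
    Monoidal.InducingFunctorData (forget hr) :=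
  letI := monoidalStruct hr hH
  { μIso := tensorIso hr
    εIso := unitIso hr hH
    whiskerLeft_eq := fun X _ _ f => by
      rw [← id_tensorHom, ← (forget hr).map_id]
      exact forget_tensorMap hr (𝟙 X) f
    whiskerRight_eq := fun f Y => by
      rw [← tensorHom_id, ← (forget hr).map_id]
      exact forget_tensorMap hr f (𝟙 Y)
    tensorHom_eq := forget_tensorMap hr
    associator_eq := fun X Y Z => forget_map_isoMk hr (forgetAssoc hr X Y Z) _
    leftUnitor_eq := fun X => forget_map_isoMk hr (forgetLeft hr hH X) _
    rightUnitor_eq := fun X => forget_map_isoMk hr (forgetRight hr hH X) _ }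

end FullComod

end WeakMultiplier
end

theorem mainTheorem3 {k : Type u} [Field k] {A : Type v} [NonUnitalRing A] [Module k A]
    [IsScalarTower k A A] [SMulCommClass k A A] (H : RegularWeakMultiplierBialgebra k A)
    (hH : H.IsRightFull) :
    ∃ (_ : IsFirmAlgebra k H.base) (B : BaseActions H) (_ : MonoidalCategory (FullComod H)),
      (∃ (c : RightComod H H.base) (hc : c.IsFull),
        c.IsBaseComod ∧ 𝟙_ (FullComod H) = FullComod.mk H.base c hc) ∧
      (∀ V W : FullComod H,
        ∃ (c : RightComod H (B.functor.obj V ⊗ B.functor.obj W).carrier) (hc : c.IsFull),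
          RightComod.IsInduced V.str W.str
            (FirmBimod.proj (B.functor.obj V) (B.functor.obj W)) c ∧
          V ⊗ W = FullComod.mk (B.functor.obj V ⊗ B.functor.obj W).carrier c hc) ∧
      IsStrictMonoidal B.functor := by
  have hr := H.range_piR hH
  have hR : IsFirmAlgebra k H.Base := H.isFirmAlgebra_base hH
  let _ := FullComod.monoidalStruct hr hH
  -- The monoidal axioms are inherited from firm bimodules through the faithful forgetful functor.
  refine ⟨hR, baseActions H hr, Monoidal.induced (FullComod.forget hr)
    (FullComod.inducingData hr hH), ⟨H.baseComod hr, H.baseComod_isFull hr hH, ⟨?_, ?_⟩, rfl⟩,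
    fun V W => ⟨RightComod.relProd hr V.str W.str, RightComod.relProd_isFull hr V.full W.full,
      RightComod.isInduced_relProd hr, rfl⟩, ?_⟩
  · exact fun r a b => H.lactAt_baseL b _
  · exact fun r a b => H.ractAt_baseR hr b _
  -- The comparison isomorphisms `unitIso` and `tensorIso` are by construction transports along
  -- equalities of bimodules, which is all that strictness requires.
  · exact isStrictMonoidal_induced (FullComod.forget hr) (FullComod.inducingData hr hH)
      (FullComod.forget_unit hr hH) (FullComod.forget_tensor hr) rfl fun _ _ => rfl
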